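/- **Conventions.** Let $\widehat f(\xi)=(2\pi)^{-n/2}\int_{\mathbf R^n} f(x)e^{-i\langle x,\xi\rangle}\,dx$. For $s,h>0$ let $\mathcal S_{s,h}(\mathbf R^n)$ be the space of all $f\in C^\infty(\mathbf R^n)$ with $$\|f\|_{\mathcal S_{s,h}}=\sup_{\alpha,\beta,x}\frac{|x^\beta\partial^\alpha f(x)|}{h^{|\alpha|+|\beta|}\alpha!^s\beta!^s}<\infty ,$$ let $\mathcal S_s=\bigcup_{h>0}\mathcal S_{s,h}$ be the Gelfand–Shilov space, and let $\mathcal S_s'$ be the space of linear forms on $\mathcal S_s$ that are bounded on every $\mathcal S_{s,h}$; it carries the weak-$*$ topology here. Functions $a\in\mathcal S_s$, $s\ge\frac12$, are regarded as elements $g\mapsto\int ag\,dx$ of $\mathcal S_{1/2}'$. The short-time Fourier transform is $$V_\phi f(x,\xi)=(2\pi)^{-n/2}\int f(y)\overline{\phi(y-x)}e^{-i\langle y,\xi\rangle}\,dy ,$$ and $V_\phi u(x,\xi)=(2\pi)^{-n/2}\langle u,\overline{\phi(\cdot-x)}e^{-i\langle\cdot,\xi\rangle}\rangle$ for $u\in\mathcal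 S_{1/2}'(\mathbf R^n)$, $\phi\in\mathcal S_{1/2}(\mathbf R^n)$. A weight is a function $\omega>0$ with $\omega,1/\omega\in L^\infty_{loc}$; $\mathscr P_E(\mathbf R^m)$ is the set of weights $\omega$ on $\mathbf R^m$ such that $\omega(x+y)\le C\omega(x)v(y)$ for all $x,y$, for some weight $v$ and some constant $C>0$. For $p,q\in(0,\infty]$, $\omega\in\mathscr P_E(\mathbf R^{2n})$ and a window $\phi\in\mathcal S_{1/2}(\mathbf R^n)\setminus 0$, the modulation space $M^{p,q}_{(\omega)}(\mathbf R^n)$ consists of all $u\in\mathcal S_{1/2}'(\mathbf R^n)$ for which $$\|u\|_{M^{p,q}_{(\omega)}}=\Big\|\,\xi\mapsto\|V_\phi u(\cdot,\xi)\,\omega(\cdot,\xi)\|_{L^p(\mathbf R^n)}\Big\|_{L^q(\mathbf R^n)}<\infty ,$$ with the topology of this quasi-norm. For a real $d\times d$ matrix $A$ with transpose $A^*$, let $T_A=e^{i\langle AD_\xi,D_x\rangle}$, that is, $\widehat{T_Aa}(\eta,y)=e^{i\langle Ay,\eta\rangle}\,\widehat a(\eta,y)$ for functions $a(x,\xi)$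 on $\mathbf R^{2d}$, where $(\eta,y)$ is dual to $(x,\xi)$. **Proposition.** Let $s\ge\frac12$, let $A$ be a real $d\times d$ matrix, and let $p,q\in(0,\infty]$. 1. $T_A$ maps $\mathcal S_s(\mathbf R^{2d})$ into itself, and for all $\phi,a\in\mathcal S_s(\mathbf R^{2d})$ and $x,\xi,\eta,y\in\mathbf R^d$, $$(V_{T_A\phi}(T_Aa))(x,\xi,\eta,y)=e^{i\langle Ay,\eta\rangle}\,(V_\phi a)(x+Ay,\ \xi+A^*\eta,\ \eta,\ y).$$ 2. $T_A$ on $\mathcal S_s(\mathbf R^{2d})$ extends to a linear and continuous map $T_A:\mathcal S_{1/2}'(\mathbf R^{2d})\to\mathcal S_{1/2}'(\mathbf R^{2d})$ with the following properties. Let $\omega\in\mathscr P_E(\mathbf R^{4d})$ and $$\omega_A(x,\xi,\eta,y)=\omega(x+Ay,\ \xi+A^*\eta,\ \eta,\ y).$$ Then $\omega_A\in\mathscr P_E(\mathbf R^{4d})$, and for every choice of windows $\phi,\psi\in\mathcal S_{1/2}(\mathbf R^{2d})\setminus0$ in the definitions of $M^{p,q}_{(\omega)}(\mathbf R^{2d})$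 and $M^{p,q}_{(\omega_A)}(\mathbf R^{2d})$, respectively: * $T_A$ restricts to a homeomorphism from $M^{p,q}_{(\omega)}(\mathbf R^{2d})$ onto $M^{p,q}_{(\omega_A)}(\mathbf R^{2d})$. * This extension is unique: if $R:M^{p,q}_{(\omega)}(\mathbf R^{2d})\to M^{p,q}_{(\omega_A)}(\mathbf R^{2d})$ agrees with $T_A$ on $\mathcal S_s(\mathbf R^{2d})\cap M^{p,q}_{(\omega)}(\mathbf R^{2d})$, and if $R$ is continuous for the topologies induced by $\mathcal S_{1/2}'(\mathbf R^{2d})$, or $p,q<\infty$ and $R$ is continuous for the quasi-norm topologies, then $R=T_A$ on $M^{p,q}_{(\omega)}(\mathbf R^{2d})$. * There is a constant $C$ such that $C^{-1}\|u\|_{M^{p,q}_{(\omega)}}\le\|T_Au\|_{M^{p,q}_{(\omega_A)}}\le C\|u\|_{M^{p,q}_{(\omega)}}$ for all $u\in\mathcal S_{1/2}'(\mathbf R^{2d})$ (the quasi-norms may be $+\infty$). -/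

import Mathlib

open MeasureTheory Topology
open scoped NNReal RealInnerProductSpace ComplexConjugate

noncomputable section

section GelfandShilov

open scoped ContDiff

/-! ### Gelfand-Shilov spaces and their duals

`EuclideanSpace ℝ ι` is `ℝⁿ` with `n` the number of elements of `ι`. -/

/-- The factorial `α! = ∏ j, (α j)!` of a multi-index. -/
def multiFact {ι : Type*} [Fintype ι] (α : ι → ℕ) : ℕ := ∏ j, (α j).factorial

/-- The multi-index `α` of the mixed partial derivative `∂_{σ 0} ⋯ ∂_{σ (k-1)}`:
`α j` is the number of differentiations in the `j`-th variable. -/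
def indexOf {ι : Type*} [DecidableEq ι] {k : ℕ} (σ : Fin k → ι) (j : ι) : ℕ :=
  (Finset.univ.filter fun i => σ i = j).card

/-- The mixed partial derivative `∂_{σ 0} ⋯ ∂_{σ (k-1)} f (x)`. It is `∂^α f (x)` for `α = indexOf σ`,
with `|α| = k`, and every multi-index is of this form. -/
def partialDeriv {ι : Type*} [Fintype ι] [DecidableEq ι] {k : ℕ} (σ : Fin k → ι)
    (f : EuclideanSpace ℝ ι → ℂ) (x : EuclideanSpace ℝ ι) : ℂ :=
  iteratedFDeriv ℝ k f x fun i => EuclideanSpace.single (σ i) (1 : ℝ)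

/-- The norm `sup |x^β ∂^α f(x)| / (h^{|α|+|β|} α!^s β!^s)` of `𝒮_{s,h}`, with values in `[0,∞]`;
the supremum is over all multi-indices `α = indexOf σ` and `β`, and all points `x`. -/
def gsNorm {ι : Type*} [Fintype ι] [DecidableEq ι] (s h : ℝ) (f : EuclideanSpace ℝ ι → ℂ) : ENNReal :=
  ⨆ (k : ℕ) (σ : Fin k → ι) (β : ι → ℕ) (x : EuclideanSpace ℝ ι),
    ENNReal.ofReal (((∏ j, |x j| ^ β j) * ‖partialDeriv σ f x‖) /
      (h ^ (k + ∑ j, β j) * (multiFact (indexOf σ) : ℝ) ^ s * (multiFact β : ℝ) ^ s))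

lemma gsNorm_le_iff {ι : Type*} [Fintype ι] [DecidableEq ι] {s h : ℝ} (hh : 0 < h)
    {f : EuclideanSpace ℝ ι → ℂ} {C : ℝ} (hC : 0 ≤ C) :
    gsNorm s h f ≤ ENNReal.ofReal C ↔ ∀ (k : ℕ) (σ : Fin k → ι) (β : ι → ℕ) (x),
      (∏ j, |x j| ^ β j) * ‖partialDeriv σ f x‖ ≤
        C * (h ^ (k + ∑ j, β j) * (multiFact (indexOf σ) : ℝ) ^ s * (multiFact β : ℝ) ^ s) := by
  have hpos : ∀ α : ι → ℕ, (0 : ℝ) < multiFact α := fun α => by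
    unfold multiFact
    exact_mod_cast Finset.prod_pos fun j _ => Nat.factorial_pos _
  simp only [gsNorm, iSup_le_iff]
  refine forall₄_congr fun k σ β x => ?_
  have h1 := Real.rpow_pos_of_pos (hpos (indexOf σ)) s
  have h2 := Real.rpow_pos_of_pos (hpos β) s
  rw [ENNReal.ofReal_le_ofReal_iff hC, div_le_iff₀ (by positivity)]

lemma gsNorm_lt_top_iff {ι : Type*} [Fintype ι] [DecidableEq ι] {s h : ℝ} (hh : 0 < h)
    {f : EuclideanSpace ℝ ι → ℂ} :
    gsNorm s h f < ⊤ ↔ ∃ C : ℝ, 0 ≤ C ∧ ∀ (k : ℕ) (σ : Fin k → ι) (β : ι → ℕ) (x),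
      (∏ j, |x j| ^ β j) * ‖partialDeriv σ f x‖ ≤
        C * (h ^ (k + ∑ j, β j) * (multiFact (indexOf σ) : ℝ) ^ s * (multiFact β : ℝ) ^ s) := by
  constructor
  · intro hf
    refine ⟨(gsNorm s h f).toReal, ENNReal.toReal_nonneg, ?_⟩
    rw [← gsNorm_le_iff hh ENNReal.toReal_nonneg, ENNReal.ofReal_toReal hf.ne]
  · rintro ⟨C, hC, hf⟩
    exact ((gsNorm_le_iff hh hC).2 hf).trans_lt ENNReal.ofReal_lt_top

lemma partialDeriv_add {ι : Type*} [Fintype ι] [DecidableEq ι] {k : ℕ} (σ : Fin k → ι)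
    {f g : EuclideanSpace ℝ ι → ℂ} (hf : ContDiff ℝ ∞ f) (hg : ContDiff ℝ ∞ g) (x) :
    partialDeriv σ (f + g) x = partialDeriv σ f x + partialDeriv σ g x := by
  have h : ((k : ℕ∞) : WithTop ℕ∞) ≤ ∞ := by exact_mod_cast le_top
  unfold partialDeriv
  rw [iteratedFDeriv_add_apply (hf.of_le h).contDiffAt (hg.of_le h).contDiffAt]
  rfl

lemma partialDeriv_smul {ι : Type*} [Fintype ι] [DecidableEq ι] {k : ℕ} (σ : Fin k → ι)
    {f : EuclideanSpace ℝ ι → ℂ} (c : ℂ) (hf : ContDiff ℝ ∞ f) (x) :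
    partialDeriv σ (c • f) x = c * partialDeriv σ f x := by
  have h : ((k : ℕ∞) : WithTop ℕ∞) ≤ ∞ := by exact_mod_cast le_top
  unfold partialDeriv
  rw [iteratedFDeriv_const_smul_apply (hf.of_le h).contDiffAt]
  rfl

/-- The Gelfand-Shilov space `𝒮_s(ℝⁿ) = ⋃_{h > 0} 𝒮_{s,h}(ℝⁿ)`. -/
def GSSpace (s : ℝ) (ι : Type*) [Fintype ι] [DecidableEq ι] :
    Submodule ℂ (EuclideanSpace ℝ ι → ℂ) where
  carrier := {f | ContDiff ℝ ∞ f ∧ ∃ h : ℝ, 0 < h ∧ gsNorm s h f < ⊤}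
  zero_mem' := by
    refine ⟨contDiff_const, 1, one_pos, (gsNorm_lt_top_iff one_pos).2 ⟨0, le_rfl, ?_⟩⟩
    intro k σ β x
    have h0 := partialDeriv_smul σ (0 : ℂ) (f := (0 : EuclideanSpace ℝ ι → ℂ)) contDiff_zero_fun x
    rw [smul_zero, zero_mul] at h0
    rw [h0]
    simp
  add_mem' := by
    rintro f g ⟨hf, h₁, hh₁, hf'⟩ ⟨hg, h₂, hh₂, hg'⟩
    obtain ⟨C₁, hC₁, hf'⟩ := (gsNorm_lt_top_iff hh₁).1 hf'
    obtain ⟨C₂, hC₂, hg'⟩ := (gsNorm_lt_top_iff hh₂).1 hg'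
    have hm : 0 < max h₁ h₂ := lt_max_of_lt_left hh₁
    refine ⟨hf.add hg, max h₁ h₂, hm, (gsNorm_lt_top_iff hm).2 ⟨C₁ + C₂, by positivity, ?_⟩⟩
    intro k σ β x
    have hp : 0 ≤ ∏ j, |x j| ^ β j := by positivity
    have e₁ : h₁ ^ (k + ∑ j, β j) ≤ (max h₁ h₂) ^ (k + ∑ j, β j) := by
      gcongr
      exact le_max_left _ _
    have e₂ : h₂ ^ (k + ∑ j, β j) ≤ (max h₁ h₂) ^ (k + ∑ j, β j) := by
      gcongr
      exact le_max_right _ _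
    rw [partialDeriv_add σ hf hg]
    calc (∏ j, |x j| ^ β j) * ‖partialDeriv σ f x + partialDeriv σ g x‖
        ≤ (∏ j, |x j| ^ β j) * ‖partialDeriv σ f x‖ +
          (∏ j, |x j| ^ β j) * ‖partialDeriv σ g x‖ := by
          rw [← mul_add]
          gcongr
          exact norm_add_le _ _
      _ ≤ _ := add_le_add (hf' k σ β x) (hg' k σ β x)
      _ ≤ _ := by
          rw [add_mul]
          gcongr
  smul_mem' := by
    rintro c f ⟨hf, h, hh, hf'⟩
    obtain ⟨C, hC, hf'⟩ := (gsNorm_lt_top_iff hh).1 hf'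
    refine ⟨contDiff_const.smul hf, h, hh,
      (gsNorm_lt_top_iff hh).2 ⟨‖c‖ * C, by positivity, ?_⟩⟩
    intro k σ β x
    rw [partialDeriv_smul σ c hf, norm_mul, mul_left_comm, mul_assoc]
    exact mul_le_mul_of_nonneg_left (hf' k σ β x) (norm_nonneg c)

lemma multiFact_indexOf_le {ι : Type*} [Fintype ι] [DecidableEq ι] {k : ℕ} (σ : Fin k → ι) :
    multiFact (indexOf σ) ≤ k.factorial ∧
      k.factorial ≤ Fintype.card ι ^ k * multiFact (indexOf σ) := by
  have hs : ∑ j, indexOf σ j = k := by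
    have := Finset.card_eq_sum_card_fiberwise (f := σ) (s := Finset.univ) (t := Finset.univ)
      (fun _ _ => by simp)
    simpa [indexOf] using this.symm
  have hd : multiFact (indexOf σ) ∣ k.factorial := by
    have := Nat.prod_factorial_dvd_factorial_sum Finset.univ (indexOf σ)
    rwa [hs] at this
  refine ⟨Nat.le_of_dvd (Nat.factorial_pos _) hd, ?_⟩
  have h1 := Nat.multinomial_spec Finset.univ (indexOf σ)
  rw [hs] at h1
  rw [← h1, mul_comm]
  refine Nat.mul_le_mul_right _ ?_
  have h2 := Finset.sum_pow_eq_sum_piAntidiag (R := ℕ) (Finset.univ : Finset ι) (fun _ => 1) k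
  simp only [Finset.sum_const, Finset.card_univ, smul_eq_mul, mul_one, one_pow,
    Finset.prod_const_one] at h2
  rw [h2]
  refine Finset.single_le_sum (f := fun a => Nat.multinomial Finset.univ a)
    (fun _ _ => Nat.zero_le _) ?_
  simp [Finset.mem_piAntidiag, hs]

/-- The same space described by operator norms of derivatives. -/
lemma mem_GSSpace_iff {ι : Type*} [Fintype ι] [DecidableEq ι] {s : ℝ} (hs : 0 ≤ s)
    {f : EuclideanSpace ℝ ι → ℂ} :
    f ∈ GSSpace s ι ↔ ContDiff ℝ ∞ f ∧ ∃ h : ℝ, 0 < h ∧ ∃ C : ℝ, 0 ≤ C ∧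
      ∀ (k l : ℕ) (x), ‖x‖ ^ l * ‖iteratedFDeriv ℝ k f x‖ ≤
        C * (h ^ (k + l) * (k.factorial : ℝ) ^ s * (l.factorial : ℝ) ^ s) := by
  have hpos : ∀ n : ℕ, (0 : ℝ) < n.factorial := fun n => by exact_mod_cast n.factorial_pos
  constructor
  · rintro ⟨hf, h, hh, hb⟩
    obtain ⟨C, hC, hb⟩ := (gsNorm_lt_top_iff hh).1 hb
    set n : ℝ := (Fintype.card ι : ℝ) with hn
    refine ⟨hf, (n + 1) * h, by positivity, C, hC, fun k l x => ?_⟩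
    have key : ∀ j : ι, ∀ σ : Fin k → ι, |x j| ^ l * ‖partialDeriv σ f x‖ ≤
        C * (h ^ (k + l) * (k.factorial : ℝ) ^ s * (l.factorial : ℝ) ^ s) := by
      intro j σ
      have := hb k σ (Pi.single j l) x
      have e1 : ∏ i, |x i| ^ (Pi.single j l : ι → ℕ) i = |x j| ^ l := by
        rw [Finset.prod_eq_single j] <;> simp +contextual
      have e2 : ∑ i, (Pi.single j l : ι → ℕ) i = l := by simp
      have e3 : multiFact (Pi.single j l : ι → ℕ) = l.factorial := by
        unfold multiFact
        rw [Finset.prod_eq_single j] <;> simp +contextual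
      rw [e1, e2, e3] at this
      refine this.trans ?_
      gcongr
      exact_mod_cast (multiFact_indexOf_le σ).1
    have key0 : ∀ σ : Fin k → ι, ‖x‖ ^ l * ‖partialDeriv σ f x‖ ≤
        C * (((n + 1) ^ l * h ^ (k + l)) * (k.factorial : ℝ) ^ s * (l.factorial : ℝ) ^ s) := by
      intro σ
      have hx : ‖x‖ = 0 ∨ ∃ j, ‖x‖ ≤ n * |x j| := by
        rcases isEmpty_or_nonempty ι with hι | hι
        · left
          rw [norm_eq_zero]
          exact Subsingleton.elim _ _
        · right
          obtain ⟨j, hj⟩ := Finite.exists_max fun j => |x j|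
          refine ⟨j, ?_⟩
          have h1 : ‖x‖ ≤ ∑ i, |x i| := by
            rw [EuclideanSpace.norm_eq, Real.sqrt_le_left (by positivity)]
            simpa using Finset.sum_sq_le_sq_sum_of_nonneg (s := Finset.univ)
              (f := fun i => |x i|) (fun i _ => abs_nonneg _)
          refine h1.trans ((Finset.sum_le_sum fun i _ => hj i).trans ?_)
          simp [hn]
      have hn1 : 1 ≤ (n + 1) ^ l := one_le_pow₀ (by simp [hn])
      rcases hx with hx | ⟨j, hj⟩
      · rcases Nat.eq_zero_or_pos l with rfl | hl
        · have := hb k σ 0 x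
          simp only [Pi.zero_apply, pow_zero, Finset.prod_const_one, one_mul, Finset.sum_const_zero,
            add_zero, multiFact, Nat.factorial_zero, Nat.cast_one, Real.one_rpow, mul_one] at this ⊢
          refine this.trans ?_
          gcongr
          exact_mod_cast (multiFact_indexOf_le σ).1
        · rw [hx, zero_pow hl.ne', zero_mul]
          positivity
      · calc ‖x‖ ^ l * ‖partialDeriv σ f x‖ ≤ (n * |x j|) ^ l * ‖partialDeriv σ f x‖ := by gcongr
          _ = n ^ l * (|x j| ^ l * ‖partialDeriv σ f x‖) := by ring
          _ ≤ (n + 1) ^ l * (C * (h ^ (k + l) * (k.factorial : ℝ) ^ s * (l.factorial : ℝ) ^ s)) := by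
              gcongr ?_ ^ l * ?_
              · linarith
              · exact key j σ
          _ = _ := by ring
    have hop : ‖iteratedFDeriv ℝ k f x‖ ≤ ∑ σ : Fin k → ι, ‖partialDeriv σ f x‖ := by
      refine ContinuousMultilinearMap.opNorm_le_bound (by positivity) fun v => ?_
      have hv : v = fun i => ∑ j, v i j • EuclideanSpace.single j (1 : ℝ) := by
        funext i
        ext a
        simp [Finset.sum_apply, Pi.single_apply]
      have hexp : iteratedFDeriv ℝ k f x v =
          ∑ σ : Fin k → ι, (∏ i, v i (σ i)) • partialDeriv σ f x := by
        conv_lhs => rw [hv]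
        rw [ContinuousMultilinearMap.map_sum]
        refine Finset.sum_congr rfl fun σ _ => ?_
        rw [ContinuousMultilinearMap.map_smul_univ]
        rfl
      rw [hexp, Finset.sum_mul]
      refine (norm_sum_le _ _).trans (Finset.sum_le_sum fun σ _ => ?_)
      rw [norm_smul, mul_comm, norm_prod]
      gcongr with i
      exact PiLp.norm_apply_le (v i) (σ i)
    calc ‖x‖ ^ l * ‖iteratedFDeriv ℝ k f x‖
        ≤ ‖x‖ ^ l * ∑ σ : Fin k → ι, ‖partialDeriv σ f x‖ := by gcongr
      _ = ∑ σ : Fin k → ι, ‖x‖ ^ l * ‖partialDeriv σ f x‖ := Finset.mul_sum _ _ _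
      _ ≤ ∑ _σ : Fin k → ι,
          C * (((n + 1) ^ l * h ^ (k + l)) * (k.factorial : ℝ) ^ s * (l.factorial : ℝ) ^ s) :=
          Finset.sum_le_sum fun σ _ => key0 σ
      _ = n ^ k *
          (C * (((n + 1) ^ l * h ^ (k + l)) * (k.factorial : ℝ) ^ s * (l.factorial : ℝ) ^ s)) := by
          simp [hn]
      _ ≤ (n + 1) ^ k *
          (C * (((n + 1) ^ l * h ^ (k + l)) * (k.factorial : ℝ) ^ s * (l.factorial : ℝ) ^ s)) := by
          gcongr
          linarith
      _ = _ := by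
          rw [mul_pow, pow_add (n + 1)]
          ring
  · rintro ⟨hf, h, hh, C, hC, hb⟩
    set n : ℝ := (Fintype.card ι : ℝ) with hn
    have hN : 1 ≤ (n + 1) ^ s := Real.one_le_rpow (by simp [hn]) hs
    refine ⟨hf, (n + 1) ^ s * h, by positivity, (gsNorm_lt_top_iff (by positivity)).2
      ⟨C, hC, fun k σ β x => ?_⟩⟩
    have e1 : ∏ j, |x j| ^ β j ≤ ‖x‖ ^ ∑ j, β j := by
      rw [← Finset.prod_pow_eq_pow_sum]
      gcongr with j
      exact PiLp.norm_apply_le x j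
    have e2 : ‖partialDeriv σ f x‖ ≤ ‖iteratedFDeriv ℝ k f x‖ := by
      refine (ContinuousMultilinearMap.le_opNorm _ _).trans ?_
      simp
    have aux : ∀ m : ℕ, ∀ τ : Fin m → ι,
        (m.factorial : ℝ) ^ s ≤ ((n + 1) ^ s) ^ m * (multiFact (indexOf τ) : ℝ) ^ s := by
      intro m τ
      rw [Real.rpow_pow_comm (by positivity), ← Real.mul_rpow (by positivity) (by positivity)]
      refine Real.rpow_le_rpow (by positivity) ?_ hs
      have := (multiFact_indexOf_le τ).2
      have h3 : (m.factorial : ℝ) ≤ n ^ m * multiFact (indexOf τ) := by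
        rw [hn]
        exact_mod_cast this
      refine h3.trans ?_
      gcongr
      linarith
    obtain ⟨τ, hτ⟩ : ∃ τ : Fin (∑ j, β j) → ι, indexOf τ = β := by
      have e : (Σ j, Fin (β j)) ≃ Fin (∑ j, β j) := Fintype.equivFinOfCardEq (by simp)
      refine ⟨fun i => (e.symm i).1, funext fun j => ?_⟩
      unfold indexOf
      rw [← Fintype.card_subtype, ← Fintype.card_fin (β j)]
      have sigmaFst : {z : Σ j, Fin (β j) // z.1 = j} ≃ Fin (β j) :=
        Equiv.sigmaSubtype j
      refine Fintype.card_congr ((e.symm.subtypeEquiv (p := fun i => (e.symm i).1 = j)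
        (q := fun z => z.1 = j) fun _ => Iff.rfl).trans sigmaFst)
    have a1 := aux k σ
    have a2 := aux _ τ
    rw [hτ] at a2
    calc (∏ j, |x j| ^ β j) * ‖partialDeriv σ f x‖
        ≤ ‖x‖ ^ (∑ j, β j) * ‖iteratedFDeriv ℝ k f x‖ := by gcongr
      _ ≤ C * (h ^ (k + ∑ j, β j) * (k.factorial : ℝ) ^ s * ((∑ j, β j).factorial : ℝ) ^ s) :=
          hb _ _ x
      _ ≤ C * (h ^ (k + ∑ j, β j) * (((n + 1) ^ s) ^ k * (multiFact (indexOf σ) : ℝ) ^ s) *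
          (((n + 1) ^ s) ^ (∑ j, β j) * (multiFact β : ℝ) ^ s)) := by gcongr
      _ = _ := by
          rw [mul_pow ((n + 1) ^ s), pow_add ((n + 1) ^ s)]
          ring

lemma iteratedDeriv_cexp_real (j : ℕ) :
    iteratedDeriv j (fun t : ℝ => Complex.exp (-Complex.I * t)) =
      fun t : ℝ => (-Complex.I) ^ j * Complex.exp (-Complex.I * t) := by
  induction j with
  | zero => simp
  | succ j ih =>
    rw [iteratedDeriv_succ, ih]
    funext t
    have h1 : HasDerivAt (fun t : ℝ => -Complex.I * (t : ℂ)) (-Complex.I) t := by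
      simpa using (Complex.ofRealCLM.hasDerivAt (x := t)).const_mul (-Complex.I)
    have h2 := (h1.cexp.const_mul ((-Complex.I) ^ j)).deriv
    rw [h2]
    ring

/-- The time-frequency shift `y ↦ conj (φ (y - X)) e^{-i⟨y, Ξ⟩}` of the conjugate of a window. -/
def tfShift {ι : Type*} [Fintype ι] (φ : EuclideanSpace ℝ ι → ℂ) (X Ξ : EuclideanSpace ℝ ι) :
    EuclideanSpace ℝ ι → ℂ :=
  fun y => conj (φ (y - X)) * Complex.exp (-(Complex.I * (⟪y, Ξ⟫ : ℝ)))

lemma tfShift_mem {ι : Type*} [Fintype ι] [DecidableEq ι] {s : ℝ} (hs : 0 ≤ s)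
    {φ : EuclideanSpace ℝ ι → ℂ} (hφ : φ ∈ GSSpace s ι) (X Ξ : EuclideanSpace ℝ ι) :
    tfShift φ X Ξ ∈ GSSpace s ι := by
  rw [mem_GSSpace_iff hs] at hφ ⊢
  obtain ⟨hf, h, hh, C, hC, hb⟩ := hφ
  set u : EuclideanSpace ℝ ι → ℂ := fun y => conj (φ (y - X)) with hu
  set e : EuclideanSpace ℝ ι → ℂ :=
    fun y => Complex.exp (-(Complex.I * (⟪y, Ξ⟫ : ℝ))) with he
  have hg : ContDiff ℝ ∞ fun t : ℝ => Complex.exp (-Complex.I * t) := by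
    exact ContDiff.cexp (contDiff_const.mul Complex.ofRealCLM.contDiff)
  have he' : e = (fun t : ℝ => Complex.exp (-Complex.I * t)) ∘ (innerSL ℝ Ξ) := by
    funext y
    simp [he, real_inner_comm]
  have hce : ContDiff ℝ ∞ e := by
    rw [he']
    exact hg.comp (innerSL ℝ Ξ).contDiff
  have hcu0 : ContDiff ℝ ∞ fun y => φ (y - X) := hf.comp (contDiff_id.sub contDiff_const)
  have hcu : ContDiff ℝ ∞ u := Complex.conjLIE.contDiff.comp hcu0
  have ne : ∀ j y, ‖iteratedFDeriv ℝ j e y‖ ≤ ‖Ξ‖ ^ j := by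
    intro j y
    have hj : ((j : ℕ∞) : WithTop ℕ∞) ≤ ∞ := by exact_mod_cast le_top
    rw [he', ContinuousLinearMap.iteratedFDeriv_comp_right _ hg y hj]
    refine (ContinuousMultilinearMap.norm_compContinuousLinearMap_le _ _).trans ?_
    rw [norm_iteratedFDeriv_eq_norm_iteratedDeriv]
    have hd := congrFun (iteratedDeriv_cexp_real j) (innerSL ℝ Ξ y)
    rw [hd]
    simp [Complex.norm_exp]
  have nu : ∀ j y, ‖iteratedFDeriv ℝ j u y‖ = ‖iteratedFDeriv ℝ j φ (y - X)‖ := by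
    intro j y
    have : u = Complex.conjLIE ∘ fun y => φ (y - X) := rfl
    rw [this, LinearIsometryEquiv.norm_iteratedFDeriv_comp_left, iteratedFDeriv_comp_sub]
  refine ⟨hcu.mul hce, 2 * (h + ‖Ξ‖ + ‖X‖), by positivity, 2 * C, by positivity,
    fun k l y => ?_⟩
  have hk : ((k : ℕ∞) : WithTop ℕ∞) ≤ ∞ := by exact_mod_cast le_top
  have hL := norm_iteratedFDeriv_mul_le hcu hce y hk
  have one_fact : ∀ n : ℕ, (1 : ℝ) ≤ (n.factorial : ℝ) ^ s := fun n =>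
    Real.one_le_rpow (by exact_mod_cast n.factorial_pos) hs
  have hterm : ∀ i ∈ Finset.range (k + 1), ‖y‖ ^ l * ‖iteratedFDeriv ℝ i u y‖ ≤
      h ^ i * (2 * C * ((2 * (h + ‖X‖)) ^ l * (k.factorial : ℝ) ^ s * (l.factorial : ℝ) ^ s)) := by
    intro i hi
    have hik : (i.factorial : ℝ) ^ s ≤ (k.factorial : ℝ) ^ s :=
      Real.rpow_le_rpow (by positivity)
        (by exact_mod_cast Nat.factorial_le (Nat.lt_succ_iff.1 (Finset.mem_range.1 hi))) hs
    have hy : ‖y‖ ^ l ≤ 2 ^ l * (‖y - X‖ ^ l + ‖X‖ ^ l) := by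
      have h1 : ‖y‖ ≤ ‖y - X‖ + ‖X‖ := by simpa using norm_add_le (y - X) X
      refine (pow_le_pow_left₀ (norm_nonneg _) h1 l).trans
        ((add_pow_le (norm_nonneg _) (norm_nonneg _) l).trans ?_)
      gcongr
      · norm_num
      · omega
    rw [nu]
    have b1 := hb i l (y - X)
    have b0 := hb i 0 (y - X)
    simp only [pow_zero, one_mul, add_zero, Nat.factorial_zero, Nat.cast_one, Real.one_rpow,
      mul_one] at b0
    have p1 : h ^ l ≤ (h + ‖X‖) ^ l := by
      gcongr
      linarith [norm_nonneg X]
    have p2 : ‖X‖ ^ l ≤ (h + ‖X‖) ^ l := by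
      gcongr
      linarith
    calc ‖y‖ ^ l * ‖iteratedFDeriv ℝ i φ (y - X)‖
        ≤ 2 ^ l * (‖y - X‖ ^ l + ‖X‖ ^ l) * ‖iteratedFDeriv ℝ i φ (y - X)‖ := by gcongr
      _ = 2 ^ l * (‖y - X‖ ^ l * ‖iteratedFDeriv ℝ i φ (y - X)‖ +
          ‖X‖ ^ l * ‖iteratedFDeriv ℝ i φ (y - X)‖) := by ring
      _ ≤ 2 ^ l * (C * (h ^ (i + l) * (k.factorial : ℝ) ^ s * (l.factorial : ℝ) ^ s) +
          (h + ‖X‖) ^ l * (C * (h ^ i * (k.factorial : ℝ) ^ s * (l.factorial : ℝ) ^ s))) := by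
          refine mul_le_mul_of_nonneg_left (add_le_add (b1.trans (by gcongr)) ?_) (by positivity)
          refine mul_le_mul p2 (b0.trans ?_) (norm_nonneg _) (by positivity)
          rw [mul_assoc (h ^ i)]
          gcongr
          exact hik.trans (le_mul_of_one_le_right (by positivity) (one_fact l))
      _ = 2 ^ l * h ^ i * C * ((k.factorial : ℝ) ^ s * (l.factorial : ℝ) ^ s) *
          (h ^ l + (h + ‖X‖) ^ l) := by
          rw [pow_add]
          ring
      _ ≤ 2 ^ l * h ^ i * C * ((k.factorial : ℝ) ^ s * (l.factorial : ℝ) ^ s) *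
          ((h + ‖X‖) ^ l + (h + ‖X‖) ^ l) := by gcongr
      _ = _ := by
          rw [mul_pow 2]
          ring
  set K := 2 * C * ((2 * (h + ‖X‖)) ^ l * (k.factorial : ℝ) ^ s * (l.factorial : ℝ) ^ s) with hK
  calc ‖y‖ ^ l * ‖iteratedFDeriv ℝ k (tfShift φ X Ξ) y‖
      ≤ ‖y‖ ^ l * ∑ i ∈ Finset.range (k + 1),
          (k.choose i : ℝ) * ‖iteratedFDeriv ℝ i u y‖ * ‖iteratedFDeriv ℝ (k - i) e y‖ := by
        gcongr
        exact hL
    _ = ∑ i ∈ Finset.range (k + 1), (‖y‖ ^ l * ‖iteratedFDeriv ℝ i u y‖) *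
          ‖iteratedFDeriv ℝ (k - i) e y‖ * (k.choose i : ℝ) := by
        rw [Finset.mul_sum]
        exact Finset.sum_congr rfl fun i _ => by ring
    _ ≤ ∑ i ∈ Finset.range (k + 1), (h ^ i * K) * ‖Ξ‖ ^ (k - i) * (k.choose i : ℝ) := by
        refine Finset.sum_le_sum fun i hi => ?_
        exact mul_le_mul_of_nonneg_right (mul_le_mul (hterm i hi) (ne _ _) (norm_nonneg _)
          (by positivity)) (by positivity)
    _ = (h + ‖Ξ‖) ^ k * K := by
        rw [add_pow, Finset.sum_mul]
        exact Finset.sum_congr rfl fun i _ => by ring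
    _ = 2 * C * (((h + ‖Ξ‖) ^ k * (2 * (h + ‖X‖)) ^ l) * (k.factorial : ℝ) ^ s *
          (l.factorial : ℝ) ^ s) := by
        rw [hK]
        ring
    _ ≤ 2 * C * (((2 * (h + ‖Ξ‖ + ‖X‖)) ^ k * (2 * (h + ‖Ξ‖ + ‖X‖)) ^ l) *
          (k.factorial : ℝ) ^ s * (l.factorial : ℝ) ^ s) := by
        have := norm_nonneg X
        have := norm_nonneg Ξ
        gcongr <;> linarith
    _ = _ := by rw [← pow_add]

end GelfandShilov

/-- A linear form on `𝒮_s(ℝⁿ)` that is bounded on each normed space `𝒮_{s,h}(ℝⁿ)`, `h > 0`. -/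
def IsGSBounded {s : ℝ} {ι : Type*} [Fintype ι] [DecidableEq ι] (u : GSSpace s ι →ₗ[ℂ] ℂ) : Prop :=
  ∀ h : ℝ, 0 < h → ∃ C : ℝ≥0, ∀ f : GSSpace s ι,
    ‖u f‖ₑ ≤ C * gsNorm s h (f : EuclideanSpace ℝ ι → ℂ)

lemma IsGSBounded.add {s : ℝ} {ι : Type*} [Fintype ι] [DecidableEq ι] {u v : GSSpace s ι →ₗ[ℂ] ℂ}
    (hu : IsGSBounded u) (hv : IsGSBounded v) : IsGSBounded (u + v) := by
  intro h hh
  obtain ⟨C, hC⟩ := hu h hh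
  obtain ⟨D, hD⟩ := hv h hh
  refine ⟨C + D, fun f => ?_⟩
  rw [ENNReal.coe_add, add_mul, LinearMap.add_apply]
  exact (enorm_add_le (u f) (v f)).trans (add_le_add (hC f) (hD f))

lemma IsGSBounded.smul {s : ℝ} {ι : Type*} [Fintype ι] [DecidableEq ι] {u : GSSpace s ι →ₗ[ℂ] ℂ}
    (c : ℂ) (hu : IsGSBounded u) : IsGSBounded (c • u) := by
  intro h hh
  obtain ⟨C, hC⟩ := hu h hh
  refine ⟨‖c‖₊ * C, fun f => ?_⟩
  rw [LinearMap.smul_apply, smul_eq_mul, enorm_mul, ENNReal.coe_mul, ← enorm_eq_nnnorm, mul_assoc]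
  exact mul_le_mul' le_rfl (hC f)

/-- The dual `𝒮_s'(ℝⁿ) = ⋂_{h > 0} 𝒮_{s,h}'(ℝⁿ)` as a subspace of the algebraic dual of `𝒮_s`. -/
def gsDual (s : ℝ) (ι : Type*) [Fintype ι] [DecidableEq ι] :
    Submodule ℂ (GSSpace s ι →ₗ[ℂ] ℂ) where
  carrier := {u | IsGSBounded u}
  zero_mem' := fun h _ => ⟨0, fun f => by simp⟩
  add_mem' := IsGSBounded.add
  smul_mem' c _ hu := IsGSBounded.smul c hu

/-- The space `𝒮_s'(ℝⁿ)` of Gelfand-Shilov distributions. -/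
def GSDual (s : ℝ) (ι : Type*) [Fintype ι] [DecidableEq ι] : Type _ := gsDual s ι

instance (s : ℝ) (ι : Type*) [Fintype ι] [DecidableEq ι] : AddCommGroup (GSDual s ι) :=
  inferInstanceAs (AddCommGroup (gsDual s ι))

instance (s : ℝ) (ι : Type*) [Fintype ι] [DecidableEq ι] : Module ℂ (GSDual s ι) :=
  inferInstanceAs (Module ℂ (gsDual s ι))

/-- The pairing `⟨u, g⟩` of a distribution and a test function, linear in both. -/
def GSDual.pairing {s : ℝ} {ι : Type*} [Fintype ι] [DecidableEq ι] (u : GSDual s ι)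
    (g : GSSpace s ι) : ℂ :=
  (show gsDual s ι from u).1 g

/-- The weak-* topology of `𝒮_s'(ℝⁿ)`. -/
instance (s : ℝ) (ι : Type*) [Fintype ι] [DecidableEq ι] : TopologicalSpace (GSDual s ι) :=
  TopologicalSpace.induced (fun u (g : GSSpace s ι) => u.pairing g) inferInstance

/-- The distribution `u` is given by the function `a`. -/
def GSDual.IsFunction {s : ℝ} {ι : Type*} [Fintype ι] [DecidableEq ι] (u : GSDual s ι)
    (a : EuclideanSpace ℝ ι → ℂ) : Prop :=
  ∀ g : GSSpace s ι, u.pairing g = ∫ y, a y * (g : EuclideanSpace ℝ ι → ℂ) y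

/-! ### Short-time Fourier transform, weights and modulation spaces -/

/-- The constant `(2π)^{-n/2}`. -/
def fourierConst (ι : Type*) [Fintype ι] : ℂ :=
  (((2 * Real.pi) ^ (-(Fintype.card ι : ℝ) / 2) : ℝ) : ℂ)

/-- The Fourier transform `f̂(Ξ) = (2π)^{-n/2} ∫ f(X) e^{-i⟨X, Ξ⟩} dX`. -/
def unitaryFourier {ι : Type*} [Fintype ι] (f : EuclideanSpace ℝ ι → ℂ) (Ξ : EuclideanSpace ℝ ι) : ℂ :=
  fourierConst ι * ∫ X, f X * Complex.exp (-(Complex.I * (⟪X, Ξ⟫ : ℝ)))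

/-- The inverse Fourier transform `(2π)^{-n/2} ∫ g(Ξ) e^{i⟨X, Ξ⟩} dΞ`. -/
def unitaryFourierInv {ι : Type*} [Fintype ι] (g : EuclideanSpace ℝ ι → ℂ) (X : EuclideanSpace ℝ ι) : ℂ :=
  fourierConst ι * ∫ Ξ, g Ξ * Complex.exp (Complex.I * (⟪X, Ξ⟫ : ℝ))

/-- The short-time Fourier transform of a function `f` with window `φ`,
`V_φ f(X, Ξ) = (2π)^{-n/2} ∫ f(Y) conj(φ(Y - X)) e^{-i⟨Y, Ξ⟩} dY`. -/
def stft {ι : Type*} [Fintype ι] (φ f : EuclideanSpace ℝ ι → ℂ) (X Ξ : EuclideanSpace ℝ ι) : ℂ :=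
  unitaryFourier (fun Y => f Y * conj (φ (Y - X))) Ξ

/-- The short-time Fourier transform of `u ∈ 𝒮_s'(ℝⁿ)` with window `φ ∈ 𝒮_s(ℝⁿ)`,
`V_φ u(X, Ξ) = (2π)^{-n/2} ⟨u, conj(φ(· - X)) e^{-i⟨·, Ξ⟩}⟩`. -/
def GSDual.stft {s : ℝ} (hs : 0 ≤ s) {ι : Type*} [Fintype ι] [DecidableEq ι] (φ : GSSpace s ι)
    (u : GSDual s ι) (X Ξ : EuclideanSpace ℝ ι) : ℂ :=
  fourierConst ι * u.pairing ⟨tfShift φ X Ξ, tfShift_mem hs φ.2 X Ξ⟩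

/-- A weight: a positive function `ω` such that `ω` and `1/ω` belong to `L^∞_loc`. -/
def IsWeight {V : Type*} [TopologicalSpace V] [MeasureSpace V] (ω : V → ℝ) : Prop :=
  (∀ x, 0 < ω x) ∧ ∀ K : Set V, IsCompact K →
    MemLp ω ⊤ (volume.restrict K) ∧ MemLp (fun x => (ω x)⁻¹) ⊤ (volume.restrict K)

/-- The class `𝒫_E` of moderate weights: `ω(x + y) ≤ C ω(x) v(y)` for some weight `v`. -/
def IsModerate {V : Type*} [TopologicalSpace V] [MeasureSpace V] [Add V] (ω : V → ℝ) : Prop :=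
  IsWeight ω ∧ ∃ v : V → ℝ, IsWeight v ∧ ∃ C : ℝ, 0 < C ∧ ∀ x y, ω (x + y) ≤ C * (ω x * v y)

/-- The mixed quasi-norm of `L^{p,q}_{(ω)}`: the `L^q` quasi-norm in `Ξ` of the `L^p` quasi-norm
of `F(·, Ξ) ω(·, Ξ)`. -/
def mixedNorm {V : Type*} [MeasureSpace V] (p q : ENNReal) (ω : V × V → ℝ) (F : V → V → ℂ) :
    ENNReal :=
  eLpNorm (fun Ξ => eLpNorm (fun X => F X Ξ * (ω (X, Ξ) : ℂ)) p volume) q volume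

/-- The quasi-norm `‖u‖_{M^{p,q}_{(ω)}} = ‖V_φ u‖_{L^{p,q}_{(ω)}}` for `u ∈ 𝒮_{1/2}'(ℝⁿ)`, taken with
the window `φ ∈ 𝒮_{1/2}(ℝⁿ)`. -/
def modNorm {ι : Type*} [Fintype ι] [DecidableEq ι] (p q : ENNReal)
    (ω : EuclideanSpace ℝ ι × EuclideanSpace ℝ ι → ℝ) (φ : GSSpace (1 / 2) ι)
    (u : GSDual (1 / 2) ι) : ENNReal :=
  mixedNorm p q ω (u.stft (by norm_num) φ)

/-- The modulation space `M^{p,q}_{(ω)}(ℝⁿ)`, defined with the window `φ`. -/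
def ModSpace {ι : Type*} [Fintype ι] [DecidableEq ι] (p q : ENNReal)
    (ω : EuclideanSpace ℝ ι × EuclideanSpace ℝ ι → ℝ) (φ : GSSpace (1 / 2) ι) : Type _ :=
  {u : GSDual (1 / 2) ι // modNorm p q ω φ u < ⊤}

/-- The quasi-norm topology of `M^{p,q}_{(ω)}(ℝⁿ)`: a set is open if it contains, with each of its
points, a ball of positive radius about that point. -/
instance {ι : Type*} [Fintype ι] [DecidableEq ι] (p q : ENNReal)
    (ω : EuclideanSpace ℝ ι × EuclideanSpace ℝ ι → ℝ) (φ : GSSpace (1 / 2) ι) :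
    TopologicalSpace (ModSpace p q ω φ) where
  IsOpen U := ∀ u ∈ U, ∃ ε : ENNReal, 0 < ε ∧
    ∀ v : ModSpace p q ω φ, modNorm p q ω φ (v.1 - u.1) < ε → v ∈ U
  isOpen_univ := fun _ _ => ⟨1, one_pos, fun _ _ => trivial⟩
  isOpen_inter := by
    rintro U V hU hV u ⟨h₁, h₂⟩
    obtain ⟨ε, hε, hU⟩ := hU u h₁
    obtain ⟨δ, hδ, hV⟩ := hV u h₂
    exact ⟨min ε δ, lt_min hε hδ, fun v hv =>
      ⟨hU v (hv.trans_le (min_le_left _ _)), hV v (hv.trans_le (min_le_right _ _))⟩⟩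
  isOpen_sUnion := by
    rintro S hS u ⟨U, hU, hu⟩
    obtain ⟨ε, hε, h⟩ := hS U hU u hu
    exact ⟨ε, hε, fun v hv => ⟨U, hU, h v hv⟩⟩

/-- The topology that `M^{p,q}_{(ω)}(ℝⁿ)` inherits from the weak-* topology of `𝒮_{1/2}'(ℝⁿ)`. -/
@[reducible]
def ModSpace.weakTop {ι : Type*} [Fintype ι] [DecidableEq ι] (p q : ENNReal)
    (ω : EuclideanSpace ℝ ι × EuclideanSpace ℝ ι → ℝ) (φ : GSSpace (1 / 2) ι) :
    TopologicalSpace (ModSpace p q ω φ) :=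
  TopologicalSpace.induced (fun u => u.1) inferInstance

/-! ### The operator `T_A = e^{i⟨A D_ξ, D_x⟩}` on `ℝ^{2d}` -/

/-- The point `(x, ξ)` of `ℝ^{2d}`. -/
def phasePoint {d : ℕ} (x ξ : EuclideanSpace ℝ (Fin d)) : EuclideanSpace ℝ (Fin d ⊕ Fin d) :=
  WithLp.toLp 2 (Sum.elim x ξ)

/-- The component `x` of `(x, ξ)`. -/
def fstPart {d : ℕ} (X : EuclideanSpace ℝ (Fin d ⊕ Fin d)) : EuclideanSpace ℝ (Fin d) :=
  WithLp.toLp 2 fun i => X (Sum.inl i)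

/-- The component `ξ` of `(x, ξ)`. -/
def sndPart {d : ℕ} (X : EuclideanSpace ℝ (Fin d ⊕ Fin d)) : EuclideanSpace ℝ (Fin d) :=
  WithLp.toLp 2 fun i => X (Sum.inr i)

/-- The operator `T_A = e^{i⟨A D_ξ, D_x⟩}`, `D = -i∂`: the Fourier multiplier with symbol
`e^{i⟨A y, η⟩}`, where `(η, y)` is the variable dual to `(x, ξ)`. -/
def expOp {d : ℕ} (A : Matrix (Fin d) (Fin d) ℝ) (a : EuclideanSpace ℝ (Fin d ⊕ Fin d) → ℂ) :
    EuclideanSpace ℝ (Fin d ⊕ Fin d) → ℂ :=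
  unitaryFourierInv fun Ξ =>
    Complex.exp (Complex.I * (⟪A.toEuclideanLin (sndPart Ξ), fstPart Ξ⟫ : ℝ)) * unitaryFourier a Ξ

/-- The weight `ω_A(x, ξ, η, y) = ω(x + A y, ξ + A^* η, η, y)`. -/
def weightShear {d : ℕ} (A : Matrix (Fin d) (Fin d) ℝ)
    (ω : EuclideanSpace ℝ (Fin d ⊕ Fin d) × EuclideanSpace ℝ (Fin d ⊕ Fin d) → ℝ) :
    EuclideanSpace ℝ (Fin d ⊕ Fin d) × EuclideanSpace ℝ (Fin d ⊕ Fin d) → ℝ :=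
  fun Z => ω (phasePoint (fstPart Z.1 + A.toEuclideanLin (sndPart Z.2))
    (sndPart Z.1 + A.transpose.toEuclideanLin (fstPart Z.2)), Z.2)

end

/-! The symbol ⟨Ay, η⟩ is half the quadratic form of the symmetric map B : (η, y) ↦ (Ay, A^*η), so
T_A is the Fourier multiplier e^{i⟨BD, D⟩/2}, here `chirpOp`. Everything follows from its
commutation relations. The multiplier commutes with derivatives, and multiplication by ⟨·, v⟩ passes
through it as ⟨·, v⟩ + i∂_{Bv} (`smulLeftCLM_chirpOp`). Hence ⟨x, v⟩^l ∂^k T f = T g, where g arises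
from f by k + l multiplications and differentiations. Such words in x and D satisfy factorial
estimates on 𝒮_{s,h} exactly because s ≥ 1/2 (`factorial_rpow_le`), and T itself is only estimated
once, from Schwartz seminorms to the sup norm. This gives `chirpOp_gsBound`.

The chirp is even and unimodular, so T is its own transpose for the bilinear pairing and its inverse
is the multiplier of -B; T therefore extends to 𝒮_{1/2}' by transposition (`dualOp`). It maps a
time-frequency shift at (X, Ξ) to a phase times the shift at (X + BΞ, Ξ) (`chirpOp_shift`), which is
the formula for the short-time Fourier transform. Since L^p is translation invariant, the norm of Tu
with window Tφ and sheared weight equals that of u with window φ (`modNorm_dualOp`).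

What remains is window independence for all p, q in (0, ∞]. The inversion formula, extended to
distributions by Riemann sums that are bounded in one 𝒮_{1/2,h} and converge pointwise
(`eventually_gsBound`, `GSDual.integral_tfCoeff_mul_pairing`), shows that |V_φ u| is dominated by
the convolution of |V_ψ u| with a Gaussian. The quasi-Banach range is treated with the maximal
function sup_W F(W) e^{-N|Z-W|}, whose r-th power is dominated by the convolution of F^r with an
exponential (`rpow_mul_exp_le_lintegral`). With r = min(1, p, q), Young's inequality in L^{p/r,q/r}
bounds the maximal function, and moderate weights enter only through exponential moderateness.

Uniqueness uses the same Riemann sums for u: they lie in 𝒮_{1/2}, converge to u weakly, and are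
dominated by the maximal function, so for p, q < ∞ they also converge in quasi-norm
(`IsModerate.tendsto_modNorm_sub_approx`). -/

set_option linter.unusedSectionVars false

/-! ### Gelfand–Shilov estimates through operator norms, with explicit constants -/

section GSBound

open scoped ContDiff

/-- The estimates of `𝒮_{s,h}` in terms of operator norms of derivatives. -/
def GSBound {E : Type*} [NormedAddCommGroup E] [NormedSpace ℝ E] (s C h : ℝ) (f : E → ℂ) : Prop :=
  ∀ (k l : ℕ) (x : E), ‖x‖ ^ l * ‖iteratedFDeriv ℝ k f x‖ ≤
    C * (h ^ (k + l) * (k.factorial : ℝ) ^ s * (l.factorial : ℝ) ^ s)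

variable {ι : Type*} [Fintype ι] [DecidableEq ι]

/-- Some coordinate carries |x| up to the dimension n, and the operator norm of the k-th derivative
is at most the sum of n^k partial derivatives; the factors n^l and n^k are absorbed into h. In
contrast with mere membership, the new h does not depend on f, which is what bounded operators and
functionals require. -/
lemma gsBound_of_gsNorm {s h : ℝ} (hs : 0 ≤ s) (hh : 0 < h) {f : EuclideanSpace ℝ ι → ℂ}
    (hf : gsNorm s h f < ⊤) :
    GSBound s (gsNorm s h f).toReal (((Fintype.card ι : ℝ) + 1) * h) f := by
  intro k l x
  have hb := (gsNorm_le_iff (f := f) hh ENNReal.toReal_nonneg).1 (ENNReal.ofReal_toReal hf.ne).ge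
  set C := (gsNorm s h f).toReal
  have hC : 0 ≤ C := ENNReal.toReal_nonneg
  set n : ℝ := (Fintype.card ι : ℝ) with hn
  have key : ∀ j : ι, ∀ σ : Fin k → ι, |x j| ^ l * ‖partialDeriv σ f x‖ ≤
      C * (h ^ (k + l) * (k.factorial : ℝ) ^ s * (l.factorial : ℝ) ^ s) := by
    intro j σ
    have := hb k σ (Pi.single j l) x
    have e1 : ∏ i, |x i| ^ (Pi.single j l : ι → ℕ) i = |x j| ^ l := by
      rw [Finset.prod_eq_single j] <;> simp +contextual
    have e2 : ∑ i, (Pi.single j l : ι → ℕ) i = l := by simp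
    have e3 : multiFact (Pi.single j l : ι → ℕ) = l.factorial := by
      unfold multiFact
      rw [Finset.prod_eq_single j] <;> simp +contextual
    rw [e1, e2, e3] at this
    refine this.trans ?_
    gcongr
    exact_mod_cast (multiFact_indexOf_le σ).1
  have key0 : ∀ σ : Fin k → ι, ‖x‖ ^ l * ‖partialDeriv σ f x‖ ≤
      C * (((n + 1) ^ l * h ^ (k + l)) * (k.factorial : ℝ) ^ s * (l.factorial : ℝ) ^ s) := by
    intro σ
    -- The left alternative accounts for the zero-dimensional space, where there is no coordinate to
    -- choose; there l = 0 is covered by β = 0.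
    have hx : ‖x‖ = 0 ∨ ∃ j, ‖x‖ ≤ n * |x j| := by
      rcases isEmpty_or_nonempty ι with hι | hι
      · left
        rw [norm_eq_zero]
        exact Subsingleton.elim _ _
      · right
        obtain ⟨j, hj⟩ := Finite.exists_max fun j => |x j|
        refine ⟨j, ?_⟩
        have h1 : ‖x‖ ≤ ∑ i, |x i| := by
          rw [EuclideanSpace.norm_eq, Real.sqrt_le_left (by positivity)]
          simpa using Finset.sum_sq_le_sq_sum_of_nonneg (s := Finset.univ)
            (f := fun i => |x i|) (fun i _ => abs_nonneg _)
        refine h1.trans ((Finset.sum_le_sum fun i _ => hj i).trans ?_)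
        simp [hn]
    have hn1 : 1 ≤ (n + 1) ^ l := one_le_pow₀ (by simp [hn])
    rcases hx with hx | ⟨j, hj⟩
    · rcases Nat.eq_zero_or_pos l with rfl | hl
      · have := hb k σ 0 x
        simp only [Pi.zero_apply, pow_zero, Finset.prod_const_one, one_mul, Finset.sum_const_zero,
          add_zero, multiFact, Nat.factorial_zero, Nat.cast_one, Real.one_rpow, mul_one] at this ⊢
        refine this.trans ?_
        gcongr
        exact_mod_cast (multiFact_indexOf_le σ).1
      · rw [hx, zero_pow hl.ne', zero_mul]
        positivity
    · calc ‖x‖ ^ l * ‖partialDeriv σ f x‖ ≤ (n * |x j|) ^ l * ‖partialDeriv σ f x‖ := by gcongr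
        _ = n ^ l * (|x j| ^ l * ‖partialDeriv σ f x‖) := by ring
        _ ≤ (n + 1) ^ l * (C * (h ^ (k + l) * (k.factorial : ℝ) ^ s * (l.factorial : ℝ) ^ s)) := by
            gcongr ?_ ^ l * ?_
            · linarith
            · exact key j σ
        _ = _ := by ring
  have hop : ‖iteratedFDeriv ℝ k f x‖ ≤ ∑ σ : Fin k → ι, ‖partialDeriv σ f x‖ := by
    refine ContinuousMultilinearMap.opNorm_le_bound (by positivity) fun v => ?_
    have hv : v = fun i => ∑ j, v i j • EuclideanSpace.single j (1 : ℝ) := by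
      funext i
      ext a
      simp [Finset.sum_apply, Pi.single_apply]
    have hexp : iteratedFDeriv ℝ k f x v =
        ∑ σ : Fin k → ι, (∏ i, v i (σ i)) • partialDeriv σ f x := by
      conv_lhs => rw [hv]
      rw [ContinuousMultilinearMap.map_sum]
      refine Finset.sum_congr rfl fun σ _ => ?_
      rw [ContinuousMultilinearMap.map_smul_univ]
      rfl
    rw [hexp, Finset.sum_mul]
    refine (norm_sum_le _ _).trans (Finset.sum_le_sum fun σ _ => ?_)
    rw [norm_smul, mul_comm, norm_prod]
    gcongr with i
    exact PiLp.norm_apply_le (v i) (σ i)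
  calc ‖x‖ ^ l * ‖iteratedFDeriv ℝ k f x‖
      ≤ ‖x‖ ^ l * ∑ σ : Fin k → ι, ‖partialDeriv σ f x‖ := by gcongr
    _ = ∑ σ : Fin k → ι, ‖x‖ ^ l * ‖partialDeriv σ f x‖ := Finset.mul_sum _ _ _
    _ ≤ ∑ _σ : Fin k → ι,
        C * (((n + 1) ^ l * h ^ (k + l)) * (k.factorial : ℝ) ^ s * (l.factorial : ℝ) ^ s) :=
        Finset.sum_le_sum fun σ _ => key0 σ
    _ = n ^ k *
        (C * (((n + 1) ^ l * h ^ (k + l)) * (k.factorial : ℝ) ^ s * (l.factorial : ℝ) ^ s)) := by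
        simp [hn]
    _ ≤ (n + 1) ^ k *
        (C * (((n + 1) ^ l * h ^ (k + l)) * (k.factorial : ℝ) ^ s * (l.factorial : ℝ) ^ s)) := by
        gcongr
        linarith
    _ = _ := by
        rw [mul_pow, pow_add (n + 1)]
        ring

/-- The loss is the multinomial inequality |α|! ≤ n^{|α|} α!; its s-th power is geometric in the
order and goes into h, so the constant C is unchanged. -/
lemma GSBound.gsNorm_le {s C h : ℝ} (hs : 0 ≤ s) (hC : 0 ≤ C) (hh : 0 < h)
    {f : EuclideanSpace ℝ ι → ℂ} (hb : GSBound s C h f) :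
    gsNorm s (((Fintype.card ι : ℝ) + 1) ^ s * h) f ≤ ENNReal.ofReal C := by
  set n : ℝ := (Fintype.card ι : ℝ) with hn
  have hN : 1 ≤ (n + 1) ^ s := Real.one_le_rpow (by simp [hn]) hs
  refine (gsNorm_le_iff (by positivity) hC).2 fun k σ β x => ?_
  have e1 : ∏ j, |x j| ^ β j ≤ ‖x‖ ^ ∑ j, β j := by
    rw [← Finset.prod_pow_eq_pow_sum]
    gcongr with j
    exact PiLp.norm_apply_le x j
  have e2 : ‖partialDeriv σ f x‖ ≤ ‖iteratedFDeriv ℝ k f x‖ := by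
    refine (ContinuousMultilinearMap.le_opNorm _ _).trans ?_
    simp
  have aux : ∀ m : ℕ, ∀ τ : Fin m → ι,
      (m.factorial : ℝ) ^ s ≤ ((n + 1) ^ s) ^ m * (multiFact (indexOf τ) : ℝ) ^ s := by
    intro m τ
    rw [Real.rpow_pow_comm (by positivity), ← Real.mul_rpow (by positivity) (by positivity)]
    refine Real.rpow_le_rpow (by positivity) ?_ hs
    have := (multiFact_indexOf_le τ).2
    have h3 : (m.factorial : ℝ) ≤ n ^ m * multiFact (indexOf τ) := by
      rw [hn]
      exact_mod_cast this
    refine h3.trans ?_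
    gcongr
    linarith
  -- Listing each variable j with multiplicity β j presents β as an `indexOf`, so that the
  -- multinomial inequality applies to β as well.
  obtain ⟨τ, hτ⟩ : ∃ τ : Fin (∑ j, β j) → ι, indexOf τ = β := by
    have e : (Σ j, Fin (β j)) ≃ Fin (∑ j, β j) := Fintype.equivFinOfCardEq (by simp)
    refine ⟨fun i => (e.symm i).1, funext fun j => ?_⟩
    unfold indexOf
    rw [← Fintype.card_subtype, ← Fintype.card_fin (β j)]
    have sigmaFst : {z : Σ j, Fin (β j) // z.1 = j} ≃ Fin (β j) :=
      Equiv.sigmaSubtype j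
    refine Fintype.card_congr ((e.symm.subtypeEquiv (p := fun i => (e.symm i).1 = j)
      (q := fun z => z.1 = j) fun _ => Iff.rfl).trans sigmaFst)
  have a1 := aux k σ
  have a2 := aux _ τ
  rw [hτ] at a2
  calc (∏ j, |x j| ^ β j) * ‖partialDeriv σ f x‖
      ≤ ‖x‖ ^ (∑ j, β j) * ‖iteratedFDeriv ℝ k f x‖ := by gcongr
    _ ≤ C * (h ^ (k + ∑ j, β j) * (k.factorial : ℝ) ^ s * ((∑ j, β j).factorial : ℝ) ^ s) :=
        hb _ _ x
    _ ≤ C * (h ^ (k + ∑ j, β j) * (((n + 1) ^ s) ^ k * (multiFact (indexOf σ) : ℝ) ^ s) *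
        (((n + 1) ^ s) ^ (∑ j, β j) * (multiFact β : ℝ) ^ s)) := by gcongr
    _ = _ := by
        rw [mul_pow ((n + 1) ^ s), pow_add ((n + 1) ^ s)]
        ring

lemma mem_GSSpace_iff_bound {s : ℝ} (hs : 0 ≤ s) {f : EuclideanSpace ℝ ι → ℂ} :
    f ∈ GSSpace s ι ↔ ContDiff ℝ ∞ f ∧ ∃ h : ℝ, 0 < h ∧ ∃ C : ℝ, 0 ≤ C ∧ GSBound s C h f :=
  mem_GSSpace_iff hs

lemma GSBound.mono {E : Type*} [NormedAddCommGroup E] [NormedSpace ℝ E] {s C D h k : ℝ}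
    {f : E → ℂ} (hb : GSBound s C h f) (hC : C ≤ D) (hD : 0 ≤ D) (hh : 0 ≤ h) (hk : h ≤ k) :
    GSBound s D k f := by
  intro i l x
  refine (hb i l x).trans ?_
  gcongr

/-- A function with the estimates of `𝒮_{s,h}` as a Schwartz function. -/
def GSBound.toSchwartz {E : Type*} [NormedAddCommGroup E] [NormedSpace ℝ E] {s C h : ℝ}
    {f : E → ℂ} (hf : ContDiff ℝ ∞ f) (hb : GSBound s C h f) : SchwartzMap E ℂ where
  toFun := f
  smooth' := hf
  decay' l k := ⟨_, fun x => hb k l x⟩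

lemma exists_schwartz {s : ℝ} (hs : 0 ≤ s) {f : EuclideanSpace ℝ ι → ℂ} (hf : f ∈ GSSpace s ι) :
    ∃ F : SchwartzMap (EuclideanSpace ℝ ι) ℂ, ⇑F = f := by
  obtain ⟨h1, h, hh, C, hC, hb⟩ := (mem_GSSpace_iff_bound hs).1 hf
  exact ⟨hb.toSchwartz h1, rfl⟩

end GSBound

/-! ### The quadratic chirp multiplier and its commutation relations -/

section ChirpOp

open scoped SchwartzMap FourierTransform LineDeriv ContDiff
open SchwartzMap

variable {E : Type*} [NormedAddCommGroup E] [InnerProductSpace ℝ E]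

/-- The symbol `e^{i⟨B D, D⟩/2}` at `D = 2π z`. -/
noncomputable def chirp (B : E →L[ℝ] E) (z : E) : ℂ :=
  Complex.exp (Complex.I * (2 * Real.pi ^ 2 * ⟪B z, z⟫ : ℝ))

lemma hasTemperateGrowth_expI :
    (fun t : ℝ => Complex.exp (Complex.I * t)).HasTemperateGrowth := by
  have e : (fun t : ℝ => Complex.exp (Complex.I * t)) =
      (fun t : ℝ => Complex.exp (-Complex.I * t)) ∘ fun t => -t := by
    funext t
    simp
  refine e ▸ Function.HasTemperateGrowth.comp ⟨?_, fun n => ⟨0, 1, fun t => ?_⟩⟩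
    (Function.HasTemperateGrowth.neg (f := fun t : ℝ => t) (by fun_prop))
  · exact ContDiff.cexp (contDiff_const.mul Complex.ofRealCLM.contDiff)
  · rw [norm_iteratedFDeriv_eq_norm_iteratedDeriv, iteratedDeriv_cexp_real]
    simp [Complex.norm_exp]

lemma chirp_hasTemperateGrowth (B : E →L[ℝ] E) : (chirp B).HasTemperateGrowth := by
  refine hasTemperateGrowth_expI.comp (f := fun z : E => (2 * Real.pi ^ 2 * ⟪B z, z⟫ : ℝ)) ?_
  have h : (fun z : E => ⟪B z, z⟫).HasTemperateGrowth :=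
    (innerSL ℝ).bilinear_hasTemperateGrowth (B.hasTemperateGrowth) (by fun_prop)
  exact (Function.HasTemperateGrowth.const _).mul h

lemma chirp_hasFDerivAt {B : E →L[ℝ] E} (hB : ∀ x y, ⟪B x, y⟫ = ⟪x, B y⟫) (z : E) :
    HasFDerivAt (chirp B)
      ((Complex.ofRealCLM.comp (innerSL ℝ (B z))).smulRight
        (Complex.I * (4 * Real.pi ^ 2 : ℝ) * chirp B z)) z := by
  have h1 : HasFDerivAt (fun z : E => ⟪B z, z⟫) _ z := B.hasFDerivAt.inner ℝ (hasFDerivAt_id z)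
  have h2 := (Complex.ofRealCLM.hasFDerivAt.comp z (h1.const_mul (2 * Real.pi ^ 2))).const_mul
    Complex.I
  have h3 := h2.cexp
  refine h3.congr_fderiv ?_
  ext v
  have : ⟪B v, z⟫ = ⟪B z, v⟫ := by rw [hB, real_inner_comm]
  simp [chirp, this]
  ring

/-- By symmetry of B the gradient of 2π²⟨Bz, z⟩ is 4π² Bz. This is the frequency side of the
relation between the multiplier and multiplication by linear forms. -/
lemma lineDeriv_smulLeftCLM_chirp {B : E →L[ℝ] E} (hB : ∀ x y, ⟪B x, y⟫ = ⟪x, B y⟫)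
    (g : 𝓢(E, ℂ)) (v : E) :
    ∂_{v} (smulLeftCLM ℂ (chirp B) g) = smulLeftCLM ℂ (chirp B)
      (∂_{v} g + (Complex.I * (4 * Real.pi ^ 2 : ℝ)) • smulLeftCLM ℂ (inner ℝ · (B v)) g) := by
  ext x
  have hT := chirp_hasTemperateGrowth B
  have hv : (fun x : E => inner ℝ x (B v)).HasTemperateGrowth := by fun_prop
  have e : ⇑(smulLeftCLM ℂ (chirp B) g) = fun x => chirp B x * g x := by
    funext y
    simp [smulLeftCLM_apply_apply hT]
  rw [lineDerivOp_apply_eq_fderiv, e]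
  have h := ((chirp_hasFDerivAt hB x).mul g.differentiableAt.hasFDerivAt).fderiv
  rw [smulLeftCLM_apply_apply hT]
  have h' : (fun y => chirp B y * g y) = chirp B * ⇑g := rfl
  rw [h', h]
  simp only [add_apply, smul_apply, smul_eq_mul,
    ContinuousLinearMap.smulRight_apply, ContinuousLinearMap.comp_apply, innerSL_apply_apply,
    Complex.ofRealCLM_apply,
    smulLeftCLM_apply_apply hv, lineDerivOp_apply_eq_fderiv, hB]
  simp
  ring

variable [FiniteDimensional ℝ E] [MeasurableSpace E] [BorelSpace E]

/-- The operator `e^{i⟨B D, D⟩/2}` on Schwartz functions. -/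
noncomputable def chirpOp (B : E →L[ℝ] E) : 𝓢(E, ℂ) →L[ℂ] 𝓢(E, ℂ) :=
  fourierMultiplierCLM ℂ (chirp B)

lemma chirpOp_eq (B : E →L[ℝ] E) (f : 𝓢(E, ℂ)) :
    chirpOp B f = 𝓕⁻ (smulLeftCLM ℂ (chirp B) (𝓕 f)) := rfl

lemma lineDeriv_chirpOp (B : E →L[ℝ] E) (f : 𝓢(E, ℂ)) (w : E) :
    ∂_{w} (chirpOp B f) = chirpOp B (∂_{w} f) := by
  have hw : (fun x : E => ((inner ℝ x w : ℝ) : ℂ)).HasTemperateGrowth :=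
    by fun_prop
  -- The derivative comes with a real symbol; the composition rule for multipliers needs both
  -- symbols complex.
  have e : ∀ g : 𝓢(E, ℂ), fourierMultiplierCLM ℂ (inner ℝ · w) g =
      fourierMultiplierCLM ℂ (fun x => ((inner ℝ x w : ℝ) : ℂ)) g := fun g =>
    (fourierMultiplierCLM_ofReal ℂ (by fun_prop) g).symm
  rw [lineDeriv_eq_fourierMultiplierCLM, lineDeriv_eq_fourierMultiplierCLM, map_smul, e, e,
    chirpOp, fourierMultiplierCLM_fourierMultiplierCLM_apply hw (chirp_hasTemperateGrowth B),
    fourierMultiplierCLM_fourierMultiplierCLM_apply (chirp_hasTemperateGrowth B) hw,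
    mul_comm (chirp B)]

/-- The multiplication by `⟨·, v⟩`, conjugated by `e^{i⟨B D, D⟩/2}`. -/
noncomputable def mulShear (B : E →L[ℝ] E) (v : E) (f : 𝓢(E, ℂ)) : 𝓢(E, ℂ) :=
  smulLeftCLM ℂ (inner ℝ · v) f + Complex.I • ∂_{B v} f

/-- Under the Fourier transform, multiplication by ⟨·, v⟩ is a derivative; when that derivative hits
the chirp it produces ⟨·, Bv⟩, which is i∂_{Bv} back on the space side. -/
lemma smulLeftCLM_chirpOp {B : E →L[ℝ] E} (hB : ∀ x y, ⟪B x, y⟫ = ⟪x, B y⟫)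
    (f : 𝓢(E, ℂ)) (v : E) :
    smulLeftCLM ℂ (inner ℝ · v) (chirpOp B f) = chirpOp B (mulShear B v f) := by
  have h1 := fourierInv_lineDerivOp_eq (smulLeftCLM ℂ (chirp B) (𝓕 f)) v
  rw [lineDeriv_smulLeftCLM_chirp hB, lineDerivOp_fourier_eq] at h1
  have h2 : (Complex.I * (4 * Real.pi ^ 2 : ℝ)) • smulLeftCLM ℂ (inner ℝ · (B v)) (𝓕 f) =
      (2 * Real.pi : ℂ) • 𝓕 (∂_{B v} f) := by
    rw [fourier_lineDerivOp_eq, smul_smul]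
    congr 1
    push_cast
    ring
  rw [h2, ← FourierTransform.fourier_smul, ← FourierTransform.fourier_add, ← chirpOp_eq,
    ← chirpOp_eq] at h1
  have h3 : (2 * Real.pi * Complex.I : ℂ) ≠ 0 := by simp [Real.pi_ne_zero]
  have h4 : -(2 * Real.pi * Complex.I) • smulLeftCLM ℂ (inner ℝ · v) f +
      (2 * Real.pi : ℂ) • ∂_{B v} f = (-(2 * Real.pi * Complex.I)) • mulShear B v f := by
    rw [mulShear, smul_add, smul_smul]
    congr 2
    linear_combination 2 * Real.pi * Complex.I_sq
  rw [h4, map_smul, smul_right_inj (neg_ne_zero.2 h3)] at h1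
  exact h1.symm

end ChirpOp

/-! ### Boundedness of the chirp multiplier on Gelfand–Shilov spaces -/

section ChirpBound

open scoped SchwartzMap FourierTransform LineDeriv ContDiff Nat
open SchwartzMap

variable {E : Type*} [NormedAddCommGroup E] [InnerProductSpace ℝ E]

/-- Only two Leibniz terms survive, because a linear form has no second derivative. For k = 0 the
truncated order k - 1 is harmless, since its factor k vanishes. -/
lemma norm_iteratedFDeriv_inner_smul_le {f : E → ℂ} (hf : ContDiff ℝ ∞ f) (v x : E) (k : ℕ) :
    ‖iteratedFDeriv ℝ k (fun y => (⟪y, v⟫ : ℝ) • f y) x‖ ≤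
      ‖v‖ * (‖x‖ * ‖iteratedFDeriv ℝ k f x‖ + k * ‖iteratedFDeriv ℝ (k - 1) f x‖) := by
  set L : E → ℝ := fun y => ⟪y, v⟫ with hL
  have hL' : L = innerSL ℝ v := by
    funext y
    simp [hL, real_inner_comm]
  have hc : ContDiff ℝ ∞ L := hL' ▸ (innerSL ℝ v).contDiff
  have hd : fderiv ℝ L = fun _ => innerSL ℝ v := by
    funext y
    rw [hL', ContinuousLinearMap.fderiv]
  have n0 : ‖iteratedFDeriv ℝ 0 L x‖ ≤ ‖x‖ * ‖v‖ := by
    rw [norm_iteratedFDeriv_zero]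
    exact norm_inner_le_norm x v
  have n1 : ‖iteratedFDeriv ℝ 1 L x‖ ≤ ‖v‖ := by
    rw [← norm_iteratedFDeriv_fderiv, hd, norm_iteratedFDeriv_zero, innerSL_apply_norm]
  have n2 : ∀ i, ‖iteratedFDeriv ℝ (i + 2) L x‖ = 0 := fun i => by
    rw [← norm_iteratedFDeriv_fderiv, hd, iteratedFDeriv_succ_const]
    simp
  have h := norm_iteratedFDeriv_smul_le hc hf x (n := k) (by exact_mod_cast le_top)
  refine h.trans ?_
  rcases k with _ | m
  · simp only [zero_add, Finset.range_one, Finset.sum_singleton, Nat.choose_self, Nat.cast_one,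
      one_mul, Nat.cast_zero, zero_mul, add_zero]
    calc _ ≤ (‖x‖ * ‖v‖) * ‖iteratedFDeriv ℝ 0 f x‖ := by gcongr
      _ = _ := by ring
  · rw [Finset.sum_range_succ', Finset.sum_range_succ']
    have h0 : ∑ i ∈ Finset.range m, ((m + 1).choose (i + 1 + 1) : ℝ) *
        ‖iteratedFDeriv ℝ (i + 1 + 1) L x‖ * ‖iteratedFDeriv ℝ (m + 1 - (i + 1 + 1)) f x‖ = 0 :=
      Finset.sum_eq_zero fun i _ => by rw [n2]; ring
    rw [h0]
    simp only [zero_add, Nat.choose_one_right, Nat.choose_zero_right, Nat.cast_one, one_mul,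
      Nat.sub_zero]
    calc _ ≤ ((m + 1 : ℕ) : ℝ) * ‖v‖ * ‖iteratedFDeriv ℝ (m + 1 - 1) f x‖ +
          (‖x‖ * ‖v‖) * ‖iteratedFDeriv ℝ (m + 1) f x‖ := by gcongr
      _ = _ := by ring

/-- The estimates satisfied by the result of `n` multiplications by linear forms and differentiations
applied to a function of `𝒮_{s,h}`. -/
def IterBound (s h : ℝ) (n : ℕ) (C : ℝ) (f : E → ℂ) : Prop :=
  ∀ (k l : ℕ) (x : E), ‖x‖ ^ l * ‖iteratedFDeriv ℝ k f x‖ ≤ C * (h ^ (k + l) * ((n + k + l)! : ℝ) ^ s)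

/-- Merging k! and l! into (k + l)! turns each later multiplication or differentiation into an index
shift. The two factorials are separated again at the end at the price of a geometric factor
(`factorial_add_rpow_le`). -/
lemma GSBound.iterBound {s C h : ℝ} (hs : 0 ≤ s) (hC : 0 ≤ C) (hh : 0 ≤ h) {f : E → ℂ}
    (hf : GSBound s C h f) : IterBound s h 0 C f := by
  intro k l x
  refine (hf k l x).trans ?_
  rw [mul_assoc (h ^ (k + l)), ← Real.mul_rpow (by positivity) (by positivity)]
  gcongr
  rw [zero_add]
  exact_mod_cast Nat.le_of_dvd (Nat.factorial_pos _) (Nat.factorial_mul_factorial_dvd_factorial_add k l)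

lemma IterBound.lineDeriv {s h C : ℝ} {n : ℕ} {f : 𝓢(E, ℂ)}
    (hf : IterBound s h n C f) (w : E) : IterBound s h (n + 1) (‖w‖ * (C * h)) (∂_{w} f : 𝓢(E, ℂ)) := by
  intro k l x
  have e : ⇑(∂_{w} f : 𝓢(E, ℂ)) = fun x => fderiv ℝ f x w := by
    funext x
    rw [lineDerivOp_apply_eq_fderiv]
  have h1 : ‖iteratedFDeriv ℝ k (∂_{w} f : 𝓢(E, ℂ)) x‖ ≤ ‖w‖ * ‖iteratedFDeriv ℝ (k + 1) f x‖ := by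
    rw [e, ← norm_iteratedFDeriv_fderiv]
    exact norm_iteratedFDeriv_clm_apply_const
      (((f.smooth ⊤).fderiv_right (m := ∞) (by simp)).contDiffAt) (by exact_mod_cast le_top)
  calc _ ≤ ‖x‖ ^ l * (‖w‖ * ‖iteratedFDeriv ℝ (k + 1) f x‖) := by gcongr
    _ = ‖w‖ * (‖x‖ ^ l * ‖iteratedFDeriv ℝ (k + 1) f x‖) := by ring
    _ ≤ ‖w‖ * (C * (h ^ (k + 1 + l) * ((n + (k + 1) + l)! : ℝ) ^ s)) := by
      exact mul_le_mul_of_nonneg_left (hf _ _ _) (norm_nonneg _)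
    _ = _ := by
      rw [show n + (k + 1) + l = n + 1 + k + l by ring, show k + 1 + l = k + l + 1 by ring]
      ring

/-- This is where s ≥ 1/2 enters: (n + 1)!/(n - 1)! is at least n², and n^{2s} ≥ n ≥ k. It
compensates a derivative that falls on a linear factor: this costs k, while the factorial index has
dropped by two against the target. -/
lemma factorial_rpow_le {s : ℝ} (hs : 1 / 2 ≤ s) (n k : ℕ) (hk : 0 < k) (hkn : k ≤ n) :
    (k : ℝ) * ((n - 1)! : ℝ) ^ s ≤ ((n + 1)! : ℝ) ^ s := by
  obtain ⟨m, rfl⟩ : ∃ m, n = m + 1 := ⟨n - 1, by omega⟩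
  have e : ((m + 1 + 1)! : ℝ) = ((m : ℝ) + 1 + 1) * (m + 1) * m ! := by
    push_cast [Nat.factorial_succ]
    ring
  rw [e, Real.mul_rpow (by positivity) (by positivity)]
  simp only [Nat.add_sub_cancel]
  refine mul_le_mul_of_nonneg_right ?_ (by positivity)
  have h1 : (1 : ℝ) ≤ (m : ℝ) + 1 := by simp
  have hk' : (k : ℝ) ≤ m + 1 := by exact_mod_cast hkn
  calc (k : ℝ) ≤ ((m : ℝ) + 1) ^ (1 : ℝ) := by simpa using hk'
    _ ≤ ((m : ℝ) + 1) ^ (2 * s) := Real.rpow_le_rpow_of_exponent_le h1 (by linarith)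
    _ = (((m : ℝ) + 1) ^ 2) ^ s := by
      rw [Real.rpow_mul (by positivity)]
      simp
    _ ≤ _ := by
      refine Real.rpow_le_rpow (by positivity) ?_ (by linarith)
      nlinarith

/-- The term with ‖x‖^{l+1} costs a factor h. The term in which a derivative falls on the linear
form has order k - 1, hence costs h⁻¹, and its factor k is absorbed by `factorial_rpow_le`. -/
lemma IterBound.inner_smul {s h C : ℝ} {n : ℕ} {f : 𝓢(E, ℂ)} (hs : 1 / 2 ≤ s) (hC : 0 ≤ C)
    (hh : 0 < h) (hf : IterBound s h n C f) (v : E) :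
    IterBound s h (n + 1) (‖v‖ * (C * (h + h⁻¹))) (smulLeftCLM ℂ (inner ℝ · v) f) := by
  intro k l x
  have e : ⇑(smulLeftCLM ℂ (inner ℝ · v) f) = fun y => (⟪y, v⟫ : ℝ) • f y := by
    funext x
    rw [smulLeftCLM_apply_apply (by fun_prop)]
  have h1 : ‖x‖ ^ l * (k * ‖iteratedFDeriv ℝ (k - 1) f x‖) ≤
      C * h⁻¹ * (h ^ (k + l) * ((n + 1 + k + l)! : ℝ) ^ s) := by
    rcases k with _ | k
    · simp only [Nat.cast_zero, zero_mul, mul_zero]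
      positivity
    · calc ‖x‖ ^ l * ((k + 1 : ℕ) * ‖iteratedFDeriv ℝ (k + 1 - 1) f x‖)
          = (k + 1 : ℕ) * (‖x‖ ^ l * ‖iteratedFDeriv ℝ k f x‖) := by
            rw [Nat.add_sub_cancel]
            ring
        _ ≤ (k + 1 : ℕ) * (C * (h ^ (k + l) * ((n + k + l)! : ℝ) ^ s)) := by
            exact mul_le_mul_of_nonneg_left (hf _ _ _) (by positivity)
        _ = C * h ^ (k + l) * ((k + 1 : ℕ) * ((n + (k + 1) + l - 1)! : ℝ) ^ s) := by
            rw [show n + (k + 1) + l - 1 = n + k + l by omega]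
            ring
        _ ≤ C * h ^ (k + l) * ((n + (k + 1) + l + 1)! : ℝ) ^ s := by
            gcongr
            exact factorial_rpow_le hs _ _ (by omega) (by omega)
        _ = _ := by
            rw [show n + (k + 1) + l + 1 = n + 1 + (k + 1) + l by ring,
              show k + 1 + l = k + l + 1 by ring, pow_succ]
            field_simp
  have h2 := hf k (l + 1) x
  rw [e]
  calc _ ≤ ‖x‖ ^ l * (‖v‖ * (‖x‖ * ‖iteratedFDeriv ℝ k f x‖ +
        k * ‖iteratedFDeriv ℝ (k - 1) f x‖)) := by
        gcongr
        exact norm_iteratedFDeriv_inner_smul_le (f.smooth ⊤) v x k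
    _ = ‖v‖ * (‖x‖ ^ (l + 1) * ‖iteratedFDeriv ℝ k f x‖ +
        ‖x‖ ^ l * (k * ‖iteratedFDeriv ℝ (k - 1) f x‖)) := by ring
    _ ≤ ‖v‖ * (C * (h ^ (k + (l + 1)) * ((n + k + (l + 1))! : ℝ) ^ s) +
        C * h⁻¹ * (h ^ (k + l) * ((n + 1 + k + l)! : ℝ) ^ s)) := by gcongr
    _ = _ := by
      rw [show n + k + (l + 1) = n + 1 + k + l by ring, show k + (l + 1) = k + l + 1 by ring]
      ring

lemma IterBound.add {s h C D : ℝ} {n : ℕ} {f g : 𝓢(E, ℂ)}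
    (hf : IterBound s h n C f) (hg : IterBound s h n D g) : IterBound s h n (C + D) (f + g) := by
  intro k l x
  have e : iteratedFDeriv ℝ k ⇑(f + g) x = iteratedFDeriv ℝ k f x + iteratedFDeriv ℝ k g x := by
    have : ⇑(f + g) = ⇑f + ⇑g := rfl
    rw [this, iteratedFDeriv_add_apply (f.smooth k).contDiffAt (g.smooth k).contDiffAt]
  rw [e]
  calc _ ≤ ‖x‖ ^ l * (‖iteratedFDeriv ℝ k f x‖ + ‖iteratedFDeriv ℝ k g x‖) := by
        gcongr
        exact norm_add_le _ _
    _ ≤ _ := by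
      rw [mul_add, add_mul]
      exact add_le_add (hf _ _ _) (hg _ _ _)

lemma IterBound.I_smul {s h C : ℝ} {n : ℕ} {f : 𝓢(E, ℂ)}
    (hf : IterBound s h n C f) : IterBound s h n C (Complex.I • f) := by
  intro k l x
  have e : iteratedFDeriv ℝ k ⇑(Complex.I • f) x = Complex.I • iteratedFDeriv ℝ k f x := by
    have : ⇑(Complex.I • f) = Complex.I • ⇑f := rfl
    rw [this, iteratedFDeriv_const_smul_apply (f.smooth k).contDiffAt]
  rw [e, norm_smul, Complex.norm_I, one_mul]
  exact hf k l x

lemma IterBound.shear {s h C : ℝ} {n : ℕ} {f : 𝓢(E, ℂ)} (hs : 1 / 2 ≤ s) (hC : 0 ≤ C)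
    (hh : 0 < h) (hf : IterBound s h n C f) (B : E →L[ℝ] E) {v : E} (hv : ‖v‖ ≤ 1) :
    IterBound s h (n + 1) (C * (h + h⁻¹ + ‖B‖ * h)) (mulShear B v f) := by
  have hBv : ‖B v‖ ≤ ‖B‖ := by simpa using B.le_opNorm_of_le hv
  intro k l x
  refine ((hf.inner_smul hs hC hh v).add (hf.lineDeriv (B v)).I_smul k l x).trans ?_
  refine mul_le_mul_of_nonneg_right ?_ (by positivity)
  calc ‖v‖ * (C * (h + h⁻¹)) + ‖B v‖ * (C * h) ≤ 1 * (C * (h + h⁻¹)) + ‖B‖ * (C * h) := by gcongr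
    _ = _ := by ring

lemma IterBound.iterate_mulShear {s h C : ℝ} {n : ℕ} {f : 𝓢(E, ℂ)} (hs : 1 / 2 ≤ s) (hC : 0 ≤ C)
    (hh : 0 < h) (hf : IterBound s h n C f) (B : E →L[ℝ] E) {v : E} (hv : ‖v‖ ≤ 1) (l : ℕ) :
    IterBound s h (n + l) (C * (h + h⁻¹ + ‖B‖ * h) ^ l) ((mulShear B v)^[l] f) := by
  induction l with
  | zero => simpa using hf
  | succ l ih =>
    rw [Function.iterate_succ_apply', pow_succ, ← mul_assoc, ← add_assoc]
    exact ih.shear hs (by positivity) hh B hv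

lemma IterBound.iteratedLineDeriv {s h C : ℝ} {n : ℕ} {f : 𝓢(E, ℂ)}
    (hf : IterBound s h n C f) {k : ℕ} (m : Fin k → E) :
    IterBound s h (n + k) ((∏ i, ‖m i‖) * (C * h ^ k)) (∂^{m} f : 𝓢(E, ℂ)) := by
  induction k with
  | zero => simpa using hf
  | succ k ih =>
    have h1 := (ih (Fin.tail m)).lineDeriv (m 0)
    rw [LineDeriv.iteratedLineDerivOp_succ_left, Fin.prod_univ_succ]
    have e : ‖m 0‖ * (∏ i : Fin k, ‖m i.succ‖) * (C * h ^ (k + 1)) =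
        ‖m 0‖ * ((∏ i, ‖Fin.tail m i‖) * (C * h ^ k) * h) := by
      simp only [Fin.tail]
      ring
    rw [e]
    exact h1

variable [FiniteDimensional ℝ E] [MeasurableSpace E] [BorelSpace E]

lemma iteratedLineDeriv_chirpOp (B : E →L[ℝ] E) (f : 𝓢(E, ℂ)) {k : ℕ} (m : Fin k → E) :
    ∂^{m} (chirpOp B f) = chirpOp B (∂^{m} f) := by
  induction k with
  | zero => simp
  | succ k ih =>
    rw [LineDeriv.iteratedLineDerivOp_succ_left, ih, lineDeriv_chirpOp,
      ← LineDeriv.iteratedLineDerivOp_succ_left]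

lemma inner_pow_mul_chirpOp {B : E →L[ℝ] E} (hB : ∀ x y, ⟪B x, y⟫ = ⟪x, B y⟫)
    (f : 𝓢(E, ℂ)) (v : E) (l : ℕ) (x : E) :
    (⟪x, v⟫ : ℝ) ^ l • chirpOp B f x = chirpOp B ((mulShear B v)^[l] f) x := by
  induction l generalizing f with
  | zero => simp
  | succ l ih =>
    rw [Function.iterate_succ_apply, ← ih, ← smulLeftCLM_chirpOp hB,
      smulLeftCLM_apply_apply (by fun_prop), smul_smul, pow_succ]

/-- The only analytic estimate of the operator itself. The finite set of seminorms is fixed once and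
for all, independently of the order of the estimate to be proved, because powers and derivatives are
moved onto f first. -/
lemma exists_norm_chirpOp_le (B : E →L[ℝ] E) : ∃ (S : Finset (ℕ × ℕ)) (C : ℝ), 0 ≤ C ∧
    ∀ (f : 𝓢(E, ℂ)) (M : ℝ), (∀ i ∈ S, ∀ x, ‖x‖ ^ i.1 * ‖iteratedFDeriv ℝ i.2 f x‖ ≤ M) → 0 ≤ M →
      ∀ x, ‖chirpOp B f x‖ ≤ C * M := by
  have hc : Continuous ((SchwartzMap.seminorm ℂ 0 0 : Seminorm ℂ 𝓢(E, ℂ)).comp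
      (chirpOp B).toLinearMap) :=
    ((schwartz_withSeminorms ℂ E ℂ).continuous_seminorm (0, 0)).comp (chirpOp B).continuous
  obtain ⟨S, C, -, hS⟩ := Seminorm.bound_of_continuous (schwartz_withSeminorms ℂ E ℂ) _ hc
  refine ⟨S, C, C.2, fun f M hM hM0 x => ?_⟩
  refine (norm_le_seminorm ℂ (chirpOp B f) x).trans ((hS f).trans ?_)
  rw [smul_apply, NNReal.smul_def, smul_eq_mul]
  refine mul_le_mul_of_nonneg_left ?_ C.2
  refine Seminorm.finset_sup_apply_le hM0 fun i hi => ?_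
  exact seminorm_le_bound ℂ _ _ f hM0 (hM i hi)

lemma factorial_add_rpow_le {s : ℝ} (hs : 0 ≤ s) (k l : ℕ) :
    ((k + l)! : ℝ) ^ s ≤ (2 ^ s) ^ (k + l) * (k ! : ℝ) ^ s * (l ! : ℝ) ^ s := by
  rw [Real.rpow_pow_comm (by norm_num), ← Real.mul_rpow (by positivity) (by positivity),
    ← Real.mul_rpow (by positivity) (by positivity)]
  refine Real.rpow_le_rpow (by positivity) ?_ hs
  have h1 := Nat.add_choose_mul_factorial_mul_factorial k l
  have h2 : (k + l).choose l ≤ 2 ^ (k + l) := Nat.choose_le_two_pow _ _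
  rw [← h1]
  push_cast
  gcongr
  exact_mod_cast h2

/-- `e^{i⟨B D, D⟩/2}` is bounded from `𝒮_{s,h}` to `𝒮_{s,h'}` for some `h'`. -/
theorem chirpOp_gsBound {s h : ℝ} (hs : 1 / 2 ≤ s) (hh : 0 < h) {B : E →L[ℝ] E}
    (hB : ∀ x y, ⟪B x, y⟫ = ⟪x, B y⟫) : ∃ h' K : ℝ, 0 < h' ∧ 0 ≤ K ∧
      ∀ (f : 𝓢(E, ℂ)) (C : ℝ), 0 ≤ C → GSBound s C h f → GSBound s (K * C) h' (chirpOp B f) := by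
  have hs0 : 0 ≤ s := by linarith
  obtain ⟨S, C₀, hC₀, hS⟩ := exists_norm_chirpOp_le B
  -- R is the price of one application of `mulShear`, a the base of the price for splitting a
  -- factorial, and W collects the finitely many seminorms. Only R and a affect h'; W goes into the
  -- constant.
  set R : ℝ := h + h⁻¹ + ‖B‖ * h with hR
  have hR0 : 0 < R := by positivity
  set a : ℝ := 2 ^ s with ha
  have ha0 : 0 < a := by positivity
  set W : ℝ := ∑ i ∈ S, h ^ (i.2 + i.1) * (a ^ (i.2 + i.1) * ((i.2 + i.1)! : ℝ) ^ s) with hW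
  refine ⟨a * a * R, C₀ * W, by positivity, by positivity, fun f C hC hf k l x => ?_⟩
  -- Testing with ⟨x, v⟩^l instead of ‖x‖^l keeps the expression algebraic, so that both the power
  -- and the derivatives pass through the operator. The choice v = x/‖x‖ recovers ‖x‖^l.
  have key : ∀ v : E, ‖v‖ ≤ 1 → ∀ m : Fin k → E, ∀ x, ‖(⟪x, v⟫ : ℝ) ^ l • ∂^{m} (chirpOp B f) x‖ ≤
      C₀ * W * C * ((a * a * R) ^ (k + l) * (k ! : ℝ) ^ s * (l ! : ℝ) ^ s) * ∏ i, ‖m i‖ := by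
    intro v hv m x
    rw [iteratedLineDeriv_chirpOp, inner_pow_mul_chirpOp hB]
    have h1 := ((hf.iterBound hs0 hC hh.le).iteratedLineDeriv m).iterate_mulShear hs
      (by positivity) hh B hv l
    refine (hS _ (W * C * ((a * a * R) ^ (k + l) * (k ! : ℝ) ^ s * (l ! : ℝ) ^ s) * ∏ i, ‖m i‖)
      (fun i hi x => (h1 i.2 i.1 x).trans ?_) (by positivity) x).trans (le_of_eq (by ring))
    -- Two splittings, first of the seminorm orders i from k + l and then of k from l; together they
    -- produce the factor a * a in h'.
    have h2 : ((0 + k + l + i.2 + i.1)! : ℝ) ^ s ≤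
        (a * a) ^ (k + l) * (a ^ (i.2 + i.1) * ((i.2 + i.1)! : ℝ) ^ s) *
          ((k ! : ℝ) ^ s * (l ! : ℝ) ^ s) := by
      rw [show 0 + k + l + i.2 + i.1 = (k + l) + (i.2 + i.1) by ring]
      refine (factorial_add_rpow_le hs0 _ _).trans ?_
      calc _ ≤ a ^ (k + l + (i.2 + i.1)) * (a ^ (k + l) * (k ! : ℝ) ^ s * (l ! : ℝ) ^ s) *
            ((i.2 + i.1)! : ℝ) ^ s := by
            gcongr
            exact factorial_add_rpow_le hs0 _ _
        _ = _ := by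
            rw [pow_add, mul_pow]
            ring
    have h3 : h ^ (i.2 + i.1) * (a ^ (i.2 + i.1) * ((i.2 + i.1)! : ℝ) ^ s) ≤ W :=
      Finset.single_le_sum (f := fun i : ℕ × ℕ =>
        h ^ (i.2 + i.1) * (a ^ (i.2 + i.1) * ((i.2 + i.1)! : ℝ) ^ s))
        (fun _ _ => by positivity) hi
    have h4 : h ^ k * R ^ l ≤ R ^ (k + l) := by
      rw [pow_add]
      gcongr
      have : 0 ≤ h⁻¹ + ‖B‖ * h := by positivity
      linarith
    calc (∏ i, ‖m i‖) * (C * h ^ k) * R ^ l *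
          (h ^ (i.2 + i.1) * ((0 + k + l + i.2 + i.1)! : ℝ) ^ s)
        ≤ (∏ i, ‖m i‖) * (C * h ^ k) * R ^ l *
          (h ^ (i.2 + i.1) * ((a * a) ^ (k + l) * (a ^ (i.2 + i.1) * ((i.2 + i.1)! : ℝ) ^ s) *
          ((k ! : ℝ) ^ s * (l ! : ℝ) ^ s))) := by gcongr
      _ = (∏ i, ‖m i‖) * C * (h ^ k * R ^ l) * (a * a) ^ (k + l) * ((k ! : ℝ) ^ s * (l ! : ℝ) ^ s) *
          (h ^ (i.2 + i.1) * (a ^ (i.2 + i.1) * ((i.2 + i.1)! : ℝ) ^ s)) := by ring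
      _ ≤ (∏ i, ‖m i‖) * C * R ^ (k + l) * (a * a) ^ (k + l) * ((k ! : ℝ) ^ s * (l ! : ℝ) ^ s) *
          W := by gcongr
      _ = _ := by
        rw [mul_pow (a * a)]
        ring
  rw [← Real.norm_of_nonneg (pow_nonneg (norm_nonneg x) l), ← norm_smul]
  refine ContinuousMultilinearMap.opNorm_le_bound (by positivity) fun m => ?_
  rw [smul_apply, ← iteratedLineDerivOp_eq_iteratedFDeriv]
  rcases eq_or_ne x 0 with rfl | hx
  · rcases Nat.eq_zero_or_pos l with rfl | hl
    · simpa using key 0 (by simp) m 0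
    · rw [norm_zero, zero_pow hl.ne', zero_smul, norm_zero]
      positivity
  · have hx' : ‖x‖ ≠ 0 := norm_ne_zero_iff.2 hx
    have h5 := key (‖x‖⁻¹ • x) (by rw [norm_smul, norm_inv, norm_norm, inv_mul_cancel₀ hx']) m x
    have h6 : ⟪x, ‖x‖⁻¹ • x⟫ = ‖x‖ := by
      rw [real_inner_smul_right, real_inner_self_eq_norm_sq]
      field_simp
    rwa [h6] at h5

end ChirpBound

/-! ### Inverse, transpose and time-frequency covariance of the chirp multiplier -/

section ChirpAlgebra

open scoped SchwartzMap FourierTransform ContDiff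
open SchwartzMap

variable {E : Type*} [NormedAddCommGroup E] [InnerProductSpace ℝ E]

lemma chirp_neg_left (B : E →L[ℝ] E) (z : E) : chirp (-B) z = conj (chirp B z) := by
  rw [chirp, chirp, ← Complex.exp_conj]
  congr 1
  simp only [map_mul, Complex.conj_I, Complex.conj_ofReal]
  simp

lemma chirp_neg_right (B : E →L[ℝ] E) (z : E) : chirp B (-z) = chirp B z := by
  simp [chirp]

lemma norm_chirp (B : E →L[ℝ] E) (z : E) : ‖chirp B z‖ = 1 := by
  rw [chirp, mul_comm, Complex.norm_exp_ofReal_mul_I]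

/-- The cross term of the quadratic form is a character in z; on the space side it is the
translation that shears X by BΞ. -/
lemma chirp_sub {B : E →L[ℝ] E} (hB : ∀ x y, ⟪B x, y⟫ = ⟪x, B y⟫) (z w : E) :
    chirp B (z - w) = chirp B z * chirp B w *
      Complex.exp (-(Complex.I * (4 * Real.pi ^ 2 * ⟪z, B w⟫ : ℝ))) := by
  rw [chirp, chirp, chirp, ← Complex.exp_add, ← Complex.exp_add]
  congr 1
  have h : ⟪B w, z⟫ = ⟪z, B w⟫ := real_inner_comm _ _
  rw [map_sub, inner_sub_left, inner_sub_right, inner_sub_right, h, hB z w]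
  push_cast
  ring

variable [FiniteDimensional ℝ E] [MeasurableSpace E] [BorelSpace E]

lemma schwartz_fourier_apply (f : 𝓢(E, ℂ)) (z : E) :
    𝓕 f z = ∫ y, Complex.exp (-(Complex.I * (2 * Real.pi * ⟪y, z⟫ : ℝ))) * f y := by
  rw [fourier_coe, Real.fourier_eq']
  refine integral_congr_ae (.of_forall fun y => ?_)
  simp only [smul_eq_mul]
  congr 2
  push_cast
  ring

lemma chirpOp_apply (B : E →L[ℝ] E) (f : 𝓢(E, ℂ)) (x : E) :
    chirpOp B f x =
      ∫ z, Complex.exp (Complex.I * (2 * Real.pi * ⟪z, x⟫ : ℝ)) * (chirp B z * 𝓕 f z) := by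
  rw [chirpOp_eq, fourierInv_coe, Real.fourierInv_eq']
  refine integral_congr_ae (.of_forall fun y => ?_)
  simp only [smul_eq_mul]
  rw [smulLeftCLM_apply_apply (chirp_hasTemperateGrowth B), smul_eq_mul]
  congr 2
  push_cast
  ring

lemma chirpOp_neg_chirpOp (B : E →L[ℝ] E) (f : 𝓢(E, ℂ)) : chirpOp (-B) (chirpOp B f) = f := by
  have h : chirp (-B) * chirp B = fun _ => 1 := by
    funext z
    rw [Pi.mul_apply, chirp_neg_left, mul_comm, Complex.mul_conj, Complex.normSq_eq_norm_sq,
      norm_chirp]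
    simp
  rw [chirpOp, chirpOp, fourierMultiplierCLM_fourierMultiplierCLM_apply
    (chirp_hasTemperateGrowth _) (chirp_hasTemperateGrowth _), h]
  simp

lemma fourier_fourierInv_neg (f : 𝓢(E, ℂ)) (z : E) : 𝓕 f (-z) = 𝓕⁻ f z := by
  rw [fourier_coe, fourierInv_coe, Real.fourierInv_eq_fourier_neg]

/-- The transpose of a Fourier multiplier has the reflected symbol, and the chirp is even. -/
lemma integral_chirpOp_mul (B : E →L[ℝ] E) (f g : 𝓢(E, ℂ)) :
    ∫ x, chirpOp B f x * g x = ∫ x, f x * chirpOp B g x := by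
  have hT := chirp_hasTemperateGrowth B
  rw [chirpOp_eq, integral_fourierInv_mul_eq]
  have h1 : ∫ x, smulLeftCLM ℂ (chirp B) (𝓕 f) x * 𝓕⁻ g x =
      ∫ x, 𝓕 f x * smulLeftCLM ℂ (chirp B) (𝓕⁻ g) x := by
    refine integral_congr_ae (.of_forall fun y => ?_)
    simp only [smulLeftCLM_apply_apply hT, smul_eq_mul]
    ring
  rw [h1, integral_fourier_mul_eq]
  refine integral_congr_ae (.of_forall fun x => ?_)
  simp only
  congr 1
  rw [schwartz_fourier_apply, chirpOp_apply, ← integral_neg_eq_self]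
  refine integral_congr_ae (.of_forall fun z => ?_)
  simp only [smulLeftCLM_apply_apply hT, smul_eq_mul, chirp_neg_right]
  rw [← fourier_fourierInv_neg, neg_neg]
  simp

/-- Conjugation reflects frequencies, which an even symbol does not notice, and conjugates the
chirp, which reverses the sign of B. -/
lemma conj_chirpOp (B : E →L[ℝ] E) (f g : 𝓢(E, ℂ)) (hg : ∀ x, g x = conj (f x)) (x : E) :
    conj (chirpOp B f x) = chirpOp (-B) g x := by
  have h1 : ∀ z, conj (𝓕 f z) = 𝓕 g (-z) := fun z => by
    rw [schwartz_fourier_apply, schwartz_fourier_apply, ← integral_conj]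
    refine integral_congr_ae (.of_forall fun y => ?_)
    simp only [map_mul, ← Complex.exp_conj, hg, map_neg, Complex.conj_I, Complex.conj_ofReal]
    simp
  rw [chirpOp_apply, chirpOp_apply, ← integral_conj, ← integral_neg_eq_self]
  refine integral_congr_ae (.of_forall fun z => ?_)
  simp only [map_mul, ← Complex.exp_conj, h1, ← chirp_neg_left, neg_neg, chirp_neg_right,
    Complex.conj_I, Complex.conj_ofReal]
  simp

/-- The operator `e^{i⟨B D, D⟩/2}` intertwines time-frequency shifts. -/
lemma chirpOp_shift {B : E →L[ℝ] E} (hB : ∀ x y, ⟪B x, y⟫ = ⟪x, B y⟫) (g h : 𝓢(E, ℂ)) (X Ξ : E)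
    (hh : ∀ y, h y = g (y - X) * Complex.exp (-(Complex.I * (⟪y, Ξ⟫ : ℝ)))) (y : E) :
    chirpOp B h y = Complex.exp (Complex.I * (⟪B Ξ, Ξ⟫ / 2 : ℝ)) *
      (chirpOp B g (y - (X + B Ξ)) * Complex.exp (-(Complex.I * (⟪y, Ξ⟫ : ℝ)))) := by
  have hpi : (2 * Real.pi : ℝ) ≠ 0 := by positivity
  obtain ⟨w, hw⟩ : ∃ w, Ξ = (2 * Real.pi) • w :=
    ⟨(2 * Real.pi)⁻¹ • Ξ, by rw [smul_smul, mul_inv_cancel₀ hpi, one_smul]⟩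
  -- On the frequency side the modulation is a translation by w = Ξ/2π and the translation by X a
  -- character. After the substitution z ↦ z - w, the cross term in `chirp_sub` is a second
  -- character, and the two combine to the translation by X + BΞ.
  have h1 : ∀ z, 𝓕 h (z - w) = Complex.exp (-(Complex.I * (2 * Real.pi * ⟪X, z⟫ : ℝ))) * 𝓕 g z := by
    intro z
    rw [schwartz_fourier_apply, schwartz_fourier_apply, ← integral_const_mul,
      ← integral_add_right_eq_self _ X]
    refine integral_congr_ae (.of_forall fun y => ?_)
    simp only [hh, add_sub_cancel_right]
    rw [mul_comm (g y), ← mul_assoc, ← mul_assoc, ← Complex.exp_add, ← Complex.exp_add]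
    congr 2
    rw [hw, inner_add_left, inner_add_left, inner_sub_right, inner_sub_right, real_inner_smul_right,
      real_inner_smul_right]
    push_cast
    ring
  rw [chirpOp_apply, chirpOp_apply, ← integral_mul_const, ← integral_const_mul,
    ← integral_sub_right_eq_self _ w]
  refine integral_congr_ae (.of_forall fun z => ?_)
  simp only [h1, chirp_sub hB]
  have e1 : chirp B w = Complex.exp (Complex.I * (⟪B Ξ, Ξ⟫ / 2 : ℝ)) := by
    rw [chirp, hw, map_smul, real_inner_smul_left, real_inner_smul_right]
    congr 2
    push_cast
    ring
  rw [e1]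
  have e2 : Complex.exp (Complex.I * (2 * Real.pi * ⟪z - w, y⟫ : ℝ)) *
      Complex.exp (-(Complex.I * (4 * Real.pi ^ 2 * ⟪z, B w⟫ : ℝ))) *
      Complex.exp (-(Complex.I * (2 * Real.pi * ⟪X, z⟫ : ℝ))) =
      Complex.exp (Complex.I * (2 * Real.pi * ⟪z, y - (X + B Ξ)⟫ : ℝ)) *
      Complex.exp (-(Complex.I * (⟪y, Ξ⟫ : ℝ))) := by
    rw [← Complex.exp_add, ← Complex.exp_add, ← Complex.exp_add]
    congr 1
    rw [hw, map_smul, inner_sub_left, inner_sub_right, inner_add_right, real_inner_smul_right,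
      real_inner_smul_right, real_inner_comm X z, real_inner_comm y w]
    push_cast
    ring
  linear_combination (chirp B z * Complex.exp (Complex.I * (⟪B Ξ, Ξ⟫ / 2 : ℝ)) * 𝓕 g z) * e2

end ChirpAlgebra

/-! ### Normalization of the Fourier transform, and the operator on 𝒮_{1/2} -/

section GSOperator

open scoped SchwartzMap FourierTransform ContDiff
open SchwartzMap

variable {ι : Type*} [Fintype ι] [DecidableEq ι]

/-- An element of `𝒮_s` as a Schwartz function. -/
noncomputable def GSSpace.toSchwartz {s : ℝ} (hs : 0 ≤ s) (f : GSSpace s ι) :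
    𝓢(EuclideanSpace ℝ ι, ℂ) :=
  (exists_schwartz hs f.2).choose

@[simp]
lemma GSSpace.coe_toSchwartz {s : ℝ} (hs : 0 ≤ s) (f : GSSpace s ι) :
    ⇑(GSSpace.toSchwartz hs f) = (f : EuclideanSpace ℝ ι → ℂ) :=
  (exists_schwartz hs f.2).choose_spec

lemma fourierConst_ne_zero (ι : Type*) [Fintype ι] : fourierConst ι ≠ 0 := by
  rw [fourierConst, Complex.ofReal_ne_zero]
  positivity

lemma fourierConst_mul_self_mul (ι : Type*) [Fintype ι] :
    fourierConst ι * fourierConst ι * ((2 * Real.pi) ^ Fintype.card ι : ℝ) = 1 := by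
  rw [fourierConst, ← Complex.ofReal_mul, ← Complex.ofReal_mul, ← Real.rpow_add (by positivity),
    ← Real.rpow_natCast, ← Real.rpow_add (by positivity)]
  ring_nf
  simp

lemma unitaryFourier_smul (f : 𝓢(EuclideanSpace ℝ ι, ℂ)) (z : EuclideanSpace ℝ ι) :
    unitaryFourier f ((2 * Real.pi) • z) = fourierConst ι * 𝓕 f z := by
  rw [unitaryFourier, schwartz_fourier_apply]
  congr 1
  refine integral_congr_ae (.of_forall fun y => ?_)
  simp only [real_inner_smul_right]
  rw [mul_comm]

lemma unitaryFourierInv_eq (g : EuclideanSpace ℝ ι → ℂ) (x : EuclideanSpace ℝ ι) :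
    unitaryFourierInv g x = fourierConst ι * (((2 * Real.pi) ^ Fintype.card ι : ℝ) *
      ∫ z, Complex.exp (Complex.I * (2 * Real.pi * ⟪z, x⟫ : ℝ)) * g ((2 * Real.pi) • z)) := by
  have h := Measure.integral_comp_smul (volume : Measure (EuclideanSpace ℝ ι))
    (fun z => g z * Complex.exp (Complex.I * (⟪x, z⟫ : ℝ))) (2 * Real.pi)
  have h1 : ∫ z : EuclideanSpace ℝ ι, g z * Complex.exp (Complex.I * (⟪x, z⟫ : ℝ)) =
      ((2 * Real.pi) ^ Fintype.card ι : ℝ) *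
      ∫ z, g ((2 * Real.pi) • z) * Complex.exp (Complex.I * (⟪x, (2 * Real.pi) • z⟫ : ℝ)) := by
    rw [h, finrank_euclideanSpace, abs_of_nonneg (by positivity), Complex.real_smul, ← mul_assoc,
      ← Complex.ofReal_mul, mul_inv_cancel₀ (by positivity)]
    simp
  rw [unitaryFourierInv, h1]
  congr 2
  refine integral_congr_ae (.of_forall fun z => ?_)
  simp only [real_inner_smul_right, real_inner_comm z x]
  rw [mul_comm]

/-- The substitution Ξ = 2πz passes between the two normalizations; its Jacobian (2π)^n cancels the
two constants (2π)^{-n/2}. -/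
lemma unitaryFourierInv_chirp (B : EuclideanSpace ℝ ι →L[ℝ] EuclideanSpace ℝ ι)
    (f : 𝓢(EuclideanSpace ℝ ι, ℂ)) :
    unitaryFourierInv (fun Ξ => Complex.exp (Complex.I * (⟪B Ξ, Ξ⟫ / 2 : ℝ)) * unitaryFourier f Ξ) =
      chirpOp B f := by
  funext x
  have h : ∫ z, Complex.exp (Complex.I * (2 * Real.pi * ⟪z, x⟫ : ℝ)) *
      (Complex.exp (Complex.I * (⟪B ((2 * Real.pi) • z), (2 * Real.pi) • z⟫ / 2 : ℝ)) *
        unitaryFourier f ((2 * Real.pi) • z)) = fourierConst ι * chirpOp B f x := by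
    rw [chirpOp_apply, ← integral_const_mul]
    refine integral_congr_ae (.of_forall fun z => ?_)
    simp only
    rw [unitaryFourier_smul, chirp, map_smul, real_inner_smul_left, real_inner_smul_right]
    have : (2 * Real.pi * (2 * Real.pi * ⟪B z, z⟫) / 2 : ℝ) = 2 * Real.pi ^ 2 * ⟪B z, z⟫ := by ring
    rw [this]
    ring
  rw [unitaryFourierInv_eq, h]
  linear_combination chirpOp B f x * fourierConst_mul_self_mul ι

lemma chirpOp_mem {s : ℝ} (hs : 1 / 2 ≤ s)
    {B : EuclideanSpace ℝ ι →L[ℝ] EuclideanSpace ℝ ι} (hB : ∀ x y, ⟪B x, y⟫ = ⟪x, B y⟫)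
    {f : 𝓢(EuclideanSpace ℝ ι, ℂ)} (hf : ⇑f ∈ GSSpace s ι) : ⇑(chirpOp B f) ∈ GSSpace s ι := by
  have hs0 : 0 ≤ s := by linarith
  obtain ⟨h1, h, hh, C, hC, hb⟩ := (mem_GSSpace_iff_bound hs0).1 hf
  obtain ⟨h', K, hh', hK, hb'⟩ := chirpOp_gsBound hs hh hB
  exact (mem_GSSpace_iff_bound hs0).2
    ⟨(chirpOp B f).smooth ⊤, h', hh', K * C, by positivity, hb' f C hC hb⟩

/-- The operator `e^{i⟨B D, D⟩/2}` on `𝒮_{1/2}`. -/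
noncomputable def gsOp (B : EuclideanSpace ℝ ι →L[ℝ] EuclideanSpace ℝ ι)
    (hB : ∀ x y, ⟪B x, y⟫ = ⟪x, B y⟫) : GSSpace (1 / 2) ι →ₗ[ℂ] GSSpace (1 / 2) ι where
  toFun f := ⟨chirpOp B (GSSpace.toSchwartz (by norm_num) f),
    chirpOp_mem le_rfl hB (by rw [GSSpace.coe_toSchwartz]; exact f.2)⟩
  map_add' f g := by
    have : GSSpace.toSchwartz (by norm_num) (f + g) = GSSpace.toSchwartz (by norm_num) f +
        GSSpace.toSchwartz (by norm_num) g := by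
      ext x
      simp [GSSpace.coe_toSchwartz]
    ext x
    simp [this]
  map_smul' c f := by
    have : GSSpace.toSchwartz (by norm_num) (c • f) = c • GSSpace.toSchwartz (by norm_num) f := by
      ext x
      simp [GSSpace.coe_toSchwartz]
    ext x
    simp [this]

lemma coe_gsOp {B : EuclideanSpace ℝ ι →L[ℝ] EuclideanSpace ℝ ι}
    (hB : ∀ x y, ⟪B x, y⟫ = ⟪x, B y⟫) {f : GSSpace (1 / 2) ι} {F : 𝓢(EuclideanSpace ℝ ι, ℂ)}
    (h : ⇑F = (f : EuclideanSpace ℝ ι → ℂ)) :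
    (gsOp B hB f : EuclideanSpace ℝ ι → ℂ) = chirpOp B F := by
  have : GSSpace.toSchwartz (by norm_num) f = F := by
    ext x
    rw [GSSpace.coe_toSchwartz, h]
  rw [← this]
  rfl

lemma gsOp_neg_gsOp {B : EuclideanSpace ℝ ι →L[ℝ] EuclideanSpace ℝ ι}
    (hB : ∀ x y, ⟪B x, y⟫ = ⟪x, B y⟫) (hB' : ∀ x y, ⟪(-B) x, y⟫ = ⟪x, (-B) y⟫)
    (f : GSSpace (1 / 2) ι) : gsOp (-B) hB' (gsOp B hB f) = f := by
  apply Subtype.ext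
  rw [coe_gsOp hB' (coe_gsOp hB (GSSpace.coe_toSchwartz (by norm_num) f)).symm,
    chirpOp_neg_chirpOp, GSSpace.coe_toSchwartz]

lemma gsOp_gsOp_neg {B : EuclideanSpace ℝ ι →L[ℝ] EuclideanSpace ℝ ι}
    (hB : ∀ x y, ⟪B x, y⟫ = ⟪x, B y⟫) (hB' : ∀ x y, ⟪(-B) x, y⟫ = ⟪x, (-B) y⟫)
    (f : GSSpace (1 / 2) ι) : gsOp B hB (gsOp (-B) hB' f) = f := by
  have h := gsOp_neg_gsOp hB' (by simpa using hB) f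
  simpa only [neg_neg] using h

lemma gsNorm_gsOp_le {B : EuclideanSpace ℝ ι →L[ℝ] EuclideanSpace ℝ ι}
    (hB : ∀ x y, ⟪B x, y⟫ = ⟪x, B y⟫) {h : ℝ} (hh : 0 < h) :
    ∃ h' : ℝ, 0 < h' ∧ ∃ K : ℝ≥0, ∀ f : GSSpace (1 / 2) ι,
      gsNorm (1 / 2) h' (gsOp B hB f : EuclideanSpace ℝ ι → ℂ) ≤
        K * gsNorm (1 / 2) h (f : EuclideanSpace ℝ ι → ℂ) := by
  obtain ⟨h', K, hh', hK, hb⟩ := chirpOp_gsBound (s := 1 / 2) (h := ((Fintype.card ι : ℝ) + 1) * h)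
    le_rfl (by positivity) hB
  -- The summand 1 keeps the constant nonzero, so that the right-hand side is ∞ whenever the norm of
  -- f is.
  refine ⟨((Fintype.card ι : ℝ) + 1) ^ (1 / 2 : ℝ) * h', by positivity, K.toNNReal + 1,
    fun f => ?_⟩
  rcases eq_or_ne (gsNorm (1 / 2) h (f : EuclideanSpace ℝ ι → ℂ)) ⊤ with ht | ht
  · rw [ht, ENNReal.mul_top (by simp)]
    exact le_top
  have h1 := gsBound_of_gsNorm (by norm_num) hh ht.lt_top
  have h2 := hb (GSSpace.toSchwartz (by norm_num) f) _ ENNReal.toReal_nonneg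
    (by rw [GSSpace.coe_toSchwartz]; exact h1)
  have h3 := h2.gsNorm_le (by norm_num) (mul_nonneg hK ENNReal.toReal_nonneg) hh'
  refine h3.trans ?_
  rw [ENNReal.ofReal_mul hK, ENNReal.ofReal_toReal ht]
  gcongr
  exact ENNReal.coe_le_coe.2 (by simp)

lemma integral_gsOp_mul {s : ℝ} (hs : 0 ≤ s) {B : EuclideanSpace ℝ ι →L[ℝ] EuclideanSpace ℝ ι}
    (hB : ∀ x y, ⟪B x, y⟫ = ⟪x, B y⟫) (f : GSSpace s ι) (g : GSSpace (1 / 2) ι) :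
    ∫ x, chirpOp B (GSSpace.toSchwartz hs f) x * (g : EuclideanSpace ℝ ι → ℂ) x =
      ∫ x, (f : EuclideanSpace ℝ ι → ℂ) x * (gsOp B hB g : EuclideanSpace ℝ ι → ℂ) x := by
  have := integral_chirpOp_mul B (GSSpace.toSchwartz hs f) (GSSpace.toSchwartz (by norm_num) g)
  rw [GSSpace.coe_toSchwartz, GSSpace.coe_toSchwartz] at this
  rw [this, coe_gsOp hB (GSSpace.coe_toSchwartz (by norm_num) g)]

/-- The conjugate of the transformed window is the multiplier of -B applied to the conjugate of φ,
so a further application of the operator undoes it. The shifts of the window Tφ are thus mapped back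
to shifts of φ itself. -/
lemma chirpOp_tfShift {B : EuclideanSpace ℝ ι →L[ℝ] EuclideanSpace ℝ ι}
    (hB : ∀ x y, ⟪B x, y⟫ = ⟪x, B y⟫) (φ h : 𝓢(EuclideanSpace ℝ ι, ℂ)) (X Ξ : EuclideanSpace ℝ ι)
    (hh : ⇑h = tfShift (chirpOp B φ) X Ξ) (y : EuclideanSpace ℝ ι) :
    chirpOp B h y =
      Complex.exp (Complex.I * (⟪B Ξ, Ξ⟫ / 2 : ℝ)) * tfShift φ (X + B Ξ) Ξ y := by
  set ψ : 𝓢(EuclideanSpace ℝ ι, ℂ) := φ.postcompCLM (𝕜 := ℝ)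
    (Complex.conjCLE : ℂ →L[ℝ] ℂ) with hψ
  have hψ' : ∀ x, ψ x = conj (φ x) := fun x => by simp [hψ]
  have h1 : ∀ y, h y = chirpOp (-B) ψ (y - X) * Complex.exp (-(Complex.I * (⟪y, Ξ⟫ : ℝ))) := by
    intro y
    rw [hh, tfShift, conj_chirpOp B φ ψ hψ']
  have h2 := chirpOp_neg_chirpOp (-B) ψ
  rw [neg_neg] at h2
  rw [chirpOp_shift hB _ h X Ξ h1 y, h2, hψ', tfShift]

end GSOperator

/-! ### Transposition to distributions and the short-time Fourier transform -/

section DualOperator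

variable {ι : Type*} [Fintype ι] [DecidableEq ι]

lemma GSDual.ext {s : ℝ} {u v : GSDual s ι} (h : ∀ g, u.pairing g = v.pairing g) : u = v :=
  Subtype.ext (LinearMap.ext h)

@[simp]
lemma GSDual.add_pairing {s : ℝ} (u v : GSDual s ι) (g : GSSpace s ι) :
    (u + v).pairing g = u.pairing g + v.pairing g := rfl

@[simp]
lemma GSDual.sub_pairing {s : ℝ} (u v : GSDual s ι) (g : GSSpace s ι) :
    (u - v).pairing g = u.pairing g - v.pairing g := rfl

@[simp]
lemma GSDual.smul_pairing {s : ℝ} (c : ℂ) (u : GSDual s ι) (g : GSSpace s ι) :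
    (c • u).pairing g = c * u.pairing g := rfl

lemma GSDual.pairing_smul {s : ℝ} (u : GSDual s ι) (c : ℂ) (g : GSSpace s ι) :
    u.pairing (c • g) = c * u.pairing g :=
  map_smul (show gsDual s ι from u).1 c g

/-- The transpose of `e^{i⟨B D, D⟩/2}` on `𝒮_{1/2}'`. -/
noncomputable def dualOp (B : EuclideanSpace ℝ ι →L[ℝ] EuclideanSpace ℝ ι)
    (hB : ∀ x y, ⟪B x, y⟫ = ⟪x, B y⟫) : GSDual (1 / 2) ι →ₗ[ℂ] GSDual (1 / 2) ι where
  toFun u := ⟨(show gsDual (1 / 2) ι from u).1.comp (gsOp B hB), by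
    intro h hh
    obtain ⟨h', hh', K, hK⟩ := gsNorm_gsOp_le hB hh
    obtain ⟨C, hC⟩ := (show gsDual (1 / 2) ι from u).2 h' hh'
    refine ⟨C * K, fun f => (hC _).trans ?_⟩
    rw [ENNReal.coe_mul, mul_assoc]
    gcongr
    exact hK f⟩
  map_add' _ _ := rfl
  map_smul' _ _ := rfl

@[simp]
lemma dualOp_pairing (B : EuclideanSpace ℝ ι →L[ℝ] EuclideanSpace ℝ ι)
    (hB : ∀ x y, ⟪B x, y⟫ = ⟪x, B y⟫) (u : GSDual (1 / 2) ι) (g : GSSpace (1 / 2) ι) :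
    (dualOp B hB u).pairing g = u.pairing (gsOp B hB g) := rfl

lemma continuous_pairing {s : ℝ} (g : GSSpace s ι) :
    Continuous fun u : GSDual s ι => u.pairing g :=
  (continuous_apply g).comp continuous_induced_dom

lemma continuous_dualOp (B : EuclideanSpace ℝ ι →L[ℝ] EuclideanSpace ℝ ι)
    (hB : ∀ x y, ⟪B x, y⟫ = ⟪x, B y⟫) : Continuous (dualOp B hB) :=
  continuous_induced_rng.2 (continuous_pi fun g => continuous_pairing (gsOp B hB g))

lemma dualOp_neg_dualOp {B : EuclideanSpace ℝ ι →L[ℝ] EuclideanSpace ℝ ι}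
    (hB : ∀ x y, ⟪B x, y⟫ = ⟪x, B y⟫) (hB' : ∀ x y, ⟪(-B) x, y⟫ = ⟪x, (-B) y⟫)
    (u : GSDual (1 / 2) ι) : dualOp (-B) hB' (dualOp B hB u) = u :=
  GSDual.ext fun g => by simp [gsOp_gsOp_neg hB hB']

lemma dualOp_dualOp_neg {B : EuclideanSpace ℝ ι →L[ℝ] EuclideanSpace ℝ ι}
    (hB : ∀ x y, ⟪B x, y⟫ = ⟪x, B y⟫) (hB' : ∀ x y, ⟪(-B) x, y⟫ = ⟪x, (-B) y⟫)
    (u : GSDual (1 / 2) ι) : dualOp B hB (dualOp (-B) hB' u) = u :=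
  GSDual.ext fun g => by simp [gsOp_neg_gsOp hB hB']

lemma dualOp_isFunction {s : ℝ} (hs : 0 ≤ s) {B : EuclideanSpace ℝ ι →L[ℝ] EuclideanSpace ℝ ι}
    (hB : ∀ x y, ⟪B x, y⟫ = ⟪x, B y⟫) (a : GSSpace s ι) {u : GSDual (1 / 2) ι}
    (hu : u.IsFunction a) : (dualOp B hB u).IsFunction (chirpOp B (GSSpace.toSchwartz hs a)) :=
  fun g => by rw [dualOp_pairing, hu, integral_gsOp_mul]

lemma stft_eq_integral (φ a : EuclideanSpace ℝ ι → ℂ) (X Ξ : EuclideanSpace ℝ ι) :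
    stft φ a X Ξ = fourierConst ι * ∫ y, a y * tfShift φ X Ξ y := by
  simp only [stft, unitaryFourier, tfShift, mul_assoc]

/-- Transposition moves the operator onto the shifted window, where `chirpOp_tfShift` evaluates it;
the phase leaves the pairing by linearity. -/
lemma stft_dualOp {B : EuclideanSpace ℝ ι →L[ℝ] EuclideanSpace ℝ ι}
    (hB : ∀ x y, ⟪B x, y⟫ = ⟪x, B y⟫) (φ : GSSpace (1 / 2) ι) (u : GSDual (1 / 2) ι)
    (X Ξ : EuclideanSpace ℝ ι) :
    (dualOp B hB u).stft (by norm_num) (gsOp B hB φ) X Ξ =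
      Complex.exp (Complex.I * (⟪B Ξ, Ξ⟫ / 2 : ℝ)) * u.stft (by norm_num) φ (X + B Ξ) Ξ := by
  have h0 : (0 : ℝ) ≤ 1 / 2 := by norm_num
  rw [GSDual.stft, GSDual.stft, dualOp_pairing, mul_left_comm]
  congr 1
  rw [← GSDual.pairing_smul]
  congr 1
  apply Subtype.ext
  set k : GSSpace (1 / 2) ι := ⟨tfShift (gsOp B hB φ : EuclideanSpace ℝ ι → ℂ) X Ξ,
    tfShift_mem h0 (gsOp B hB φ).2 X Ξ⟩
  rw [coe_gsOp hB (GSSpace.coe_toSchwartz h0 k)]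
  funext y
  rw [chirpOp_tfShift hB (GSSpace.toSchwartz h0 φ) _ X Ξ]
  · rw [GSSpace.coe_toSchwartz]
    rfl
  · rw [GSSpace.coe_toSchwartz, ← coe_gsOp hB (GSSpace.coe_toSchwartz h0 φ)]

lemma stft_chirpOp {s : ℝ} (hs : 0 ≤ s) {B : EuclideanSpace ℝ ι →L[ℝ] EuclideanSpace ℝ ι}
    (hB : ∀ x y, ⟪B x, y⟫ = ⟪x, B y⟫) {φ a : SchwartzMap (EuclideanSpace ℝ ι) ℂ}
    (hφ : ⇑(chirpOp B φ) ∈ GSSpace s ι) (X Ξ : EuclideanSpace ℝ ι) :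
    stft (chirpOp B φ) (chirpOp B a) X Ξ =
      Complex.exp (Complex.I * (⟪B Ξ, Ξ⟫ / 2 : ℝ)) * stft φ a (X + B Ξ) Ξ := by
  obtain ⟨k, hk⟩ := exists_schwartz hs (tfShift_mem hs hφ X Ξ)
  rw [stft_eq_integral, stft_eq_integral, mul_left_comm, ← hk, integral_chirpOp_mul]
  congr 1
  rw [← integral_const_mul]
  refine integral_congr_ae (.of_forall fun y => ?_)
  simp only [chirpOp_tfShift hB φ k X Ξ hk]
  ring

end DualOperator

/-! ### Gaussian decay in 𝒮_{1/2} and the growth of time-frequency shifts -/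

section GaussianDecay

open scoped SchwartzMap FourierTransform LineDeriv ContDiff Nat
open SchwartzMap

lemma sqrt_factorial_two_mul_le (m : ℕ) : ((2 * m)! : ℝ) ^ (1 / 2 : ℝ) ≤ 2 ^ m * m ! := by
  rw [← Real.sqrt_eq_rpow, Real.sqrt_le_left (by positivity)]
  have h := Nat.add_choose_mul_factorial_mul_factorial m m
  have h2 : (m + m).choose m ≤ 2 ^ (m + m) := Nat.choose_le_two_pow _ _
  rw [two_mul, ← h]
  push_cast
  have h3 : ((m + m).choose m : ℝ) ≤ 2 ^ (m + m) := by exact_mod_cast h2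
  calc ((m + m).choose m : ℝ) * m ! * m ! ≤ 2 ^ (m + m) * m ! * m ! := by gcongr
    _ = _ := by ring

/-- The even orders l = 2m are summed in the exponential series. Since √((2m)!) ≤ 2^m m!, the
divisor 4h² leaves a geometric series of ratio 1/2, with sum 2C. -/
lemma exp_sq_mul_le {t b C h : ℝ} (hh : 0 < h) (hC : 0 ≤ C)
    (H : ∀ l : ℕ, t ^ l * b ≤ C * (h ^ l * (l ! : ℝ) ^ (1 / 2 : ℝ))) :
    Real.exp (t ^ 2 / (4 * h ^ 2)) * b ≤ 2 * C := by
  have h1 : HasSum (fun m : ℕ => (t ^ 2 / (4 * h ^ 2)) ^ m / m ! * b)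
      (Real.exp (t ^ 2 / (4 * h ^ 2)) * b) := by
    rw [Real.exp_eq_exp_ℝ]
    exact (NormedSpace.expSeries_div_hasSum_exp (t ^ 2 / (4 * h ^ 2))).mul_right b
  have h2 : HasSum (fun m : ℕ => C * (1 / 2 : ℝ) ^ m) (C * 2) := hasSum_geometric_two.mul_left C
  rw [mul_comm 2 C]
  refine hasSum_le (fun m => ?_) h1 h2
  have h3 := H (2 * m)
  have h4 := sqrt_factorial_two_mul_le m
  calc (t ^ 2 / (4 * h ^ 2)) ^ m / m ! * b = (t ^ (2 * m) * b) / ((4 * h ^ 2) ^ m * m !) := by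
        rw [div_pow, ← pow_mul]
        field_simp
    _ ≤ (C * (h ^ (2 * m) * ((2 * m)! : ℝ) ^ (1 / 2 : ℝ))) / ((4 * h ^ 2) ^ m * m !) := by gcongr
    _ ≤ (C * (h ^ (2 * m) * (2 ^ m * m !))) / ((4 * h ^ 2) ^ m * m !) := by gcongr
    _ = _ := by
        rw [mul_pow, ← pow_mul, show (4 : ℝ) = 2 * 2 by norm_num, mul_pow]
        field_simp
        rw [mul_assoc, ← mul_pow]
        norm_num

/-- The square of the inequality is the bound of one term of the exponential series at t²/h² by the
whole sum. -/
lemma pow_le_mul_exp_sq {t h : ℝ} (ht : 0 ≤ t) (hh : 0 < h) (m : ℕ) :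
    t ^ m ≤ h ^ m * (m ! : ℝ) ^ (1 / 2 : ℝ) * Real.exp (t ^ 2 / (2 * h ^ 2)) := by
  have h1 : (t ^ 2 / h ^ 2) ^ m ≤ m ! * Real.exp (t ^ 2 / h ^ 2) := by
    have := Real.pow_div_factorial_le_exp (t ^ 2 / h ^ 2) (by positivity) m
    rwa [div_le_iff₀ (by positivity), mul_comm] at this
  have h2 : Real.exp (t ^ 2 / h ^ 2) = Real.exp (t ^ 2 / (2 * h ^ 2)) ^ 2 := by
    rw [← Real.exp_nat_mul]
    congr 1
    push_cast
    field_simp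
  refine (pow_le_pow_iff_left₀ (by positivity) (by positivity) two_ne_zero).1 ?_
  calc (t ^ m) ^ 2 = (h ^ m) ^ 2 * (t ^ 2 / h ^ 2) ^ m := by
        rw [div_pow, ← pow_mul, ← pow_mul, ← pow_mul]
        field_simp
        ring_nf
    _ ≤ (h ^ m) ^ 2 * (m ! * Real.exp (t ^ 2 / h ^ 2)) := by gcongr
    _ = _ := by
        rw [h2, mul_pow, mul_pow, ← Real.sqrt_eq_rpow, Real.sq_sqrt (by positivity)]
        ring

lemma GSBound.exp_mul_norm_le {E : Type*} [NormedAddCommGroup E] [NormedSpace ℝ E] {C h : ℝ}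
    {f : E → ℂ} (hh : 0 < h) (hC : 0 ≤ C) (hf : GSBound (1 / 2) C h f) (k : ℕ) (x : E) :
    ‖iteratedFDeriv ℝ k f x‖ ≤
      2 * C * (h ^ k * (k ! : ℝ) ^ (1 / 2 : ℝ)) * Real.exp (-(‖x‖ ^ 2 / (4 * h ^ 2))) := by
  have := exp_sq_mul_le (t := ‖x‖) (b := ‖iteratedFDeriv ℝ k f x‖)
    (C := C * (h ^ k * (k ! : ℝ) ^ (1 / 2 : ℝ))) hh (by positivity) fun l => by
      refine (hf k l x).trans (le_of_eq ?_)
      rw [pow_add]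
      ring
  rw [Real.exp_neg, ← div_eq_mul_inv, le_div_iff₀ (Real.exp_pos _), mul_comm]
  exact this.trans (le_of_eq (by ring))

variable {E : Type*} [NormedAddCommGroup E] [InnerProductSpace ℝ E]

lemma sqrt_factorial_mul_le {i k : ℕ} (h : i ≤ k) :
    (i ! : ℝ) ^ (1 / 2 : ℝ) * ((k - i)! : ℝ) ^ (1 / 2 : ℝ) ≤ (k ! : ℝ) ^ (1 / 2 : ℝ) := by
  rw [← Real.mul_rpow (by positivity) (by positivity)]
  refine Real.rpow_le_rpow (by positivity) ?_ (by norm_num)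
  exact_mod_cast Nat.le_of_dvd (Nat.factorial_pos _) (Nat.factorial_mul_factorial_dvd_factorial h)

/-- Since i!(k - i)! ≤ k!, the factorials leave the Leibniz sum, and the binomial theorem adds the
two scales. -/
lemma norm_iteratedFDeriv_mul_le_of_factorial {f g : E → ℂ} (hf : ContDiff ℝ ∞ f)
    (hg : ContDiff ℝ ∞ g) {x : E} {A D a d : ℝ} (hA : 0 ≤ A) (hD : 0 ≤ D) (ha : 0 ≤ a) (hd : 0 ≤ d)
    (h1 : ∀ k, ‖iteratedFDeriv ℝ k f x‖ ≤ A * (a ^ k * (k ! : ℝ) ^ (1 / 2 : ℝ)))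
    (h2 : ∀ k, ‖iteratedFDeriv ℝ k g x‖ ≤ D * (d ^ k * (k ! : ℝ) ^ (1 / 2 : ℝ))) (k : ℕ) :
    ‖iteratedFDeriv ℝ k (fun y => f y * g y) x‖ ≤
      A * D * ((a + d) ^ k * (k ! : ℝ) ^ (1 / 2 : ℝ)) := by
  refine (norm_iteratedFDeriv_mul_le hf hg x (n := k) (by exact_mod_cast le_top)).trans ?_
  calc _ ≤ ∑ i ∈ Finset.range (k + 1),
        (A * D * (k ! : ℝ) ^ (1 / 2 : ℝ)) * (a ^ i * d ^ (k - i) * (k.choose i : ℝ)) := by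
        refine Finset.sum_le_sum fun i hi => ?_
        have hik : i ≤ k := Nat.lt_succ_iff.1 (Finset.mem_range.1 hi)
        calc _ ≤ (k.choose i : ℝ) * (A * (a ^ i * (i ! : ℝ) ^ (1 / 2 : ℝ))) *
              (D * (d ^ (k - i) * ((k - i)! : ℝ) ^ (1 / 2 : ℝ))) := by
              gcongr
              · exact h1 i
              · exact h2 (k - i)
          _ = (A * D * ((i ! : ℝ) ^ (1 / 2 : ℝ) * ((k - i)! : ℝ) ^ (1 / 2 : ℝ))) *
              (a ^ i * d ^ (k - i) * (k.choose i : ℝ)) := by ring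
          _ ≤ _ := by
              gcongr
              exact sqrt_factorial_mul_le hik
    _ = _ := by
        rw [← Finset.mul_sum, ← add_pow]
        ring

/-- The character `y ↦ e^{-i⟨y, Ξ⟩}`. -/
noncomputable def expChar (Ξ y : E) : ℂ := Complex.exp (-(Complex.I * (⟪y, Ξ⟫ : ℝ)))

lemma expChar_eq_comp (Ξ : E) :
    expChar Ξ = (fun t : ℝ => Complex.exp (-Complex.I * t)) ∘ innerSL ℝ Ξ := by
  funext y
  simp [expChar, real_inner_comm]

lemma contDiff_cexp_neg_I : ContDiff ℝ ∞ fun t : ℝ => Complex.exp (-Complex.I * t) :=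
  ContDiff.cexp (contDiff_const.mul Complex.ofRealCLM.contDiff)

lemma contDiff_expChar (Ξ : E) : ContDiff ℝ ∞ (expChar Ξ) := by
  rw [expChar_eq_comp]
  exact contDiff_cexp_neg_I.comp (innerSL ℝ Ξ).contDiff

lemma norm_expChar (Ξ y : E) : ‖expChar Ξ y‖ = 1 := by
  simp [expChar, Complex.norm_exp]

lemma norm_iteratedFDeriv_expChar_le (Ξ y : E) (j : ℕ) :
    ‖iteratedFDeriv ℝ j (expChar Ξ) y‖ ≤ ‖Ξ‖ ^ j := by
  rw [expChar_eq_comp, ContinuousLinearMap.iteratedFDeriv_comp_right _ contDiff_cexp_neg_I y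
    (by exact_mod_cast le_top)]
  refine (ContinuousMultilinearMap.norm_compContinuousLinearMap_le _ _).trans ?_
  rw [norm_iteratedFDeriv_eq_norm_iteratedDeriv, congrFun (iteratedDeriv_cexp_real j) (innerSL ℝ Ξ y)]
  simp [Complex.norm_exp]

lemma norm_iteratedFDeriv_conj_sub (γ : E → ℂ) (X y : E) (j : ℕ) :
    ‖iteratedFDeriv ℝ j (fun y => conj (γ (y - X))) y‖ = ‖iteratedFDeriv ℝ j γ (y - X)‖ := by
  have : (fun y => conj (γ (y - X))) = Complex.conjLIE ∘ fun y => γ (y - X) := rfl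
  rw [this, LinearIsometryEquiv.norm_iteratedFDeriv_comp_left, iteratedFDeriv_comp_sub]

lemma contDiff_conj_sub {γ : E → ℂ} (hγ : ContDiff ℝ ∞ γ) (X : E) :
    ContDiff ℝ ∞ fun y => conj (γ (y - X)) :=
  Complex.conjLIE.contDiff.comp (hγ.comp (contDiff_id.sub contDiff_const))

/-- The powers of ‖X‖ in the binomial expansion of (‖y - X‖ + ‖X‖)^l are traded for a Gaussian in X.
Since H is free, the growth rate can be made as small as desired at the expense of the scale h + H.
-/
lemma GSBound.conj_sub {γ : E → ℂ} {C h H : ℝ} (hC : 0 ≤ C) (hh : 0 < h) (hH : 0 < H)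
    (hb : GSBound (1 / 2) C h γ) (X : E) :
    GSBound (1 / 2) (C * Real.exp (‖X‖ ^ 2 / (2 * H ^ 2))) (h + H) fun y => conj (γ (y - X)) := by
  intro k l y
  rw [norm_iteratedFDeriv_conj_sub]
  have hy : ‖y‖ ≤ ‖y - X‖ + ‖X‖ := by simpa using norm_add_le (y - X) X
  calc ‖y‖ ^ l * ‖iteratedFDeriv ℝ k γ (y - X)‖
      ≤ (‖y - X‖ + ‖X‖) ^ l * ‖iteratedFDeriv ℝ k γ (y - X)‖ := by gcongr
    _ = ∑ j ∈ Finset.range (l + 1), (‖y - X‖ ^ j * ‖iteratedFDeriv ℝ k γ (y - X)‖) *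
          ‖X‖ ^ (l - j) * (l.choose j : ℝ) := by
        rw [add_pow, Finset.sum_mul]
        exact Finset.sum_congr rfl fun j _ => by ring
    _ ≤ ∑ j ∈ Finset.range (l + 1), (C * Real.exp (‖X‖ ^ 2 / (2 * H ^ 2)) * h ^ k *
          (k ! : ℝ) ^ (1 / 2 : ℝ) * (l ! : ℝ) ^ (1 / 2 : ℝ)) *
          (h ^ j * H ^ (l - j) * (l.choose j : ℝ)) := by
        refine Finset.sum_le_sum fun j hj => ?_
        have hjl : j ≤ l := Nat.lt_succ_iff.1 (Finset.mem_range.1 hj)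
        calc _ ≤ (C * (h ^ (k + j) * (k ! : ℝ) ^ (1 / 2 : ℝ) * (j ! : ℝ) ^ (1 / 2 : ℝ))) *
              (H ^ (l - j) * ((l - j)! : ℝ) ^ (1 / 2 : ℝ) * Real.exp (‖X‖ ^ 2 / (2 * H ^ 2))) *
              (l.choose j : ℝ) := by
              refine mul_le_mul_of_nonneg_right (mul_le_mul (hb k j _)
                (pow_le_mul_exp_sq (norm_nonneg X) hH _) (by positivity) (by positivity))
                (by positivity)
          _ = (C * Real.exp (‖X‖ ^ 2 / (2 * H ^ 2)) * h ^ k * (k ! : ℝ) ^ (1 / 2 : ℝ) *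
              ((j ! : ℝ) ^ (1 / 2 : ℝ) * ((l - j)! : ℝ) ^ (1 / 2 : ℝ))) *
              (h ^ j * H ^ (l - j) * (l.choose j : ℝ)) := by
              rw [pow_add]
              ring
          _ ≤ _ := by
              gcongr
              exact sqrt_factorial_mul_le hjl
    _ = C * Real.exp (‖X‖ ^ 2 / (2 * H ^ 2)) * (h ^ k * (h + H) ^ l *
          (k ! : ℝ) ^ (1 / 2 : ℝ) * (l ! : ℝ) ^ (1 / 2 : ℝ)) := by
        rw [← Finset.mul_sum, ← add_pow]
        ring
    _ ≤ C * Real.exp (‖X‖ ^ 2 / (2 * H ^ 2)) * ((h + H) ^ k * (h + H) ^ l *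
          (k ! : ℝ) ^ (1 / 2 : ℝ) * (l ! : ℝ) ^ (1 / 2 : ℝ)) := by
        gcongr
        linarith
    _ = _ := by rw [pow_add]

/-- The frequency counterpart of `GSBound.conj_sub`: the powers of ‖Ξ‖ come from derivatives of the
character in the Leibniz rule. -/
lemma GSBound.mul_expChar {f : E → ℂ} {C h H : ℝ} (hf : ContDiff ℝ ∞ f) (hC : 0 ≤ C) (hh : 0 < h)
    (hH : 0 < H) (hb : GSBound (1 / 2) C h f) (Ξ : E) :
    GSBound (1 / 2) (C * Real.exp (‖Ξ‖ ^ 2 / (2 * H ^ 2))) (h + H) fun y => f y * expChar Ξ y := by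
  intro k l y
  refine (mul_le_mul_of_nonneg_left (norm_iteratedFDeriv_mul_le hf (contDiff_expChar Ξ) y (n := k)
    (by exact_mod_cast le_top)) (by positivity)).trans ?_
  calc _ = ∑ i ∈ Finset.range (k + 1), (‖y‖ ^ l * ‖iteratedFDeriv ℝ i f y‖) *
          ‖iteratedFDeriv ℝ (k - i) (expChar Ξ) y‖ * (k.choose i : ℝ) := by
        rw [Finset.mul_sum]
        exact Finset.sum_congr rfl fun j _ => by ring
    _ ≤ ∑ i ∈ Finset.range (k + 1), (C * Real.exp (‖Ξ‖ ^ 2 / (2 * H ^ 2)) * h ^ l *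
          (k ! : ℝ) ^ (1 / 2 : ℝ) * (l ! : ℝ) ^ (1 / 2 : ℝ)) *
          (h ^ i * H ^ (k - i) * (k.choose i : ℝ)) := by
        refine Finset.sum_le_sum fun i hi => ?_
        have hik : i ≤ k := Nat.lt_succ_iff.1 (Finset.mem_range.1 hi)
        calc _ ≤ (C * (h ^ (i + l) * (i ! : ℝ) ^ (1 / 2 : ℝ) * (l ! : ℝ) ^ (1 / 2 : ℝ))) *
              (H ^ (k - i) * ((k - i)! : ℝ) ^ (1 / 2 : ℝ) * Real.exp (‖Ξ‖ ^ 2 / (2 * H ^ 2))) *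
              (k.choose i : ℝ) := by
              refine mul_le_mul_of_nonneg_right (mul_le_mul (hb i l y)
                ((norm_iteratedFDeriv_expChar_le Ξ y _).trans
                  (pow_le_mul_exp_sq (norm_nonneg Ξ) hH _)) (norm_nonneg _) (by positivity))
                (by positivity)
          _ = (C * Real.exp (‖Ξ‖ ^ 2 / (2 * H ^ 2)) * h ^ l *
              ((i ! : ℝ) ^ (1 / 2 : ℝ) * ((k - i)! : ℝ) ^ (1 / 2 : ℝ)) * (l ! : ℝ) ^ (1 / 2 : ℝ)) *
              (h ^ i * H ^ (k - i) * (k.choose i : ℝ)) := by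
              rw [pow_add]
              ring
          _ ≤ _ := by
              gcongr
              exact sqrt_factorial_mul_le hik
    _ = C * Real.exp (‖Ξ‖ ^ 2 / (2 * H ^ 2)) * ((h + H) ^ k * h ^ l *
          (k ! : ℝ) ^ (1 / 2 : ℝ) * (l ! : ℝ) ^ (1 / 2 : ℝ)) := by
        rw [← Finset.mul_sum, ← add_pow]
        ring
    _ ≤ C * Real.exp (‖Ξ‖ ^ 2 / (2 * H ^ 2)) * ((h + H) ^ k * (h + H) ^ l *
          (k ! : ℝ) ^ (1 / 2 : ℝ) * (l ! : ℝ) ^ (1 / 2 : ℝ)) := by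
        gcongr
        linarith
    _ = _ := by rw [pow_add]

variable {ι : Type*} [Fintype ι]

lemma tfShift_eq_mul_expChar (γ : EuclideanSpace ℝ ι → ℂ) (X Ξ : EuclideanSpace ℝ ι) :
    tfShift γ X Ξ = fun y => conj (γ (y - X)) * expChar Ξ y := rfl

lemma norm_tfShift (γ : EuclideanSpace ℝ ι → ℂ) (X Ξ y : EuclideanSpace ℝ ι) :
    ‖tfShift γ X Ξ y‖ = ‖γ (y - X)‖ := by
  rw [tfShift_eq_mul_expChar, norm_mul, norm_expChar, mul_one, RCLike.norm_conj]

/-- The growth of time-frequency shifts in `𝒮_{1/2,h}`. -/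
lemma GSBound.tfShift {γ : EuclideanSpace ℝ ι → ℂ} {C h H : ℝ} (hγ : ContDiff ℝ ∞ γ) (hC : 0 ≤ C)
    (hh : 0 < h) (hH : 0 < H) (hb : GSBound (1 / 2) C h γ) (X Ξ : EuclideanSpace ℝ ι) :
    GSBound (1 / 2) (C * Real.exp (‖X‖ ^ 2 / (2 * H ^ 2)) * Real.exp (‖Ξ‖ ^ 2 / (2 * H ^ 2)))
      (h + H + H) (tfShift γ X Ξ) :=
  (hb.conj_sub hC hh hH X).mul_expChar (contDiff_conj_sub hγ X) (by positivity) (by positivity) hH Ξ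

end GaussianDecay

/-! ### Gaussian decay of Fourier transforms -/

section FourierDecay

open scoped SchwartzMap FourierTransform LineDeriv ContDiff Nat
open SchwartzMap

variable {E : Type*} [NormedAddCommGroup E] [InnerProductSpace ℝ E] [FiniteDimensional ℝ E]
  [MeasurableSpace E] [BorelSpace E]

lemma fourier_iteratedLineDeriv (f : 𝓢(E, ℂ)) {k : ℕ} (m : Fin k → E) (z : E) :
    𝓕 (∂^{m} f) z = (∏ i, (2 * Real.pi * Complex.I * (⟪z, m i⟫ : ℝ))) * 𝓕 f z := by
  induction k with
  | zero => simp
  | succ k ih =>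
    rw [LineDeriv.iteratedLineDerivOp_succ_left, fourier_lineDerivOp_eq, smul_apply,
      smulLeftCLM_apply_apply (by fun_prop), ih, Fin.prod_univ_succ, Complex.real_smul, smul_eq_mul]
    simp only [Fin.tail]
    ring

lemma norm_fourier_le_integral (f : 𝓢(E, ℂ)) (z : E) : ‖𝓕 f z‖ ≤ ∫ x, ‖f x‖ := by
  rw [schwartz_fourier_apply]
  refine (norm_integral_le_integral_norm _).trans (le_of_eq ?_)
  congr 1
  funext y
  rw [norm_mul, ← mul_neg, ← Complex.ofReal_neg, mul_comm Complex.I, Complex.norm_exp_ofReal_mul_I,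
    one_mul]

lemma norm_iteratedLineDeriv_le (f : 𝓢(E, ℂ)) {k : ℕ} (m : Fin k → E) (x : E) :
    ‖(∂^{m} f : 𝓢(E, ℂ)) x‖ ≤ ‖iteratedFDeriv ℝ k f x‖ * ∏ i, ‖m i‖ := by
  rw [iteratedLineDerivOp_eq_iteratedFDeriv]
  exact ContinuousMultilinearMap.le_opNorm _ _

lemma integrable_norm_iteratedFDeriv (f : 𝓢(E, ℂ)) (k : ℕ) :
    Integrable fun x => ‖iteratedFDeriv ℝ k f x‖ := by
  simpa using f.integrable_pow_mul_iteratedFDeriv volume 0 k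

/-- All k derivatives are taken in the unit direction of z, where each contributes exactly 2π‖z‖; no
constant depending on the dimension arises. At z = 0 there is no direction, and the case is trivial.
-/
lemma pow_mul_norm_fourier_le (f : 𝓢(E, ℂ)) (z : E) (k : ℕ) :
    (2 * Real.pi * ‖z‖) ^ k * ‖𝓕 f z‖ ≤ ∫ x, ‖iteratedFDeriv ℝ k f x‖ := by
  rcases eq_or_ne z 0 with rfl | hz
  · rcases Nat.eq_zero_or_pos k with rfl | hk
    · simpa using norm_fourier_le_integral f 0
    · rw [norm_zero, mul_zero, zero_pow hk.ne', zero_mul]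
      exact integral_nonneg fun _ => norm_nonneg _
  have hz' : ‖z‖ ≠ 0 := norm_ne_zero_iff.2 hz
  set m : Fin k → E := fun _ => ‖z‖⁻¹ • z with hm
  have hm1 : ∀ i, ‖m i‖ = 1 := fun i => by
    rw [hm, norm_smul, norm_inv, norm_norm, inv_mul_cancel₀ hz']
  have hm2 : ∀ i, ⟪z, m i⟫ = ‖z‖ := fun i => by
    rw [hm, real_inner_smul_right, real_inner_self_eq_norm_sq]
    field_simp
  have h1 : (2 * Real.pi * ‖z‖) ^ k * ‖𝓕 f z‖ = ‖𝓕 (∂^{m} f) z‖ := by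
    rw [fourier_iteratedLineDeriv, norm_mul, norm_prod]
    simp [hm2, abs_of_pos Real.pi_pos]
  rw [h1]
  refine (norm_fourier_le_integral _ z).trans (integral_mono (∂^{m} f : 𝓢(E, ℂ)).integrable.norm
    (integrable_norm_iteratedFDeriv f k) fun x => ?_)
  simpa [hm1] using norm_iteratedLineDeriv_le f m x

lemma integrable_exp_neg_mul_norm_sq {c : ℝ} (hc : 0 < c) :
    Integrable fun x : E => Real.exp (-(c * ‖x‖ ^ 2)) := by
  have h := (GaussianFourier.integrable_cexp_neg_mul_sq_norm_add (V := E) (b := (c : ℂ))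
    (by simpa using hc) 0 0).norm
  refine h.congr (.of_forall fun x => ?_)
  simp [Complex.norm_exp, ← Complex.ofReal_pow]

/-- The growth √k! of the derivatives is the input of `exp_sq_mul_le` with t = 2π‖z‖; the Gaussian
factor in x only makes the derivatives integrable. -/
lemma norm_fourier_le_exp {f : 𝓢(E, ℂ)} {A h c : ℝ} (hA : 0 ≤ A) (hh : 0 < h) (hc : 0 < c)
    (hf : ∀ k x, ‖iteratedFDeriv ℝ k f x‖ ≤
      A * (h ^ k * (k ! : ℝ) ^ (1 / 2 : ℝ)) * Real.exp (-(c * ‖x‖ ^ 2))) (z : E) :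
    ‖𝓕 f z‖ ≤ 2 * (A * ∫ x : E, Real.exp (-(c * ‖x‖ ^ 2))) *
      Real.exp (-((2 * Real.pi * ‖z‖) ^ 2 / (4 * h ^ 2))) := by
  have hI : 0 ≤ ∫ x : E, Real.exp (-(c * ‖x‖ ^ 2)) := integral_nonneg fun _ => by positivity
  have := exp_sq_mul_le (t := 2 * Real.pi * ‖z‖) (b := ‖𝓕 f z‖)
    (C := A * ∫ x : E, Real.exp (-(c * ‖x‖ ^ 2))) hh (by positivity) fun k => by
      refine (pow_mul_norm_fourier_le f z k).trans ?_
      calc _ ≤ ∫ x : E, A * (h ^ k * (k ! : ℝ) ^ (1 / 2 : ℝ)) * Real.exp (-(c * ‖x‖ ^ 2)) :=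
            integral_mono (integrable_norm_iteratedFDeriv f k)
              ((integrable_exp_neg_mul_norm_sq hc).const_mul _) fun x => hf k x
        _ = _ := by
            rw [integral_const_mul]
            ring
  rw [Real.exp_neg, ← div_eq_mul_inv, le_div_iff₀ (Real.exp_pos _), mul_comm]
  exact this

end FourierDecay

/-! ### Linear combinations with uniform estimates -/

section Combination

open scoped ContDiff

variable {E : Type*} [NormedAddCommGroup E] [NormedSpace ℝ E]

lemma GSBound.add {s C D h : ℝ} {f g : E → ℂ} (hf : ContDiff ℝ ∞ f) (hg : ContDiff ℝ ∞ g)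
    (hbf : GSBound s C h f) (hbg : GSBound s D h g) : GSBound s (C + D) h (f + g) := by
  intro k l x
  have hk : ((k : ℕ∞) : WithTop ℕ∞) ≤ ∞ := by exact_mod_cast le_top
  rw [iteratedFDeriv_add_apply (hf.of_le hk).contDiffAt (hg.of_le hk).contDiffAt]
  calc _ ≤ ‖x‖ ^ l * (‖iteratedFDeriv ℝ k f x‖ + ‖iteratedFDeriv ℝ k g x‖) := by
        gcongr
        exact norm_add_le _ _
    _ ≤ _ := by
      rw [mul_add, add_mul]
      exact add_le_add (hbf _ _ _) (hbg _ _ _)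

lemma GSBound.const_smul {s C h : ℝ} {f : E → ℂ} (hf : ContDiff ℝ ∞ f) (hbf : GSBound s C h f)
    (c : ℂ) : GSBound s (‖c‖ * C) h (c • f) := by
  intro k l x
  have hk : ((k : ℕ∞) : WithTop ℕ∞) ≤ ∞ := by exact_mod_cast le_top
  rw [iteratedFDeriv_const_smul_apply (hf.of_le hk).contDiffAt, norm_smul, mul_left_comm, mul_assoc]
  exact mul_le_mul_of_nonneg_left (hbf k l x) (norm_nonneg c)

variable {ι : Type*} [Fintype ι] [DecidableEq ι]

lemma GSSpace.contDiff {s : ℝ} (f : GSSpace s ι) :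
    ContDiff ℝ ∞ (f : EuclideanSpace ℝ ι → ℂ) := f.2.1

lemma GSSpace.continuous {s : ℝ} (f : GSSpace s ι) :
    Continuous (f : EuclideanSpace ℝ ι → ℂ) := (GSSpace.contDiff f).continuous

lemma GSSpace.exists_bound {s : ℝ} (hs : 0 ≤ s) (f : GSSpace s ι) :
    ∃ h : ℝ, 0 < h ∧ ∃ C : ℝ, 0 ≤ C ∧ GSBound s C h (f : EuclideanSpace ℝ ι → ℂ) :=
  ((mem_GSSpace_iff_bound hs).1 f.2).2

lemma GSBound.finset_sum {α : Type*} {s h : ℝ} (t : Finset α) (c : α → ℂ) (f : α → GSSpace s ι)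
    {C : α → ℝ} (hC : ∀ i ∈ t, GSBound s (C i) h (f i : EuclideanSpace ℝ ι → ℂ)) :
    GSBound s (∑ i ∈ t, ‖c i‖ * C i) h ((∑ i ∈ t, c i • f i : GSSpace s ι) :
      EuclideanSpace ℝ ι → ℂ) := by
  classical
  induction t using Finset.induction_on with
  | empty =>
    intro k l x
    simp
  | insert a t ha ih =>
    rw [Finset.sum_insert ha, Finset.sum_insert ha]
    exact ((hC a (Finset.mem_insert_self a t)).const_smul (GSSpace.contDiff (f a)) (c a)).add
      (GSSpace.contDiff (c a • f a)) (GSSpace.contDiff (∑ i ∈ t, c i • f i))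
      (ih fun i hi => hC i (Finset.mem_insert_of_mem hi))

end Combination

/-! ### Convergence of bounded pointwise null sequences in 𝒮_{1/2} -/

section Montel

open scoped SchwartzMap FourierTransform LineDeriv ContDiff Nat
open SchwartzMap Filter

variable {E : Type*} [NormedAddCommGroup E] [InnerProductSpace ℝ E] [FiniteDimensional ℝ E]
  [MeasurableSpace E] [BorelSpace E]

lemma norm_fourierInv_le_integral (f : 𝓢(E, ℂ)) (z : E) : ‖𝓕⁻ f z‖ ≤ ∫ x, ‖f x‖ := by
  rw [← fourier_fourierInv_neg]
  exact norm_fourier_le_integral f _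

lemma integrable_pow_mul_fourier (f : 𝓢(E, ℂ)) (k : ℕ) :
    Integrable fun z => (2 * Real.pi * ‖z‖) ^ k * ‖𝓕 f z‖ := by
  have := ((𝓕 f).integrable_pow_mul volume k).const_mul ((2 * Real.pi) ^ k)
  refine this.congr (.of_forall fun z => ?_)
  simp only
  ring

/-- By Fourier inversion, uniform bounds of derivatives reduce to weighted integrals of the
transform. Two applications of dominated convergence, one for the transform and one for these
integrals, then upgrade pointwise convergence to uniform convergence of every derivative. -/
lemma norm_iteratedFDeriv_le_integral_fourier (f : 𝓢(E, ℂ)) (k : ℕ) (x : E) :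
    ‖iteratedFDeriv ℝ k f x‖ ≤ ∫ z, (2 * Real.pi * ‖z‖) ^ k * ‖𝓕 f z‖ := by
  refine ContinuousMultilinearMap.opNorm_le_bound
    (integral_nonneg fun z => by positivity) fun m => ?_
  rw [← iteratedLineDerivOp_eq_iteratedFDeriv,
    ← FourierTransform.fourierInv_fourier_eq (F := 𝓢(E, ℂ)) (∂^{m} f : 𝓢(E, ℂ))]
  refine (norm_fourierInv_le_integral _ x).trans ?_
  rw [← integral_mul_const]
  refine integral_mono (𝓕 (∂^{m} f : 𝓢(E, ℂ))).integrable.norm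
    ((integrable_pow_mul_fourier f k).mul_const _) fun z => ?_
  have hp : ∏ i, ‖2 * Real.pi * Complex.I * (⟪z, m i⟫ : ℝ)‖ ≤
      (2 * Real.pi * ‖z‖) ^ k * ∏ i, ‖m i‖ := by
    calc _ ≤ ∏ i, (2 * Real.pi * ‖z‖) * ‖m i‖ := by
          refine Finset.prod_le_prod (fun i _ => norm_nonneg _) fun i _ => ?_
          have := norm_inner_le_norm (𝕜 := ℝ) z (m i)
          simp only [norm_mul, Complex.norm_ofNat, Complex.norm_real, Complex.norm_I, mul_one,
            Real.norm_of_nonneg Real.pi_pos.le]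
          rw [mul_assoc (2 * Real.pi)]
          gcongr
      _ = _ := by
          rw [Finset.prod_mul_distrib, Finset.prod_const, Finset.card_univ, Fintype.card_fin]
  simp only
  rw [fourier_iteratedLineDeriv, norm_mul, norm_prod]
  exact (mul_le_mul_of_nonneg_right hp (norm_nonneg (𝓕 f z))).trans (le_of_eq (by ring))

lemma integrable_pow_mul_exp {c : ℝ} (hc : 0 < c) (k : ℕ) :
    Integrable fun z : E => (2 * Real.pi * ‖z‖) ^ k * Real.exp (-(c * ‖z‖ ^ 2)) := by
  -- With this H the power costs the factor exp(c‖z‖²/2), half of the available decay.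
  set H : ℝ := 2 * Real.pi / Real.sqrt c with hH
  have hcs : 0 < Real.sqrt c := Real.sqrt_pos.2 hc
  have hH0 : 0 < H := by positivity
  refine ((integrable_exp_neg_mul_norm_sq (E := E) (half_pos hc)).const_mul
    (H ^ k * (k ! : ℝ) ^ (1 / 2 : ℝ))).mono' (by fun_prop) (.of_forall fun z => ?_)
  rw [Real.norm_of_nonneg (by positivity)]
  have h1 := pow_le_mul_exp_sq (t := 2 * Real.pi * ‖z‖) (by positivity) hH0 k
  have h2 : (2 * Real.pi * ‖z‖) ^ 2 / (2 * H ^ 2) = c / 2 * ‖z‖ ^ 2 := by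
    rw [hH, div_pow, Real.sq_sqrt hc.le]
    field_simp
  rw [h2] at h1
  calc _ ≤ H ^ k * (k ! : ℝ) ^ (1 / 2 : ℝ) * Real.exp (c / 2 * ‖z‖ ^ 2) *
        Real.exp (-(c * ‖z‖ ^ 2)) := by gcongr
    _ = _ := by
      rw [mul_assoc _ (Real.exp _), ← Real.exp_add]
      congr 2
      ring

variable {F : ℕ → 𝓢(E, ℂ)} {C h : ℝ}

lemma tendsto_fourier_zero (hC : 0 ≤ C) (hh : 0 < h) (hb : ∀ j, GSBound (1 / 2) C h (F j))
    (hF : ∀ x, Tendsto (fun j => F j x) atTop (𝓝 0)) (z : E) :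
    Tendsto (fun j => 𝓕 (F j) z) atTop (𝓝 0) := by
  simp only [schwartz_fourier_apply]
  have hn : ∀ y : E, ‖Complex.exp (-(Complex.I * (2 * Real.pi * ⟪y, z⟫ : ℝ)))‖ = 1 := fun y => by
    rw [← mul_neg, ← Complex.ofReal_neg, mul_comm Complex.I, Complex.norm_exp_ofReal_mul_I]
  rw [← integral_zero E ℂ]
  refine tendsto_integral_of_dominated_convergence
    (fun x => 2 * C * Real.exp (-((4 * h ^ 2)⁻¹ * ‖x‖ ^ 2))) (fun j => ?_)
    ((integrable_exp_neg_mul_norm_sq (by positivity)).const_mul _) (fun j => .of_forall fun y => ?_)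
    (.of_forall fun y => ?_)
  · exact Continuous.aestronglyMeasurable (by fun_prop)
  · rw [norm_mul, hn, one_mul]
    have := (hb j).exp_mul_norm_le hh hC 0 y
    rw [norm_iteratedFDeriv_zero] at this
    refine this.trans (le_of_eq ?_)
    simp [div_eq_inv_mul]
  · simpa using (hF y).const_mul _

lemma norm_fourier_le_of_gsBound (hC : 0 ≤ C) (hh : 0 < h) {f : 𝓢(E, ℂ)}
    (hb : GSBound (1 / 2) C h f) (z : E) :
    ‖𝓕 f z‖ ≤ 2 * (2 * C * ∫ x : E, Real.exp (-((4 * h ^ 2)⁻¹ * ‖x‖ ^ 2))) *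
      Real.exp (-(((2 * Real.pi) ^ 2 / (4 * h ^ 2)) * ‖z‖ ^ 2)) := by
  refine (norm_fourier_le_exp (c := (4 * h ^ 2)⁻¹) (A := 2 * C) (by positivity) hh (by positivity)
    (fun k x => (hb.exp_mul_norm_le hh hC k x).trans (le_of_eq ?_)) z).trans (le_of_eq ?_)
  · rw [div_eq_inv_mul (‖x‖ ^ 2)]
  · congr 2
    ring

lemma tendsto_integral_pow_mul_fourier (hC : 0 ≤ C) (hh : 0 < h)
    (hb : ∀ j, GSBound (1 / 2) C h (F j)) (hF : ∀ x, Tendsto (fun j => F j x) atTop (𝓝 0)) (k : ℕ) :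
    Tendsto (fun j => ∫ z, (2 * Real.pi * ‖z‖) ^ k * ‖𝓕 (F j) z‖) atTop (𝓝 0) := by
  rw [← integral_zero E ℝ]
  set K := 2 * (2 * C * ∫ x : E, Real.exp (-((4 * h ^ 2)⁻¹ * ‖x‖ ^ 2)))
  set c := (2 * Real.pi) ^ 2 / (4 * h ^ 2)
  refine tendsto_integral_of_dominated_convergence
    (fun z => K * ((2 * Real.pi * ‖z‖) ^ k * Real.exp (-(c * ‖z‖ ^ 2))))
    (fun j => (integrable_pow_mul_fourier (F j) k).aestronglyMeasurable)
    ((integrable_pow_mul_exp (by positivity) k).const_mul K) (fun j => .of_forall fun z => ?_)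
    (.of_forall fun z => ?_)
  · rw [Real.norm_of_nonneg (by positivity), mul_left_comm]
    gcongr
    exact norm_fourier_le_of_gsBound hC hh (hb j) z
  · simpa using (tendsto_fourier_zero hC hh hb hF z).norm.const_mul ((2 * Real.pi * ‖z‖) ^ k)

/-- A bounded sequence of `𝒮_{1/2,h}` that tends to zero pointwise tends to zero in
`𝒮_{1/2,2h}`. -/
lemma eventually_gsBound (hC : 0 ≤ C) (hh : 0 < h)
    (hb : ∀ j, GSBound (1 / 2) C h (F j)) (hF : ∀ x, Tendsto (fun j => F j x) atTop (𝓝 0))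
    {δ : ℝ} (hδ : 0 < δ) : ∀ᶠ j in atTop, GSBound (1 / 2) δ (2 * h) (F j) := by
  -- Doubling h gains 2^{-(k+l)}, which settles all orders k + l ≥ N; only finitely many pairs (k,
  -- l) need the convergence.
  obtain ⟨N, hN⟩ := exists_pow_lt_of_lt_one (show 0 < δ / (C + 1) by positivity)
    (show (1 / 2 : ℝ) < 1 by norm_num)
  have hN' : C * (1 / 2 : ℝ) ^ N ≤ δ := by
    rw [lt_div_iff₀ (by positivity)] at hN
    have : (0 : ℝ) ≤ (1 / 2 : ℝ) ^ N := by positivity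
    nlinarith
  -- For a fixed pair, the quantity is squared: one factor receives the weight ‖x‖^{2l} and stays
  -- bounded, the other has no weight and tends to zero uniformly.
  have key : ∀ k l : ℕ, ∀ᶠ j in atTop, ∀ x, ‖x‖ ^ l * ‖iteratedFDeriv ℝ k (F j) x‖ ≤
      δ * ((2 * h) ^ (k + l) * (k ! : ℝ) ^ (1 / 2 : ℝ) * (l ! : ℝ) ^ (1 / 2 : ℝ)) := by
    intro k l
    set η := δ * ((2 * h) ^ (k + l) * (k ! : ℝ) ^ (1 / 2 : ℝ) * (l ! : ℝ) ^ (1 / 2 : ℝ))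
    set M := C * (h ^ (k + 2 * l) * (k ! : ℝ) ^ (1 / 2 : ℝ) * ((2 * l)! : ℝ) ^ (1 / 2 : ℝ))
    have hη : 0 < η := by positivity
    have h1 : Tendsto (fun j => M * ∫ z, (2 * Real.pi * ‖z‖) ^ k * ‖𝓕 (F j) z‖) atTop (𝓝 0) := by
      simpa using (tendsto_integral_pow_mul_fourier hC hh hb hF k).const_mul M
    filter_upwards [h1.eventually (gt_mem_nhds (show 0 < η ^ 2 by positivity))] with j hj x
    refine (pow_le_pow_iff_left₀ (by positivity) hη.le two_ne_zero).1 ?_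
    calc (‖x‖ ^ l * ‖iteratedFDeriv ℝ k (F j) x‖) ^ 2
        = (‖x‖ ^ (2 * l) * ‖iteratedFDeriv ℝ k (F j) x‖) * ‖iteratedFDeriv ℝ k (F j) x‖ := by ring
      _ ≤ M * ∫ z, (2 * Real.pi * ‖z‖) ^ k * ‖𝓕 (F j) z‖ := by
          refine mul_le_mul (hb j k (2 * l) x) (norm_iteratedFDeriv_le_integral_fourier (F j) k x)
            (norm_nonneg _) (by positivity)
      _ ≤ η ^ 2 := hj.le
  have h2 : ∀ᶠ j in atTop, ∀ p ∈ Finset.range N ×ˢ Finset.range N, ∀ x : E,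
      ‖x‖ ^ p.2 * ‖iteratedFDeriv ℝ p.1 (F j) x‖ ≤ δ * ((2 * h) ^ (p.1 + p.2) *
        (p.1 ! : ℝ) ^ (1 / 2 : ℝ) * (p.2 ! : ℝ) ^ (1 / 2 : ℝ)) :=
    (Filter.eventually_all_finset _).2 fun p _ => key p.1 p.2
  filter_upwards [h2] with j hj k l x
  by_cases hkl : k + l < N
  · exact hj (k, l) (by simp; omega) x
  · refine (hb j k l x).trans ?_
    have h3 : C * h ^ (k + l) ≤ δ * (2 * h) ^ (k + l) := by
      rw [mul_pow]
      have h4 : (1 / 2 : ℝ) ^ (k + l) ≤ (1 / 2 : ℝ) ^ N :=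
        pow_le_pow_of_le_one (by norm_num) (by norm_num) (by omega)
      calc C * h ^ (k + l) = C * (1 / 2 : ℝ) ^ (k + l) * (2 ^ (k + l) * h ^ (k + l)) := by
            rw [one_div, inv_pow]
            field_simp
        _ ≤ C * (1 / 2 : ℝ) ^ N * (2 ^ (k + l) * h ^ (k + l)) := by gcongr
        _ ≤ _ := by gcongr
    calc _ = (C * h ^ (k + l)) * ((k ! : ℝ) ^ (1 / 2 : ℝ) * (l ! : ℝ) ^ (1 / 2 : ℝ)) := by ring
      _ ≤ (δ * (2 * h) ^ (k + l)) * ((k ! : ℝ) ^ (1 / 2 : ℝ) * (l ! : ℝ) ^ (1 / 2 : ℝ)) := by gcongr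
      _ = _ := by ring

end Montel

/-! ### Distributions along time-frequency shifts -/

section Pairing

open scoped ContDiff
open SchwartzMap Filter

variable {ι : Type*} [Fintype ι] [DecidableEq ι]

lemma GSDual.pairing_sub {s : ℝ} (u : GSDual s ι) (g h : GSSpace s ι) :
    u.pairing (g - h) = u.pairing g - u.pairing h :=
  map_sub (show gsDual s ι from u).1 g h

lemma GSDual.pairing_sum {s : ℝ} {α : Type*} (u : GSDual s ι) (t : Finset α) (c : α → ℂ)
    (f : α → GSSpace s ι) : u.pairing (∑ i ∈ t, c i • f i) = ∑ i ∈ t, c i * u.pairing (f i) := by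
  have := map_sum (show gsDual s ι from u).1 (fun i => c i • f i) t
  simp only [map_smul, smul_eq_mul] at this
  exact this

lemma GSDual.exists_norm_pairing_le {s : ℝ} (hs : 0 ≤ s) (u : GSDual s ι) {h : ℝ} (hh : 0 < h) :
    ∃ K : ℝ, 0 ≤ K ∧ ∀ (f : GSSpace s ι) (C : ℝ), 0 ≤ C →
      GSBound s C h (f : EuclideanSpace ℝ ι → ℂ) → ‖u.pairing f‖ ≤ K * C := by
  obtain ⟨K, hK⟩ := (show gsDual s ι from u).2 (((Fintype.card ι : ℝ) + 1) ^ s * h) (by positivity)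
  refine ⟨K, K.coe_nonneg, fun f C hC hf => ?_⟩
  have h1 : ‖u.pairing f‖ₑ ≤ _ := (hK f).trans (mul_le_mul_of_nonneg_left (hf.gsNorm_le hs hC hh) bot_le)
  rw [← ENNReal.ofReal_coe_nnreal, ← ENNReal.ofReal_mul K.coe_nonneg, ← ofReal_norm,
    ENNReal.ofReal_le_ofReal_iff (mul_nonneg K.coe_nonneg hC)] at h1
  exact h1

/-- Distributions are sequentially continuous for bounded pointwise convergence. -/
lemma GSDual.tendsto_pairing (u : GSDual (1 / 2) ι) {f : ℕ → GSSpace (1 / 2) ι}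
    {g : GSSpace (1 / 2) ι} {C h : ℝ} (hC : 0 ≤ C) (hh : 0 < h)
    (hb : ∀ j, GSBound (1 / 2) C h (f j : EuclideanSpace ℝ ι → ℂ))
    (hf : ∀ x, Tendsto (fun j => (f j : EuclideanSpace ℝ ι → ℂ) x) atTop
      (𝓝 ((g : EuclideanSpace ℝ ι → ℂ) x))) :
    Tendsto (fun j => u.pairing (f j)) atTop (𝓝 (u.pairing g)) := by
  have h0 : (0 : ℝ) ≤ 1 / 2 := by norm_num
  obtain ⟨h', hh', D, hD, hg⟩ := GSSpace.exists_bound h0 g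
  set m := max h h' with hm
  have hm0 : 0 < m := lt_max_of_lt_left hh
  have hb' : ∀ j, GSBound (1 / 2) (C + D) m ⇑(GSSpace.toSchwartz h0 (f j - g)) := by
    intro j
    have hneg : GSBound (1 / 2) D m (((-1 : ℂ) • g : GSSpace (1 / 2) ι) :
        EuclideanSpace ℝ ι → ℂ) := by
      have := (hg.mono le_rfl hD hh'.le (le_max_right h h')).const_smul (GSSpace.contDiff g) (-1)
      rw [norm_neg, norm_one, one_mul] at this
      exact this
    have := ((hb j).mono le_rfl hC hh.le (le_max_left h h')).add (GSSpace.contDiff (f j))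
      (GSSpace.contDiff ((-1 : ℂ) • g)) hneg
    rw [GSSpace.coe_toSchwartz, sub_eq_add_neg, ← neg_one_smul ℂ g]
    exact this
  have hf' : ∀ x, Tendsto (fun j => GSSpace.toSchwartz h0 (f j - g) x) atTop (𝓝 0) := by
    intro x
    have := (hf x).sub_const ((g : EuclideanSpace ℝ ι → ℂ) x)
    rw [sub_self] at this
    refine this.congr fun j => ?_
    rw [GSSpace.coe_toSchwartz]
    rfl
  obtain ⟨K, hK, hu⟩ := u.exists_norm_pairing_le h0 (show 0 < 2 * m by positivity)
  rw [Metric.tendsto_nhds]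
  intro ε hε
  filter_upwards [eventually_gsBound (by positivity) hm0 hb' hf'
    (show 0 < ε / (K + 1) by positivity)] with j hj
  rw [dist_eq_norm, ← GSDual.pairing_sub]
  rw [GSSpace.coe_toSchwartz] at hj
  refine (hu _ _ (by positivity) hj).trans_lt ?_
  rw [mul_div_assoc', div_lt_iff₀ (by positivity)]
  nlinarith

/-- The time-frequency shift of a window as an element of `𝒮_{1/2}`. -/
noncomputable def tfWindow (φ : GSSpace (1 / 2) ι) (Z : EuclideanSpace ℝ ι × EuclideanSpace ℝ ι) :
    GSSpace (1 / 2) ι :=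
  ⟨tfShift φ Z.1 Z.2, tfShift_mem (by norm_num) φ.2 Z.1 Z.2⟩

lemma GSDual.stft_eq (φ : GSSpace (1 / 2) ι) (u : GSDual (1 / 2) ι) (X Ξ : EuclideanSpace ℝ ι) :
    u.stft (by norm_num) φ X Ξ = fourierConst ι * u.pairing (tfWindow φ (X, Ξ)) := rfl

lemma coe_tfWindow (φ : GSSpace (1 / 2) ι) (Z : EuclideanSpace ℝ ι × EuclideanSpace ℝ ι) :
    (tfWindow φ Z : EuclideanSpace ℝ ι → ℂ) = tfShift φ Z.1 Z.2 := rfl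

lemma tfWindow_gsBound {φ : GSSpace (1 / 2) ι} {C h H : ℝ} (hC : 0 ≤ C) (hh : 0 < h) (hH : 0 < H)
    (hb : GSBound (1 / 2) C h (φ : EuclideanSpace ℝ ι → ℂ))
    (Z : EuclideanSpace ℝ ι × EuclideanSpace ℝ ι) :
    GSBound (1 / 2) (C * Real.exp (‖Z‖ ^ 2 / H ^ 2)) (h + H + H)
      (tfWindow φ Z : EuclideanSpace ℝ ι → ℂ) := by
  refine (hb.tfShift (GSSpace.contDiff φ) hC hh hH Z.1 Z.2).mono ?_ (by positivity) (by positivity) le_rfl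
  rw [mul_assoc, ← Real.exp_add]
  gcongr
  have h1 : ‖Z.1‖ ^ 2 ≤ ‖Z‖ ^ 2 := by
    gcongr
    exact norm_fst_le Z
  have h2 : ‖Z.2‖ ^ 2 ≤ ‖Z‖ ^ 2 := by
    gcongr
    exact norm_snd_le Z
  calc _ = (‖Z.1‖ ^ 2 + ‖Z.2‖ ^ 2) / (2 * H ^ 2) := by ring
    _ ≤ (‖Z‖ ^ 2 + ‖Z‖ ^ 2) / (2 * H ^ 2) := by gcongr
    _ = _ := by
      field_simp
      ring

lemma continuous_tfShift {φ : EuclideanSpace ℝ ι → ℂ} (hφ : Continuous φ) :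
    Continuous fun q : (EuclideanSpace ℝ ι × EuclideanSpace ℝ ι) × EuclideanSpace ℝ ι =>
      tfShift φ q.1.1 q.1.2 q.2 := by
  unfold tfShift
  fun_prop

/-- A convergent sequence of points is bounded, so the corresponding shifts are bounded in one
𝒮_{1/2,h} and converge pointwise. -/
lemma GSDual.continuous_pairing_tfWindow (u : GSDual (1 / 2) ι) (φ : GSSpace (1 / 2) ι) :
    Continuous fun Z => u.pairing (tfWindow φ Z) := by
  refine continuous_iff_seqContinuous.2 fun {Z Z₀} hZ => ?_
  obtain ⟨h, hh, C, hC, hb⟩ := GSSpace.exists_bound (by norm_num) φ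
  obtain ⟨R, hR⟩ := hZ.norm.bddAbove_range
  have hR' : ∀ j, ‖Z j‖ ≤ R := fun j => hR ⟨j, rfl⟩
  refine u.tendsto_pairing (C := C * Real.exp (R ^ 2 / 1 ^ 2)) (h := h + 1 + 1) (by positivity)
    (by positivity) (fun j => ?_) fun x => ?_
  · refine (tfWindow_gsBound hC hh one_pos hb (Z j)).mono ?_ (by positivity) (by positivity) le_rfl
    gcongr
    exact hR' j
  · exact ((continuous_tfShift (GSSpace.continuous φ)).comp
      (continuous_id.prodMk continuous_const)).continuousAt.tendsto.comp hZ

/-- A distribution is bounded on every 𝒮_{1/2,h}, so the free scale in `tfWindow_gsBound` can be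
taken as H = δ^{-1/2}. Growth slower than every Gaussian is what makes integrals against
Gaussian-decaying coefficients converge. -/
lemma GSDual.exists_norm_pairing_tfWindow_le (u : GSDual (1 / 2) ι) (φ : GSSpace (1 / 2) ι)
    {δ : ℝ} (hδ : 0 < δ) :
    ∃ K : ℝ, 0 ≤ K ∧ ∀ Z, ‖u.pairing (tfWindow φ Z)‖ ≤ K * Real.exp (δ * ‖Z‖ ^ 2) := by
  obtain ⟨h, hh, C, hC, hb⟩ := GSSpace.exists_bound (by norm_num) φ
  set H : ℝ := (Real.sqrt δ)⁻¹ with hH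
  have hs : 0 < Real.sqrt δ := Real.sqrt_pos.2 hδ
  obtain ⟨K, hK, hu⟩ := u.exists_norm_pairing_le (by norm_num) (show 0 < h + H + H by positivity)
  refine ⟨K * C, by positivity, fun Z => ?_⟩
  refine (hu _ _ (by positivity) (tfWindow_gsBound hC hh (by positivity) hb Z)).trans
    (le_of_eq ?_)
  rw [hH, inv_pow, Real.sq_sqrt hδ.le, div_inv_eq_mul, mul_assoc, mul_comm δ]

end Pairing

/-! ### Short-time Fourier coefficients of test functions -/

section Coefficients

open scoped SchwartzMap FourierTransform ContDiff
open SchwartzMap Filter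

variable {ι : Type*} [Fintype ι] [DecidableEq ι]

lemma GSSpace.integrable_mul {s : ℝ} (hs : 0 ≤ s) (f g : GSSpace s ι) :
    Integrable fun x => (f : EuclideanSpace ℝ ι → ℂ) x * (g : EuclideanSpace ℝ ι → ℂ) x := by
  have := (SchwartzMap.pairing (ContinuousLinearMap.mul ℂ ℂ) (GSSpace.toSchwartz hs f)
    (GSSpace.toSchwartz hs g)).integrable (μ := volume)
  refine this.congr (.of_forall fun x => ?_)
  simp only [SchwartzMap.pairing_apply_apply, GSSpace.coe_toSchwartz]
  rfl

lemma GSSpace.integrable {s : ℝ} (hs : 0 ≤ s) (f : GSSpace s ι) :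
    Integrable (f : EuclideanSpace ℝ ι → ℂ) := by
  have := (GSSpace.toSchwartz hs f).integrable (μ := volume)
  rwa [GSSpace.coe_toSchwartz] at this

/-- The distribution `g ↦ ∫ a g` given by a function of `𝒮_{1/2}`. -/
noncomputable def GSDual.ofGS (a : GSSpace (1 / 2) ι) : GSDual (1 / 2) ι :=
  ⟨{ toFun := fun g => ∫ x, (a : EuclideanSpace ℝ ι → ℂ) x * (g : EuclideanSpace ℝ ι → ℂ) x
     map_add' := fun f g => by
      rw [← integral_add (GSSpace.integrable_mul (by norm_num) a f)
        (GSSpace.integrable_mul (by norm_num) a g)]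
      exact integral_congr_ae (.of_forall fun x => mul_add _ _ _)
     map_smul' := fun c f => by
      rw [RingHom.id_apply, smul_eq_mul, ← integral_const_mul]
      exact integral_congr_ae (.of_forall fun x => mul_left_comm _ _ _) }, by
    intro h hh
    set K := ∫ x, ‖(a : EuclideanSpace ℝ ι → ℂ) x‖ with hK
    have hK0 : 0 ≤ K := integral_nonneg fun _ => norm_nonneg _
    refine ⟨K.toNNReal + 1, fun g => ?_⟩
    rcases eq_or_ne (gsNorm (1 / 2) h (g : EuclideanSpace ℝ ι → ℂ)) ⊤ with ht | ht
    · rw [ht, ENNReal.mul_top (by simp)]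
      exact le_top
    set M := (gsNorm (1 / 2) h (g : EuclideanSpace ℝ ι → ℂ)).toReal with hM
    have hg : ∀ x, ‖(g : EuclideanSpace ℝ ι → ℂ) x‖ ≤ M := fun x => by
      have := gsBound_of_gsNorm (by norm_num) hh ht.lt_top 0 0 x
      simp only [pow_zero, one_mul, Nat.factorial_zero, norm_iteratedFDeriv_zero, Real.one_rpow,
        mul_one, add_zero, Nat.cast_one] at this
      exact this
    have h1 : ‖∫ x, (a : EuclideanSpace ℝ ι → ℂ) x * (g : EuclideanSpace ℝ ι → ℂ) x‖ ≤ K * M := by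
      rw [hK, ← integral_mul_const]
      refine norm_integral_le_of_norm_le ((GSSpace.integrable (by norm_num) a).norm.mul_const M)
        (.of_forall fun x => ?_)
      rw [norm_mul]
      exact mul_le_mul_of_nonneg_left (hg x) (norm_nonneg _)
    rw [← ofReal_norm]
    refine (ENNReal.ofReal_le_ofReal h1).trans ?_
    rw [ENNReal.ofReal_mul hK0, hM, ENNReal.ofReal_toReal ht]
    gcongr
    exact ENNReal.coe_le_coe.2 (by simp)⟩

@[simp]
lemma GSDual.ofGS_pairing (a g : GSSpace (1 / 2) ι) : (GSDual.ofGS a).pairing g =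
    ∫ x, (a : EuclideanSpace ℝ ι → ℂ) x * (g : EuclideanSpace ℝ ι → ℂ) x := rfl

lemma GSDual.isFunction_ofGS (a : GSSpace (1 / 2) ι) : (GSDual.ofGS a).IsFunction a := fun _ => rfl

lemma GSDual.IsFunction.eq {s : ℝ} {u v : GSDual s ι} {a : EuclideanSpace ℝ ι → ℂ}
    (hu : u.IsFunction a) (hv : v.IsFunction a) : u = v :=
  GSDual.ext fun g => by rw [hu, hv]

/-- The complex conjugate of an element of `𝒮_{1/2}`. -/
noncomputable def gsConj (g : GSSpace (1 / 2) ι) : GSSpace (1 / 2) ι :=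
  ⟨fun y => conj ((g : EuclideanSpace ℝ ι → ℂ) y), by
    have : (fun y => conj ((g : EuclideanSpace ℝ ι → ℂ) y)) = tfShift g 0 0 := by
      funext y
      simp [tfShift]
    rw [this]
    exact tfShift_mem (by norm_num) g.2 0 0⟩

@[simp]
lemma coe_gsConj (g : GSSpace (1 / 2) ι) (y : EuclideanSpace ℝ ι) :
    (gsConj g : EuclideanSpace ℝ ι → ℂ) y = conj ((g : EuclideanSpace ℝ ι → ℂ) y) := rfl

/-- The product of `φ` and the conjugate of a translate of `ψ`. -/
lemma exists_schwartz_mul_conj (φ ψ : GSSpace (1 / 2) ι) (X : EuclideanSpace ℝ ι) :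
    ∃ F : 𝓢(EuclideanSpace ℝ ι, ℂ), ∀ y, F y = (φ : EuclideanSpace ℝ ι → ℂ) y *
      conj ((ψ : EuclideanSpace ℝ ι → ℂ) (y - X)) := by
  obtain ⟨h, hh, C, hC, hb⟩ := GSSpace.exists_bound (by norm_num) ψ
  refine ⟨SchwartzMap.pairing (ContinuousLinearMap.mul ℂ ℂ) (GSSpace.toSchwartz (by norm_num) φ)
    ((hb.conj_sub hC hh one_pos X).toSchwartz (contDiff_conj_sub (GSSpace.contDiff ψ) X)),
    fun y => ?_⟩
  rw [SchwartzMap.pairing_apply_apply, GSSpace.coe_toSchwartz]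
  rfl

/-- The short-time Fourier transform of a function of `𝒮_{1/2}` has Gaussian decay. -/
lemma exists_norm_integral_mul_tfShift_le (φ ψ : GSSpace (1 / 2) ι) :
    ∃ K ε : ℝ, 0 ≤ K ∧ 0 < ε ∧ ∀ Z : EuclideanSpace ℝ ι × EuclideanSpace ℝ ι,
      ‖∫ y, (φ : EuclideanSpace ℝ ι → ℂ) y * tfShift ψ Z.1 Z.2 y‖ ≤
        K * Real.exp (-(ε * ‖Z‖ ^ 2)) := by
  obtain ⟨h₁, hh₁, C, hC, hφ⟩ := GSSpace.exists_bound (by norm_num) φ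
  obtain ⟨h₂, hh₂, D, hD, hψ⟩ := GSSpace.exists_bound (by norm_num) ψ
  set h := max h₁ h₂
  have hh : 0 < h := lt_max_of_lt_left hh₁
  replace hφ := hφ.mono le_rfl hC hh₁.le (le_max_left h₁ h₂)
  replace hψ := hψ.mono le_rfl hD hh₂.le (le_max_right h₁ h₂)
  set I := ∫ x : EuclideanSpace ℝ ι, Real.exp (-((8 * h ^ 2)⁻¹ * ‖x‖ ^ 2)) with hI
  have hI0 : 0 ≤ I := integral_nonneg fun _ => by positivity
  -- The rate 1/(16h²) serves both variables: in Z.2 it comes from the scale h + h of the product in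
  -- `norm_fourier_le_exp`, in Z.1 from splitting the two Gaussians below.
  refine ⟨2 * ((2 * C) * (2 * D) * I), (16 * h ^ 2)⁻¹, by positivity, by positivity, fun Z => ?_⟩
  obtain ⟨F, hF⟩ := exists_schwartz_mul_conj φ ψ Z.1
  have hpi : (2 * Real.pi : ℝ) ≠ 0 := by positivity
  have e1 : ∫ y, (φ : EuclideanSpace ℝ ι → ℂ) y * tfShift ψ Z.1 Z.2 y =
      𝓕 F ((2 * Real.pi)⁻¹ • Z.2) := by
    rw [schwartz_fourier_apply]
    refine integral_congr_ae (.of_forall fun y => ?_)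
    simp only
    rw [hF, real_inner_smul_right, mul_inv_cancel_left₀ hpi, tfShift]
    ring
  have hbd : ∀ k x, ‖iteratedFDeriv ℝ k F x‖ ≤
      ((2 * C) * (2 * D) * Real.exp (-((16 * h ^ 2)⁻¹ * ‖Z.1‖ ^ 2))) *
        ((h + h) ^ k * (k.factorial : ℝ) ^ (1 / 2 : ℝ)) * Real.exp (-((8 * h ^ 2)⁻¹ * ‖x‖ ^ 2)) := by
    intro k x
    have eF : ⇑F = fun y => (φ : EuclideanSpace ℝ ι → ℂ) y *
      (fun y => conj ((ψ : EuclideanSpace ℝ ι → ℂ) (y - Z.1))) y := funext hF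
    rw [eF]
    refine (norm_iteratedFDeriv_mul_le_of_factorial
      (A := 2 * C * Real.exp (-(‖x‖ ^ 2 / (4 * h ^ 2))))
      (D := 2 * D * Real.exp (-(‖x - Z.1‖ ^ 2 / (4 * h ^ 2)))) (a := h) (d := h)
      (GSSpace.contDiff φ) (contDiff_conj_sub (GSSpace.contDiff ψ) Z.1)
      (by positivity) (by positivity) hh.le hh.le (fun k => ?_) (fun k => ?_) k).trans ?_
    · exact (hφ.exp_mul_norm_le hh hC k x).trans (le_of_eq (by ring))
    · rw [norm_iteratedFDeriv_conj_sub]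
      exact (hψ.exp_mul_norm_le hh hD k _).trans (le_of_eq (by ring))
    · have hexp : Real.exp (-(‖x‖ ^ 2 / (4 * h ^ 2))) * Real.exp (-(‖x - Z.1‖ ^ 2 / (4 * h ^ 2))) ≤
          Real.exp (-((16 * h ^ 2)⁻¹ * ‖Z.1‖ ^ 2)) * Real.exp (-((8 * h ^ 2)⁻¹ * ‖x‖ ^ 2)) := by
        rw [← Real.exp_add, ← Real.exp_add]
        refine Real.exp_le_exp.2 ?_
        have hZ : ‖Z.1‖ ≤ ‖x‖ + ‖x - Z.1‖ := by
          simpa using norm_sub_le x (x - Z.1)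
        -- Of the joint exponent, 2‖x‖² is held back to keep the derivatives integrable in x; the
        -- remainder pays for the decay in Z.1.
        have hq : ‖Z.1‖ ^ 2 ≤ 2 * ‖x‖ ^ 2 + 4 * ‖x - Z.1‖ ^ 2 := by
          nlinarith [sq_nonneg (‖x‖ - ‖x - Z.1‖), norm_nonneg Z.1, norm_nonneg x,
            norm_nonneg (x - Z.1), sq_nonneg ‖x - Z.1‖]
        have e2 : -((16 * h ^ 2)⁻¹ * ‖Z.1‖ ^ 2) + -((8 * h ^ 2)⁻¹ * ‖x‖ ^ 2) =
            -(‖Z.1‖ ^ 2 + 2 * ‖x‖ ^ 2) / (16 * h ^ 2) := by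
          field_simp
          ring
        have e3 : -(‖x‖ ^ 2 / (4 * h ^ 2)) + -(‖x - Z.1‖ ^ 2 / (4 * h ^ 2)) =
            -(4 * ‖x‖ ^ 2 + 4 * ‖x - Z.1‖ ^ 2) / (16 * h ^ 2) := by
          field_simp
          ring
        rw [e2, e3]
        refine div_le_div_of_nonneg_right ?_ (by positivity)
        linarith
      calc _ = (2 * C) * (2 * D) * ((h + h) ^ k * (k.factorial : ℝ) ^ (1 / 2 : ℝ)) *
            (Real.exp (-(‖x‖ ^ 2 / (4 * h ^ 2))) * Real.exp (-(‖x - Z.1‖ ^ 2 / (4 * h ^ 2)))) := by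
            ring
        _ ≤ (2 * C) * (2 * D) * ((h + h) ^ k * (k.factorial : ℝ) ^ (1 / 2 : ℝ)) *
            (Real.exp (-((16 * h ^ 2)⁻¹ * ‖Z.1‖ ^ 2)) *
              Real.exp (-((8 * h ^ 2)⁻¹ * ‖x‖ ^ 2))) := by gcongr
        _ = _ := by ring
  rw [e1]
  refine (norm_fourier_le_exp (by positivity) (by positivity) (by positivity) hbd _).trans ?_
  have e4 : (2 * Real.pi * ‖(2 * Real.pi)⁻¹ • Z.2‖) ^ 2 / (4 * (h + h) ^ 2) =
      (16 * h ^ 2)⁻¹ * ‖Z.2‖ ^ 2 := by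
    rw [norm_smul, norm_inv, Real.norm_of_nonneg (by positivity : (0 : ℝ) ≤ 2 * Real.pi),
      mul_inv_cancel_left₀ hpi]
    field_simp
    ring
  have hZ : ‖Z‖ ^ 2 ≤ ‖Z.1‖ ^ 2 + ‖Z.2‖ ^ 2 := by
    rcases max_choice ‖Z.1‖ ‖Z.2‖ with h | h <;> rw [Prod.norm_def, h]
    · nlinarith [sq_nonneg ‖Z.2‖]
    · nlinarith [sq_nonneg ‖Z.1‖]
  rw [e4]
  calc _ = 2 * ((2 * C) * (2 * D) * I) * (Real.exp (-((16 * h ^ 2)⁻¹ * ‖Z.1‖ ^ 2)) *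
        Real.exp (-((16 * h ^ 2)⁻¹ * ‖Z.2‖ ^ 2))) := by ring
    _ ≤ _ := by
      rw [← Real.exp_add, ← neg_add, ← mul_add]
      gcongr

/-- The coefficient `∫ g · conj (tfShift ψ W)`. -/
noncomputable def tfCoeff (ψ g : GSSpace (1 / 2) ι)
    (W : EuclideanSpace ℝ ι × EuclideanSpace ℝ ι) : ℂ :=
  ∫ t, (g : EuclideanSpace ℝ ι → ℂ) t * conj (tfShift ψ W.1 W.2 t)

/-- This makes a coefficient a short-time Fourier value of a distribution, so continuity and decay
are inherited. -/
lemma tfCoeff_eq_conj (ψ g : GSSpace (1 / 2) ι) (W : EuclideanSpace ℝ ι × EuclideanSpace ℝ ι) :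
    tfCoeff ψ g W = conj ((GSDual.ofGS (gsConj g)).pairing (tfWindow ψ W)) := by
  rw [GSDual.ofGS_pairing, ← integral_conj]
  refine integral_congr_ae (.of_forall fun t => ?_)
  simp [coe_tfWindow]

lemma continuous_tfCoeff (ψ g : GSSpace (1 / 2) ι) : Continuous (tfCoeff ψ g) := by
  simp only [funext (tfCoeff_eq_conj ψ g)]
  exact Complex.continuous_conj.comp (GSDual.continuous_pairing_tfWindow _ ψ)

lemma exists_norm_tfCoeff_le (ψ g : GSSpace (1 / 2) ι) :
    ∃ K ε : ℝ, 0 ≤ K ∧ 0 < ε ∧ ∀ W, ‖tfCoeff ψ g W‖ ≤ K * Real.exp (-(ε * ‖W‖ ^ 2)) := by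
  obtain ⟨K, ε, hK, hε, h⟩ := exists_norm_integral_mul_tfShift_le (gsConj g) ψ
  refine ⟨K, ε, hK, hε, fun W => ?_⟩
  rw [tfCoeff_eq_conj, RCLike.norm_conj]
  exact h W

/-- Two time-frequency shifts compose to one up to a phase. Consequently the kernel of a change of
window is dominated by a convolution kernel. -/
lemma norm_tfCoeff_tfWindow (ψ φ : GSSpace (1 / 2) ι)
    (Z W : EuclideanSpace ℝ ι × EuclideanSpace ℝ ι) :
    ‖tfCoeff ψ (tfWindow φ Z) W‖ =
      ‖∫ y, (φ : EuclideanSpace ℝ ι → ℂ) y * tfShift ψ (W - Z).1 (W - Z).2 y‖ := by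
  rw [tfCoeff_eq_conj, RCLike.norm_conj, GSDual.ofGS_pairing,
    ← integral_add_right_eq_self _ Z.1]
  set c : ℂ := Complex.exp (Complex.I * (⟪Z.1, Z.2 - W.2⟫ : ℝ)) with hc
  have hc1 : ‖c‖ = 1 := by rw [hc, mul_comm, Complex.norm_exp_ofReal_mul_I]
  refine Eq.trans ?_ ((norm_mul c (∫ y, (φ : EuclideanSpace ℝ ι → ℂ) y *
    tfShift ψ (W - Z).1 (W - Z).2 y)).trans (by rw [hc1, one_mul]))
  rw [← integral_const_mul]
  congr 1
  refine integral_congr_ae (.of_forall fun y => ?_)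
  simp only [coe_gsConj, coe_tfWindow, tfShift, map_mul, Complex.conj_conj, ← Complex.exp_conj,
    add_sub_cancel_right, map_neg, Complex.conj_I, Complex.conj_ofReal, Prod.fst_sub, Prod.snd_sub]
  have e : y + Z.1 - W.1 = y - (W.1 - Z.1) := by abel
  have e2 : Complex.exp (-(-Complex.I * (⟪y + Z.1, Z.2⟫ : ℝ))) *
      Complex.exp (-(Complex.I * (⟪y + Z.1, W.2⟫ : ℝ))) =
      c * Complex.exp (-(Complex.I * (⟪y, W.2 - Z.2⟫ : ℝ))) := by
    rw [hc, ← Complex.exp_add, ← Complex.exp_add]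
    congr 1
    simp only [inner_add_left, inner_sub_right]
    push_cast
    ring
  rw [e]
  linear_combination ((φ : EuclideanSpace ℝ ι → ℂ) y *
    conj ((ψ : EuclideanSpace ℝ ι → ℂ) (y - (W.1 - Z.1)))) * e2

/-- `(2π)^n ‖ψ‖²`. -/
noncomputable def windowConst (ψ : GSSpace (1 / 2) ι) : ℂ :=
  ((2 * Real.pi) ^ Fintype.card ι : ℝ) *
    ∫ x, (ψ : EuclideanSpace ℝ ι → ℂ) x * conj ((ψ : EuclideanSpace ℝ ι → ℂ) x)

lemma windowConst_ne_zero {ψ : GSSpace (1 / 2) ι} (hψ : ψ ≠ 0) : windowConst ψ ≠ 0 := by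
  refine mul_ne_zero (by norm_cast; positivity) ?_
  have e : ∫ x, (ψ : EuclideanSpace ℝ ι → ℂ) x * conj ((ψ : EuclideanSpace ℝ ι → ℂ) x) =
      ((∫ x, ‖(ψ : EuclideanSpace ℝ ι → ℂ) x‖ ^ 2 : ℝ) : ℂ) := by
    rw [← integral_complex_ofReal]
    refine integral_congr_ae (.of_forall fun x => ?_)
    simp only
    rw [Complex.mul_conj, Complex.normSq_eq_norm_sq]
  have hint : Integrable fun x => ‖(ψ : EuclideanSpace ℝ ι → ℂ) x‖ ^ 2 := by
    have := (GSSpace.integrable_mul (by norm_num) ψ (gsConj ψ)).norm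
    refine this.congr (.of_forall fun x => ?_)
    simp [sq]
  rw [e, Complex.ofReal_ne_zero]
  refine ne_of_gt ?_
  obtain ⟨x, hx⟩ : ∃ x, (ψ : EuclideanSpace ℝ ι → ℂ) x ≠ 0 := by
    by_contra hcon
    push Not at hcon
    exact hψ (Subtype.ext (funext hcon))
  exact integral_pos_of_integrable_nonneg_nonzero (((GSSpace.continuous ψ).norm.pow 2)) hint
    (fun x => by positivity) (x := x) (by simpa using hx)

end Coefficients

/-! ### Riemann sums of functions with Gaussian decay -/

section RiemannSums

open Filter

variable {V : Type*} [NormedAddCommGroup V] [NormedSpace ℝ V] [FiniteDimensional ℝ V]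
  [MeasurableSpace V] [BorelSpace V]

lemma integrable_exp_neg_mul_norm (μ : Measure V) [μ.IsAddHaarMeasure] {c : ℝ} (hc : 0 < c) :
    Integrable (fun x : V => Real.exp (-(c * ‖x‖))) μ := by
  set n := Module.finrank ℝ V + 1 with hn
  have h1 := integrable_one_add_norm (E := V) (μ := μ) (r := (n : ℝ)) (by rw [hn]; push_cast; linarith)
  refine (h1.const_mul (n.factorial / c ^ n * Real.exp c)).mono' (by fun_prop)
    (.of_forall fun x => ?_)
  have h2 := Real.pow_div_factorial_le_exp (c * (1 + ‖x‖)) (by positivity) n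
  rw [mul_add, mul_one, Real.exp_add, div_le_iff₀ (by positivity), ← mul_one_add, mul_pow] at h2
  rw [Real.norm_of_nonneg (by positivity), Real.rpow_neg (by positivity), Real.rpow_natCast,
    Real.exp_neg, ← div_eq_mul_inv, le_div_iff₀ (by positivity), inv_mul_le_iff₀ (Real.exp_pos _)]
  have e : (n.factorial : ℝ) / c ^ n * Real.exp c * Real.exp (c * ‖x‖) =
    (Real.exp c * Real.exp (c * ‖x‖) * n.factorial) / c ^ n := by ring
  rw [mul_comm, e, le_div_iff₀ (by positivity), mul_comm]
  exact h2

lemma integrable_exp_neg_mul_norm_sq' (μ : Measure V) [μ.IsAddHaarMeasure] {c : ℝ} (hc : 0 < c) :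
    Integrable (fun x : V => Real.exp (-(c * ‖x‖ ^ 2))) μ := by
  refine ((integrable_exp_neg_mul_norm μ hc).const_mul (Real.exp c)).mono' (by fun_prop)
    (.of_forall fun x => ?_)
  rw [Real.norm_of_nonneg (by positivity), ← Real.exp_add]
  refine Real.exp_le_exp.2 ?_
  nlinarith [sq_nonneg (‖x‖ - 1)]

/-- Simple functions that approximate the identity uniformly on large balls. -/
lemma exists_simpleFunc_approx_id (j : ℕ) :
    ∃ S : SimpleFunc V V, ∀ W : V, ‖W‖ ≤ j → ‖S W - W‖ ≤ 1 / (j + 1) := by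
  have : ProperSpace V := FiniteDimensional.proper ℝ V
  have hc : IsCompact (Metric.closedBall (0 : V) j) := isCompact_closedBall 0 _
  obtain ⟨t, ht⟩ := hc.elim_finite_subcover
    (fun i : ℕ => Metric.ball (TopologicalSpace.denseSeq V i) (1 / (j + 1 : ℝ)))
    (fun _ => Metric.isOpen_ball) (fun W _ => by
      obtain ⟨i, hi⟩ := (TopologicalSpace.denseRange_denseSeq V).exists_dist_lt W
        (show (0 : ℝ) < 1 / (j + 1 : ℝ) by positivity)
      exact Set.mem_iUnion.2 ⟨i, hi⟩)
  refine ⟨SimpleFunc.nearestPt (TopologicalSpace.denseSeq V) (t.sup id), fun W hW => ?_⟩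
  obtain ⟨i, hi⟩ := Set.mem_iUnion.1 (ht (mem_closedBall_zero_iff.2 hW))
  obtain ⟨hit, hi⟩ := Set.mem_iUnion.1 hi
  have h1 := SimpleFunc.edist_nearestPt_le (TopologicalSpace.denseSeq V) W
    (Finset.le_sup (f := id) hit)
  rw [edist_dist, edist_dist, ENNReal.ofReal_le_ofReal_iff dist_nonneg] at h1
  rw [← dist_eq_norm]
  exact h1.trans (by rw [dist_comm]; exact (Metric.mem_ball.1 hi).le)

/-- The nodes of the `j`-th Riemann sum. -/
noncomputable def riemannNode (V : Type*) [NormedAddCommGroup V] [NormedSpace ℝ V]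
    [FiniteDimensional ℝ V] [MeasurableSpace V] [BorelSpace V] (j : ℕ) : SimpleFunc V V :=
  (exists_simpleFunc_approx_id (V := V) j).choose

lemma norm_riemannNode_sub_le {j : ℕ} {W : V} (hW : ‖W‖ ≤ j) :
    ‖riemannNode V j W - W‖ ≤ 1 / (j + 1) :=
  (exists_simpleFunc_approx_id (V := V) j).choose_spec W hW

/-- The weights of the `j`-th Riemann sum. -/
noncomputable def riemannWeight (μ : Measure V) (j : ℕ) (w : V) : ℝ :=
  μ.real (riemannNode V j ⁻¹' {w} ∩ Metric.closedBall 0 j)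

lemma riemannWeight_nonneg (μ : Measure V) (j : ℕ) (w : V) : 0 ≤ riemannWeight μ j w :=
  measureReal_nonneg

/-- Such a sum is exactly the integral of a simple function over a ball, which opens it to dominated
convergence and to comparison with integrals. -/
lemma sum_riemannWeight {F : Type*} [NormedAddCommGroup F] [NormedSpace ℝ F] [CompleteSpace F]
    (μ : Measure V) [IsFiniteMeasureOnCompacts μ] (j : ℕ) (G : V → F) :
    ∑ w ∈ (riemannNode V j).range, riemannWeight μ j w • G w =
      ∫ W in Metric.closedBall 0 j, G (riemannNode V j W) ∂μ := by
  have : ProperSpace V := FiniteDimensional.proper ℝ V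
  have hfin : μ (Metric.closedBall (0 : V) j) ≠ ⊤ := (isCompact_closedBall 0 _).measure_lt_top.ne
  have : IsFiniteMeasure (μ.restrict (Metric.closedBall (0 : V) j)) :=
    ⟨by rw [Measure.restrict_apply_univ]; exact hfin.lt_top⟩
  have e : ∀ W, G (riemannNode V j W) = ∑ w ∈ (riemannNode V j).range,
      (riemannNode V j ⁻¹' {w}).indicator (fun _ => G w) W := by
    intro W
    rw [Finset.sum_eq_single (riemannNode V j W)]
    · simp
    · intro w _ hw
      exact Set.indicator_of_notMem (fun h => hw (by simpa using h.symm)) _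
    · intro h
      exact absurd (SimpleFunc.mem_range_self _ W) h
  have hm : ∀ w, MeasurableSet (riemannNode V j ⁻¹' {w}) := fun w =>
    (riemannNode V j).measurableSet_fiber w
  simp only [e]
  rw [integral_finsetSum _ fun w _ => (integrable_const _).indicator (hm w)]
  refine Finset.sum_congr rfl fun w _ => ?_
  rw [integral_indicator (hm w), integral_const, riemannWeight, measureReal_restrict_apply_univ,
    measureReal_restrict_apply (hm w)]

/-- A node is displaced by at most 1 inside the ball, which costs half of the Gaussian rate and a
constant factor. -/
lemma exp_riemannNode_le {j : ℕ} {W : V} (hW : ‖W‖ ≤ j) {c : ℝ} (hc : 0 ≤ c) (Z : V) :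
    Real.exp (-(c * ‖riemannNode V j W - Z‖ ^ 2)) ≤
      Real.exp c * Real.exp (-(c / 2 * ‖W - Z‖ ^ 2)) := by
  rw [← Real.exp_add]
  refine Real.exp_le_exp.2 ?_
  have h1 : ‖riemannNode V j W - W‖ ≤ 1 :=
    (norm_riemannNode_sub_le hW).trans (by rw [div_le_one (by positivity)]; simp)
  have h2 : ‖W - Z‖ ≤ ‖riemannNode V j W - Z‖ + 1 := by
    have : W - Z = (riemannNode V j W - Z) - (riemannNode V j W - W) := by abel
    rw [this]
    exact (norm_sub_le _ _).trans (by linarith)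
  have h3 : ‖W - Z‖ ^ 2 ≤ 2 * ‖riemannNode V j W - Z‖ ^ 2 + 2 := by
    nlinarith [norm_nonneg (W - Z), sq_nonneg (‖riemannNode V j W - Z‖ - 1)]
  nlinarith

lemma tendsto_riemannNode (W : V) : Tendsto (fun j => riemannNode V j W) atTop (𝓝 W) := by
  obtain ⟨N, hN⟩ := exists_nat_ge ‖W‖
  rw [tendsto_iff_norm_sub_tendsto_zero]
  refine squeeze_zero' (.of_forall fun _ => norm_nonneg _) ?_
    tendsto_one_div_add_atTop_nhds_zero_nat
  filter_upwards [eventually_ge_atTop N] with j hj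
  exact norm_riemannNode_sub_le (hN.trans (by exact_mod_cast hj))

/-- Riemann sums of continuous functions with Gaussian decay converge. -/
lemma tendsto_sum_riemannWeight {F : Type*} [NormedAddCommGroup F] [NormedSpace ℝ F]
    [CompleteSpace F] (μ : Measure V) [μ.IsAddHaarMeasure] {G : V → F} (hG : Continuous G)
    {K ε : ℝ} (hε : 0 < ε) (hb : ∀ W, ‖G W‖ ≤ K * Real.exp (-(ε * ‖W‖ ^ 2))) :
    Tendsto (fun j => ∑ w ∈ (riemannNode V j).range, riemannWeight μ j w • G w) atTop
      (𝓝 (∫ W, G W ∂μ)) := by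
  have hK : 0 ≤ K := by simpa using (norm_nonneg _).trans (hb 0)
  simp only [sum_riemannWeight, ← integral_indicator Metric.isClosed_closedBall.measurableSet]
  refine tendsto_integral_of_dominated_convergence
    (fun W => K * (Real.exp ε * Real.exp (-(ε / 2 * ‖W‖ ^ 2)))) (fun j => ?_)
    (((integrable_exp_neg_mul_norm_sq' μ (half_pos hε)).const_mul _).const_mul _)
    (fun j => .of_forall fun W => ?_) (.of_forall fun W => ?_)
  · refine StronglyMeasurable.aestronglyMeasurable
      (StronglyMeasurable.indicator ?_ Metric.isClosed_closedBall.measurableSet)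
    exact ((riemannNode V j).map G).stronglyMeasurable
  · by_cases hW : W ∈ Metric.closedBall (0 : V) j
    · rw [Set.indicator_of_mem hW]
      refine (hb _).trans (mul_le_mul_of_nonneg_left ?_ hK)
      simpa using exp_riemannNode_le (mem_closedBall_zero_iff.1 hW) hε.le 0
    · rw [Set.indicator_of_notMem hW, norm_zero]
      positivity
  · obtain ⟨N, hN⟩ := exists_nat_ge ‖W‖
    refine ((hG.tendsto W).comp (tendsto_riemannNode W)).congr' ?_
    filter_upwards [eventually_ge_atTop N] with j hj
    rw [Set.indicator_of_mem
      (mem_closedBall_zero_iff.2 (hN.trans (by exact_mod_cast hj)))]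
    rfl

/-- The bound is uniform in both j and the centre Z. With Z = 0 it bounds Riemann sums of test
functions in one 𝒮_{1/2,h}; with general Z it gives the domination of the approximants. -/
lemma sum_riemannWeight_mul_exp_le (μ : Measure V) [μ.IsAddHaarMeasure] {ε : ℝ} (hε : 0 < ε)
    (j : ℕ) (Z : V) :
    ∑ w ∈ (riemannNode V j).range, riemannWeight μ j w * Real.exp (-(ε * ‖w - Z‖ ^ 2)) ≤
      Real.exp ε * ∫ W, Real.exp (-(ε / 2 * ‖W‖ ^ 2)) ∂μ := by
  have h := sum_riemannWeight μ j fun w => Real.exp (-(ε * ‖w - Z‖ ^ 2))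
  simp only [smul_eq_mul] at h
  have hint := (integrable_exp_neg_mul_norm_sq' μ (half_pos hε)).comp_sub_right Z
  rw [h, ← integral_sub_right_eq_self (μ := μ) (fun W => Real.exp (-(ε / 2 * ‖W‖ ^ 2))) Z,
    ← integral_const_mul,
    ← integral_indicator Metric.isClosed_closedBall.measurableSet]
  refine integral_mono_of_nonneg (.of_forall fun W => Set.indicator_nonneg
    (fun _ _ => (Real.exp_pos _).le) _) (hint.const_mul _) (.of_forall fun W => ?_)
  by_cases hW : W ∈ Metric.closedBall (0 : V) j
  · simp only [Set.indicator_of_mem hW]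
    exact exp_riemannNode_le (mem_closedBall_zero_iff.1 hW) hε.le Z
  · simp only [Set.indicator_of_notMem hW]
    positivity

end RiemannSums

/-! ### Inversion formula, change of window and approximation of distributions -/

section Reproducing

open scoped SchwartzMap FourierTransform ContDiff
open SchwartzMap Filter

variable {ι : Type*} [Fintype ι] [DecidableEq ι]

instance volume_phaseSpace_isAddHaarMeasure :
    (volume : Measure (EuclideanSpace ℝ ι × EuclideanSpace ℝ ι)).IsAddHaarMeasure :=
  Measure.prod.instIsAddHaarMeasure volume volume

lemma GSSpace.exists_norm_le (φ : GSSpace (1 / 2) ι) :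
    ∃ C : ℝ, 0 ≤ C ∧ ∀ x, ‖(φ : EuclideanSpace ℝ ι → ℂ) x‖ ≤ C := by
  obtain ⟨h, hh, C, hC, hb⟩ := GSSpace.exists_bound (by norm_num) φ
  refine ⟨C, hC, fun x => ?_⟩
  have := hb 0 0 x
  simp only [pow_zero, one_mul, Nat.factorial_zero, norm_iteratedFDeriv_zero, Real.one_rpow,
    mul_one, add_zero, Nat.cast_one] at this
  exact this

/-- Fourier inversion for functions on the frequency side. -/
lemma integral_integral_mul_exp (F : 𝓢(EuclideanSpace ℝ ι, ℂ)) (y : EuclideanSpace ℝ ι) :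
    ∫ Ξ : EuclideanSpace ℝ ι, (∫ t, F t * Complex.exp (Complex.I * (⟪t, Ξ⟫ : ℝ))) *
      Complex.exp (-(Complex.I * (⟪y, Ξ⟫ : ℝ))) =
      ((2 * Real.pi) ^ Fintype.card ι : ℝ) * F y := by
  have hpi : (2 * Real.pi : ℝ) ≠ 0 := by positivity
  have h1 := Measure.integral_comp_inv_smul_of_nonneg (μ := volume)
    (fun z : EuclideanSpace ℝ ι => Complex.exp (-(Complex.I * (2 * Real.pi * ⟪z, y⟫ : ℝ))) *
      (𝓕⁻ F) z) (R := 2 * Real.pi) (by positivity)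
  rw [← schwartz_fourier_apply, FourierTransform.fourier_fourierInv_eq, finrank_euclideanSpace,
    Complex.real_smul] at h1
  rw [← h1]
  refine integral_congr_ae (.of_forall fun Ξ => ?_)
  simp only
  rw [real_inner_smul_left, mul_inv_cancel_left₀ hpi, mul_comm, real_inner_comm]
  congr 1
  rw [fourierInv_coe, Real.fourierInv_eq']
  refine integral_congr_ae (.of_forall fun t => ?_)
  simp only [smul_eq_mul]
  rw [real_inner_smul_right, mul_comm]
  congr 2
  have : ((2 * Real.pi : ℝ) : ℂ) ≠ 0 := by exact_mod_cast hpi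
  push_cast at this ⊢
  field_simp

/-- The inversion formula for the short-time Fourier transform. -/
lemma integral_tfCoeff_mul_tfShift (ψ g : GSSpace (1 / 2) ι) (y : EuclideanSpace ℝ ι) :
    ∫ W : EuclideanSpace ℝ ι × EuclideanSpace ℝ ι, tfCoeff ψ g W * tfShift ψ W.1 W.2 y =
      windowConst ψ * (g : EuclideanSpace ℝ ι → ℂ) y := by
  obtain ⟨K, ε, hK, hε, hb⟩ := exists_norm_tfCoeff_le ψ g
  obtain ⟨C, hC, hψ⟩ := GSSpace.exists_norm_le ψ
  have hcont := continuous_tfShift (GSSpace.continuous ψ)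
  have hint : Integrable fun W : EuclideanSpace ℝ ι × EuclideanSpace ℝ ι =>
      tfCoeff ψ g W * tfShift ψ W.1 W.2 y := by
    refine ((integrable_exp_neg_mul_norm_sq' volume hε).const_mul (K * C)).mono'
      ((continuous_tfCoeff ψ g).mul (hcont.comp (by fun_prop :
        Continuous fun W => (W, y)))).aestronglyMeasurable (.of_forall fun W => ?_)
    rw [norm_mul, norm_tfShift, mul_right_comm]
    exact mul_le_mul (hb W) (hψ _) (norm_nonneg _) (by positivity)
  rw [Measure.volume_eq_prod] at hint ⊢
  rw [integral_prod _ hint]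
  -- For fixed X the integral over Ξ is Fourier inversion for g · ψ(· - X); the remaining integral
  -- over X is the squared L² norm of ψ, by translation invariance.
  have inner : ∀ X, ∫ Ξ, tfCoeff ψ g (X, Ξ) * tfShift ψ X Ξ y =
      ((2 * Real.pi) ^ Fintype.card ι : ℝ) * (g : EuclideanSpace ℝ ι → ℂ) y *
        ((ψ : EuclideanSpace ℝ ι → ℂ) (y - X) * conj ((ψ : EuclideanSpace ℝ ι → ℂ) (y - X))) := by
    intro X
    obtain ⟨F, hF⟩ := exists_schwartz_mul_conj g (gsConj ψ) X
    simp only [coe_gsConj, Complex.conj_conj] at hF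
    have h1 := integral_integral_mul_exp F y
    have h2 : ∀ Ξ, tfCoeff ψ g (X, Ξ) = ∫ t, F t * Complex.exp (Complex.I * (⟪t, Ξ⟫ : ℝ)) := by
      intro Ξ
      refine integral_congr_ae (.of_forall fun t => ?_)
      simp only [hF, tfShift, map_mul, Complex.conj_conj, ← Complex.exp_conj, map_neg,
        Complex.conj_I, Complex.conj_ofReal]
      rw [neg_mul, neg_neg, mul_assoc]
    simp only [← h2] at h1
    have h3 : ∀ Ξ, tfCoeff ψ g (X, Ξ) * tfShift ψ X Ξ y =
        conj ((ψ : EuclideanSpace ℝ ι → ℂ) (y - X)) *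
          (tfCoeff ψ g (X, Ξ) * Complex.exp (-(Complex.I * (⟪y, Ξ⟫ : ℝ)))) := fun Ξ => by
      rw [tfShift]
      ring
    simp only [h3]
    rw [integral_const_mul, h1, hF]
    ring
  simp only [inner]
  rw [integral_const_mul, integral_sub_left_eq_self (fun x => (ψ : EuclideanSpace ℝ ι → ℂ) x *
    conj ((ψ : EuclideanSpace ℝ ι → ℂ) x)) volume y, windowConst]
  ring

/-- The inversion formula, paired with a distribution. -/
lemma GSDual.integral_tfCoeff_mul_pairing (u : GSDual (1 / 2) ι) (ψ g : GSSpace (1 / 2) ι) :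
    ∫ W, tfCoeff ψ g W * u.pairing (tfWindow ψ W) = windowConst ψ * u.pairing g := by
  obtain ⟨K, ε, hK, hε, hb⟩ := exists_norm_tfCoeff_le ψ g
  obtain ⟨C, hC, hψ⟩ := GSSpace.exists_norm_le ψ
  obtain ⟨h, hh, D, hD, hgs⟩ := GSSpace.exists_bound (by norm_num) ψ
  obtain ⟨L, hL, hu⟩ := u.exists_norm_pairing_tfWindow_le ψ (half_pos hε)
  -- Shifts then grow like exp(ε‖w‖²/2), which is half of the decay of the coefficients.
  set H : ℝ := (Real.sqrt (ε / 2))⁻¹ with hH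
  have hs : 0 < Real.sqrt (ε / 2) := Real.sqrt_pos.2 (half_pos hε)
  have hHinv : ∀ t : ℝ, t / H ^ 2 = ε / 2 * t := fun t => by
    rw [hH, inv_pow, Real.sq_sqrt (half_pos hε).le, div_inv_eq_mul, mul_comm]
  have hexp : ∀ t : ℝ, Real.exp (-(ε * t)) * Real.exp (ε / 2 * t) = Real.exp (-(ε / 2 * t)) := by
    intro t
    rw [← Real.exp_add]
    ring_nf
  set f : ℕ → GSSpace (1 / 2) ι := fun j => ∑ w ∈ (riemannNode _ j).range,
    ((riemannWeight volume j w : ℝ) * tfCoeff ψ g w : ℂ) • tfWindow ψ w with hf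
  -- The interchange of u with the integral: the sums are test functions, bounded in one 𝒮_{1/2,h}
  -- and pointwise convergent by the inversion formula, so u passes to the limit. Applied termwise,
  -- u also yields Riemann sums of the scalar integral, and the two limits agree.
  have hlim : Tendsto (fun j => u.pairing (f j)) atTop (𝓝 (u.pairing (windowConst ψ • g))) := by
    refine u.tendsto_pairing (h := h + H + H)
      (C := K * D * (Real.exp (ε / 2) * ∫ W : EuclideanSpace ℝ ι × EuclideanSpace ℝ ι,
        Real.exp (-(ε / 2 / 2 * ‖W‖ ^ 2))))
      (mul_nonneg (by positivity) (mul_nonneg (by positivity)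
        (integral_nonneg fun _ => (Real.exp_pos _).le)))
      (by positivity) (fun j => ?_) (fun y => ?_)
    · refine (GSBound.finset_sum _ _ _ fun w _ =>
        tfWindow_gsBound hD hh (by positivity : 0 < H) hgs w).mono ?_
        (mul_nonneg (by positivity) (mul_nonneg (by positivity)
        (integral_nonneg fun _ => (Real.exp_pos _).le))) (by positivity) le_rfl
      refine le_trans ?_ (mul_le_mul_of_nonneg_left
        (sum_riemannWeight_mul_exp_le (V := EuclideanSpace ℝ ι × EuclideanSpace ℝ ι) volume
          (half_pos hε) j 0) (by positivity : 0 ≤ K * D))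
      rw [Finset.mul_sum]
      refine Finset.sum_le_sum fun w _ => ?_
      have hw := riemannWeight_nonneg (volume : Measure (EuclideanSpace ℝ ι × EuclideanSpace ℝ ι)) j w
      rw [norm_mul, Complex.norm_real, Real.norm_of_nonneg hw, hHinv, sub_zero, ← hexp]
      calc _ ≤ riemannWeight volume j w * (K * Real.exp (-(ε * ‖w‖ ^ 2))) *
            (D * Real.exp (ε / 2 * ‖w‖ ^ 2)) := by
            gcongr
            exact hb w
        _ = _ := by ring
    · have h1 := tendsto_sum_riemannWeight (volume : Measure (EuclideanSpace ℝ ι × EuclideanSpace ℝ ι))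
        (G := fun W => tfCoeff ψ g W * tfShift ψ W.1 W.2 y) (K := K * C) (ε := ε)
        ((continuous_tfCoeff ψ g).mul ((continuous_tfShift (GSSpace.continuous ψ)).comp
          (by fun_prop : Continuous fun W => (W, y)))) hε (fun W => by
            rw [norm_mul, norm_tfShift, mul_right_comm]
            exact mul_le_mul (hb W) (hψ _) (norm_nonneg _) (by positivity))
      rw [integral_tfCoeff_mul_tfShift] at h1
      refine h1.congr fun j => ?_
      simp only [hf, AddSubmonoidClass.coe_finsetSum, Finset.sum_apply]
      refine Finset.sum_congr rfl fun w _ => ?_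
      rw [Complex.real_smul, ← mul_assoc]
      rfl
  have hlim2 : Tendsto (fun j => u.pairing (f j)) atTop
      (𝓝 (∫ W, tfCoeff ψ g W * u.pairing (tfWindow ψ W))) := by
    have h1 := tendsto_sum_riemannWeight (volume : Measure (EuclideanSpace ℝ ι × EuclideanSpace ℝ ι))
      (G := fun W => tfCoeff ψ g W * u.pairing (tfWindow ψ W)) (K := K * L) (ε := ε / 2)
      ((continuous_tfCoeff ψ g).mul (u.continuous_pairing_tfWindow ψ)) (half_pos hε) (fun W => by
        rw [norm_mul, ← hexp]
        refine (mul_le_mul (hb W) (hu W) (norm_nonneg _) (by positivity)).trans (le_of_eq ?_)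
        ring)
    refine h1.congr fun j => ?_
    rw [hf, GSDual.pairing_sum]
    refine Finset.sum_congr rfl fun w _ => ?_
    rw [Complex.real_smul, ← mul_assoc]
  rw [tendsto_nhds_unique hlim2 hlim, GSDual.pairing_smul]

/-- A change of window is dominated by convolution with a Gaussian. -/
lemma exists_enorm_pairing_tfWindow_le (φ : GSSpace (1 / 2) ι) {ψ : GSSpace (1 / 2) ι} (hψ : ψ ≠ 0) :
    ∃ K ε : ℝ, 0 ≤ K ∧ 0 < ε ∧ ∀ (u : GSDual (1 / 2) ι) Z, ‖u.pairing (tfWindow φ Z)‖ₑ ≤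
      ENNReal.ofReal K * ∫⁻ W, ‖u.pairing (tfWindow ψ W)‖ₑ *
        ENNReal.ofReal (Real.exp (-(ε * ‖Z - W‖ ^ 2))) := by
  obtain ⟨K, ε, hK, hε, hb⟩ := exists_norm_integral_mul_tfShift_le φ ψ
  have hc := windowConst_ne_zero hψ
  refine ⟨‖windowConst ψ‖⁻¹ * K, ε, by positivity, hε, fun u Z => ?_⟩
  -- The inversion formula is applied to the shifted window φ as test function; its coefficients
  -- have Gaussian decay in W - Z.
  have h1 := u.integral_tfCoeff_mul_pairing ψ (tfWindow φ Z)
  have h2 : u.pairing (tfWindow φ Z) = (windowConst ψ)⁻¹ *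
      ∫ W, tfCoeff ψ (tfWindow φ Z) W * u.pairing (tfWindow ψ W) := by
    rw [h1, inv_mul_cancel_left₀ hc]
  rw [h2, enorm_mul, ENNReal.ofReal_mul (by positivity), mul_assoc, ← norm_inv, ofReal_norm]
  refine mul_le_mul_right ((enorm_integral_le_lintegral_enorm _).trans ?_) _
  rw [← lintegral_const_mul' _ _ ENNReal.ofReal_ne_top]
  refine lintegral_mono fun W => ?_
  rw [enorm_mul, ← ofReal_norm, norm_tfCoeff_tfWindow, mul_left_comm, mul_comm,
    ← ENNReal.ofReal_mul hK, norm_sub_rev]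
  gcongr
  exact hb _

/-- Riemann sums of the inversion formula for `u`. -/
noncomputable def GSDual.approx (u : GSDual (1 / 2) ι) (ψ : GSSpace (1 / 2) ι) (j : ℕ) :
    GSSpace (1 / 2) ι :=
  ∑ w ∈ (riemannNode (EuclideanSpace ℝ ι × EuclideanSpace ℝ ι) j).range,
    ((windowConst ψ)⁻¹ * ((riemannWeight volume j w : ℝ) * u.pairing (tfWindow ψ w)) : ℂ) •
      gsConj (tfWindow ψ w)

/-- The pairing of two functions is symmetric, so testing the approximant against g produces the
Riemann sum of the inversion formula for the pairing of u with g. -/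
lemma GSDual.ofGS_approx_pairing (u : GSDual (1 / 2) ι) (ψ g : GSSpace (1 / 2) ι) (j : ℕ) :
    (GSDual.ofGS (u.approx ψ j)).pairing g = (windowConst ψ)⁻¹ *
      ∑ w ∈ (riemannNode (EuclideanSpace ℝ ι × EuclideanSpace ℝ ι) j).range,
        riemannWeight volume j w • (tfCoeff ψ g w * u.pairing (tfWindow ψ w)) := by
  have hcomm : ∀ a b : GSSpace (1 / 2) ι, (GSDual.ofGS a).pairing b = (GSDual.ofGS b).pairing a :=
    fun a b => integral_congr_ae (.of_forall fun x => mul_comm _ _)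
  rw [hcomm, GSDual.approx, GSDual.pairing_sum, Finset.mul_sum]
  refine Finset.sum_congr rfl fun w _ => ?_
  have : (GSDual.ofGS g).pairing (gsConj (tfWindow ψ w)) = tfCoeff ψ g w := rfl
  rw [this, Complex.real_smul]
  ring

lemma GSDual.tendsto_ofGS_approx (u : GSDual (1 / 2) ι) {ψ : GSSpace (1 / 2) ι} (hψ : ψ ≠ 0)
    (g : GSSpace (1 / 2) ι) :
    Tendsto (fun j => (GSDual.ofGS (u.approx ψ j)).pairing g) atTop (𝓝 (u.pairing g)) := by
  obtain ⟨K, ε, hK, hε, hb⟩ := exists_norm_tfCoeff_le ψ g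
  obtain ⟨L, hL, hu⟩ := u.exists_norm_pairing_tfWindow_le ψ (half_pos hε)
  have h1 := tendsto_sum_riemannWeight (volume : Measure (EuclideanSpace ℝ ι × EuclideanSpace ℝ ι))
    (G := fun W => tfCoeff ψ g W * u.pairing (tfWindow ψ W)) (K := K * L) (ε := ε / 2)
    ((continuous_tfCoeff ψ g).mul (u.continuous_pairing_tfWindow ψ)) (half_pos hε) (fun W => by
      rw [norm_mul]
      refine (mul_le_mul (hb W) (hu W) (norm_nonneg _) (by positivity)).trans (le_of_eq ?_)
      rw [mul_mul_mul_comm, ← Real.exp_add]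
      ring_nf)
  rw [u.integral_tfCoeff_mul_pairing] at h1
  have h2 := h1.const_mul (windowConst ψ)⁻¹
  rw [inv_mul_cancel_left₀ (windowConst_ne_zero hψ)] at h2
  exact h2.congr fun j => (u.ofGS_approx_pairing ψ g j).symm

/-- The approximants are dominated by the maximal function of the short-time Fourier transform. -/
lemma exists_norm_ofGS_approx_pairing_le (φ ψ : GSSpace (1 / 2) ι) (N : ℝ) :
    ∃ C : ℝ, 0 ≤ C ∧ ∀ (u : GSDual (1 / 2) ι) Z (M : ℝ), 0 ≤ M →
      (∀ W, ‖u.pairing (tfWindow ψ W)‖ ≤ M * Real.exp (N * ‖Z - W‖)) → ∀ j,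
      ‖(GSDual.ofGS (u.approx ψ j)).pairing (tfWindow φ Z)‖ ≤ C * M := by
  obtain ⟨K, ε, hK, hε, hb⟩ := exists_norm_integral_mul_tfShift_le φ ψ
  set I := Real.exp (ε / 2) * ∫ W : EuclideanSpace ℝ ι × EuclideanSpace ℝ ι,
    Real.exp (-(ε / 2 / 2 * ‖W‖ ^ 2)) with hI
  have hI0 : 0 ≤ I := mul_nonneg (by positivity) (integral_nonneg fun _ => (Real.exp_pos _).le)
  refine ⟨‖(windowConst ψ)⁻¹‖ * (K * Real.exp (N ^ 2 / (2 * ε)) * I), by positivity,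
    fun u Z M hM hu j => ?_⟩
  rw [u.ofGS_approx_pairing, norm_mul, mul_assoc]
  refine mul_le_mul_of_nonneg_left ?_ (norm_nonneg _)
  have h1 := mul_le_mul_of_nonneg_left
    (sum_riemannWeight_mul_exp_le (V := EuclideanSpace ℝ ι × EuclideanSpace ℝ ι) volume
      (half_pos hε) j Z) (by positivity : 0 ≤ K * Real.exp (N ^ 2 / (2 * ε)) * M)
  refine (norm_sum_le _ _).trans (le_trans ?_ (h1.trans (le_of_eq (by ring))))
  rw [Finset.mul_sum]
  refine Finset.sum_le_sum fun w _ => ?_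
  have hw := riemannWeight_nonneg (volume : Measure (EuclideanSpace ℝ ι × EuclideanSpace ℝ ι)) j w
  -- Completing the square: half of the Gaussian absorbs the exponential growth at the cost
  -- exp(N²/(2ε)).
  have hexp : Real.exp (-(ε * ‖w - Z‖ ^ 2)) * Real.exp (N * ‖w - Z‖) ≤
      Real.exp (N ^ 2 / (2 * ε)) * Real.exp (-(ε / 2 * ‖w - Z‖ ^ 2)) := by
    rw [← Real.exp_add, ← Real.exp_add]
    refine Real.exp_le_exp.2 ?_
    have : N ^ 2 / (2 * ε) + -(ε / 2 * ‖w - Z‖ ^ 2) -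
        (-(ε * ‖w - Z‖ ^ 2) + N * ‖w - Z‖) = (ε * ‖w - Z‖ - N) ^ 2 / (2 * ε) := by
      field_simp
      ring
    have h0 : 0 ≤ (ε * ‖w - Z‖ - N) ^ 2 / (2 * ε) := by positivity
    linarith
  rw [norm_smul, Real.norm_of_nonneg hw, norm_mul, norm_tfCoeff_tfWindow]
  have hu' := hu w
  rw [norm_sub_rev] at hu'
  calc _ ≤ riemannWeight volume j w * ((K * Real.exp (-(ε * ‖w - Z‖ ^ 2))) *
        (M * Real.exp (N * ‖w - Z‖))) := by
        gcongr
        exact hb _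
    _ = riemannWeight volume j w * (K * M *
        (Real.exp (-(ε * ‖w - Z‖ ^ 2)) * Real.exp (N * ‖w - Z‖))) := by ring
    _ ≤ riemannWeight volume j w * (K * M *
        (Real.exp (N ^ 2 / (2 * ε)) * Real.exp (-(ε / 2 * ‖w - Z‖ ^ 2)))) := by gcongr
    _ = _ := by ring

end Reproducing

/-! ### Minkowski's integral inequality -/

section Minkowski

open Filter
open scoped ENNReal

variable {α β : Type*} [MeasurableSpace α] [MeasurableSpace β] {μ : Measure α} {ν : Measure β}

/-- For p = ∞ a sublevel set of the essential supremum consists of the w whose slice {H > c} is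
null, and measures of slices are measurable; the other exponents are integrals. -/
lemma measurable_eLpNorm_prod [SFinite μ] {H : α → β → ℝ≥0∞} (hH : Measurable (Function.uncurry H))
    (p : ℝ≥0∞) : Measurable fun w => eLpNorm (fun x => H x w) p μ := by
  by_cases h0 : p = 0
  · simp [h0]
  by_cases ht : p = ⊤
  · subst ht
    simp only [eLpNorm_exponent_top, eLpNormEssSup_eq_essSup_enorm, enorm_eq_self]
    refine measurable_of_Iic fun c => ?_
    have hm : MeasurableSet {z : β × α | c < H z.2 z.1} :=
      measurableSet_lt measurable_const (hH.comp measurable_swap)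
    have e : (fun w => essSup (fun x => H x w) μ) ⁻¹' Set.Iic c =
        (fun w => μ (Prod.mk w ⁻¹' {z : β × α | c < H z.2 z.1})) ⁻¹' {0} := by
      ext w
      simp only [Set.mem_preimage, Set.mem_Iic, Set.mem_singleton_iff]
      constructor
      · intro h
        have h1 : ∀ᵐ x ∂μ, H x w ≤ c := by
          filter_upwards [ENNReal.ae_le_essSup fun x => H x w] with x hx using hx.trans h
        rw [ae_iff] at h1
        simpa only [not_le, Set.preimage_ofPred_eq] using h1
      · intro h
        refine essSup_le_of_ae_le c ?_
        rw [EventuallyLE, ae_iff]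
        simpa only [not_le, Set.preimage_ofPred_eq] using h
    rw [e]
    exact measurable_measure_prodMk_left hm (measurableSet_singleton 0)
  · simp only [eLpNorm_eq_lintegral_rpow_enorm_toReal h0 ht, enorm_eq_self]
    exact (Measurable.lintegral_prod_left' (f := fun z : α × β => H z.1 z.2 ^ p.toReal)
      (hH.pow_const _)).pow_const _

/-- Hölder's inequality applied to T^{p-1} H leaves J^{1/q} on the right, which can be divided out
only if J is finite. Hence T is merely below the integral of H, to allow truncations. -/
lemma lintegral_rpow_le_of_le_lintegral [SFinite μ] [SFinite ν] {H : α → β → ℝ≥0∞}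
    (hH : Measurable (Function.uncurry H)) {p : ℝ} (hp : 1 < p) {T : α → ℝ≥0∞} (hT : Measurable T)
    (hTH : ∀ x, T x ≤ ∫⁻ w, H x w ∂ν) (hfin : ∫⁻ x, T x ^ p ∂μ ≠ ⊤) :
    (∫⁻ x, T x ^ p ∂μ) ^ (1 / p) ≤ ∫⁻ w, (∫⁻ x, H x w ^ p ∂μ) ^ (1 / p) ∂ν := by
  set R := ∫⁻ w, (∫⁻ x, H x w ^ p ∂μ) ^ (1 / p) ∂ν with hR
  set J := ∫⁻ x, T x ^ p ∂μ with hJ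
  have hp0 : 0 < p := zero_lt_one.trans hp
  rcases eq_or_ne J 0 with h0 | h0
  · rw [h0, ENNReal.zero_rpow_of_pos (by positivity)]
    exact zero_le
  have hpq : p.HolderConjugate (p / (p - 1)) := Real.HolderConjugate.conjExponent hp
  set q := p / (p - 1) with hq
  have hsplit : ∀ t : ℝ≥0∞, t ^ p = t ^ (p - 1) * t := fun t => by
    conv_lhs => rw [show p = (p - 1) + 1 by ring, ENNReal.rpow_add_of_nonneg _ _ (by linarith)
      zero_le_one, ENNReal.rpow_one]
  have hHs : ∀ x, Measurable fun w => H x w := fun x => hH.comp measurable_prodMk_left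
  have hHl : ∀ w, Measurable fun x => H x w := fun w => hH.comp measurable_prodMk_right
  have h1 : J ≤ J ^ (1 / q) * R := by
    calc J ≤ ∫⁻ x, ∫⁻ w, T x ^ (p - 1) * H x w ∂ν ∂μ := by
          refine lintegral_mono fun x => ?_
          rw [lintegral_const_mul _ (hHs x)]
          simp only [hsplit]
          gcongr
          exact hTH x
      _ = ∫⁻ w, ∫⁻ x, T x ^ (p - 1) * H x w ∂μ ∂ν := by
          refine lintegral_lintegral_swap (Measurable.aemeasurable ?_)
          exact ((hT.comp measurable_fst).pow_const _).mul hH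
      _ ≤ ∫⁻ w, J ^ (1 / q) * (∫⁻ x, H x w ^ p ∂μ) ^ (1 / p) ∂ν := by
          refine lintegral_mono fun w => ?_
          have h2 := ENNReal.lintegral_mul_le_Lp_mul_Lq μ hpq.symm
            (hT.pow_const (p - 1)).aemeasurable (hHl w).aemeasurable
          have e : ∀ x, (T x ^ (p - 1)) ^ q = T x ^ p := fun x => by
            rw [← ENNReal.rpow_mul, hq, mul_div_cancel₀ _ (by linarith)]
          simp only [e] at h2
          exact h2
      _ = _ := by
          rw [lintegral_const_mul]
          exact (Measurable.lintegral_prod_left' (f := fun z : α × β => H z.1 z.2 ^ p)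
            (hH.pow_const _)).pow_const _
  have h2 : J = J ^ (1 / q) * J ^ (1 / p) := by
    rw [← ENNReal.rpow_add_of_nonneg _ _ hpq.symm.one_div_nonneg hpq.one_div_nonneg, add_comm]
    have := hpq.inv_add_inv_eq_one
    rw [one_div, one_div, this, ENNReal.rpow_one]
  have hne0 : J ^ (1 / q) ≠ 0 := by
    simp [ENNReal.rpow_eq_zero_iff, h0, hfin]
  have hnet : J ^ (1 / q) ≠ ⊤ := ENNReal.rpow_ne_top_of_nonneg hpq.symm.one_div_nonneg hfin
  conv_lhs at h1 => rw [h2]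
  exact (ENNReal.mul_le_mul_iff_right hne0 hnet).1 h1

/-- Minkowski's integral inequality. -/
lemma eLpNorm_lintegral_le [SigmaFinite μ] [SFinite ν] {H : α → β → ℝ≥0∞}
    (hH : Measurable (Function.uncurry H)) {p : ℝ≥0∞} (hp : 1 ≤ p) :
    eLpNorm (fun x => ∫⁻ w, H x w ∂ν) p μ ≤ ∫⁻ w, eLpNorm (fun x => H x w) p μ ∂ν := by
  have hHs : ∀ x, Measurable fun w => H x w := fun x => hH.comp measurable_prodMk_left
  rcases eq_or_ne p ⊤ with rfl | ht
  · have hm := measurable_eLpNorm_prod (μ := μ) hH ⊤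
    simp only [eLpNorm_exponent_top, eLpNormEssSup_eq_essSup_enorm, enorm_eq_self] at hm ⊢
    refine essSup_le_of_ae_le _ ?_
    have h1 : ∀ᵐ w ∂ν, ∀ᵐ x ∂μ, H x w ≤ essSup (fun x => H x w) μ :=
      .of_forall fun w => ENNReal.ae_le_essSup _
    have h2 := (Measure.ae_ae_comm (p := fun w x => H x w ≤ essSup (fun x => H x w) μ)
      (measurableSet_le (hH.comp measurable_swap) (hm.comp measurable_fst))).1 h1
    filter_upwards [h2] with x hx
    exact lintegral_mono_ae hx
  have hp0 : p ≠ 0 := (zero_lt_one.trans_le hp).ne'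
  simp only [eLpNorm_eq_lintegral_rpow_enorm_toReal hp0 ht, enorm_eq_self]
  rcases eq_or_ne p 1 with rfl | h1
  · simp only [ENNReal.toReal_one, ENNReal.rpow_one, div_one]
    exact (lintegral_lintegral_swap hH.aemeasurable).le
  set r := p.toReal with hr
  have hr1 : 1 < r := by
    rw [hr, ← ENNReal.toReal_one]
    exact (ENNReal.toReal_lt_toReal ENNReal.one_ne_top ht).2 (lt_of_le_of_ne hp h1.symm)
  have hr0 : 0 < r := zero_lt_one.trans hr1
  have hS : Measurable fun x => ∫⁻ w, H x w ∂ν := hH.lintegral_prod_right'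
  -- Truncation in height and to sets of finite measure makes the p-th powers integrable; monotone
  -- convergence removes it.
  set T : ℕ → α → ℝ≥0∞ := fun n => (spanningSets μ n).indicator fun x =>
    min (∫⁻ w, H x w ∂ν) n with hT
  have hTm : ∀ n, Measurable (T n) := fun n =>
    (hS.min measurable_const).indicator (measurableSet_spanningSets μ n)
  have hTmono : ∀ x, Monotone fun n => T n x := by
    intro x m n hmn
    classical
    simp only [hT, Set.indicator_apply]
    split_ifs with a b
    · gcongr
    · exact absurd (monotone_spanningSets μ hmn a) b
    · exact zero_le
    · exact le_rfl
  have hTlim : ∀ x, Tendsto (fun n => T n x) atTop (𝓝 (∫⁻ w, H x w ∂ν)) := by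
    intro x
    have h1 : Tendsto (fun n : ℕ => min (∫⁻ w, H x w ∂ν) (n : ℝ≥0∞)) atTop
        (𝓝 (min (∫⁻ w, H x w ∂ν) ⊤)) := tendsto_const_nhds.min ENNReal.tendsto_nat_nhds_top
    rw [min_top_right] at h1
    refine h1.congr' ?_
    filter_upwards [eventually_mem_spanningSets μ x] with n hn
    simp only [hT, Set.indicator_of_mem hn]
  have hle : ∀ n, ∫⁻ x, T n x ^ r ∂μ ≤ (∫⁻ w, (∫⁻ x, H x w ^ r ∂μ) ^ (1 / r) ∂ν) ^ r := by
    intro n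
    have hfin : ∫⁻ x, T n x ^ r ∂μ ≠ ⊤ := by
      refine ne_top_of_le_ne_top (b := (n : ℝ≥0∞) ^ r * μ (spanningSets μ n)) ?_ ?_
      · exact ENNReal.mul_ne_top (ENNReal.rpow_ne_top_of_nonneg hr0.le (ENNReal.natCast_ne_top n))
          (measure_spanningSets_lt_top μ n).ne
      · rw [← setLIntegral_const, ← lintegral_indicator (measurableSet_spanningSets μ n)]
        refine lintegral_mono fun x => ?_
        classical
        simp only [hT, Set.indicator_apply]
        split_ifs with a
        · gcongr
          exact min_le_right _ _
        · rw [ENNReal.zero_rpow_of_pos hr0]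
    have := lintegral_rpow_le_of_le_lintegral hH hr1 (hTm n)
      (fun x => (Set.indicator_le_self' (fun _ _ => zero_le) x).trans (min_le_left _ _)) hfin
    rw [one_div, ENNReal.rpow_inv_le_iff hr0] at this
    simpa only [one_div] using this
  have hlim := lintegral_tendsto_of_tendsto_of_monotone (μ := μ) (f := fun n x => T n x ^ r)
    (F := fun x => (∫⁻ w, H x w ∂ν) ^ r) (fun n => ((hTm n).pow_const r).aemeasurable)
    (.of_forall fun x m n hmn => ENNReal.rpow_le_rpow (hTmono x hmn) hr0.le)
    (.of_forall fun x => (ENNReal.continuous_rpow_const.tendsto _).comp (hTlim x))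
  have := le_of_tendsto' hlim hle
  rw [one_div, ENNReal.rpow_inv_le_iff hr0]
  simpa only [one_div] using this

end Minkowski

/-! ### Moderate weights are exponentially moderate and equivalent to continuous ones -/

section Weights

open Filter

variable {V : Type*} [NormedAddCommGroup V] [NormedSpace ℝ V] [FiniteDimensional ℝ V]
  [MeasureSpace V] [BorelSpace V] [(volume : Measure V).IsAddHaarMeasure]

lemma IsWeight.exists_ae_le {v : V → ℝ} (hv : IsWeight v) {K : Set V} (hK : IsCompact K) :
    ∃ M : ℝ, ∀ᵐ x, x ∈ K → v x ≤ M := by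
  have h := (hv.2 K hK).1.2
  rw [eLpNorm_exponent_top] at h
  refine ⟨(eLpNormEssSup v (volume.restrict K)).toReal, ?_⟩
  rw [← ae_restrict_iff' hK.measurableSet]
  filter_upwards [ae_le_eLpNormEssSup (f := v) (μ := volume.restrict K)] with x hx
  rw [← ofReal_norm] at hx
  exact (Real.le_norm_self _).trans ((ENNReal.ofReal_le_iff_le_toReal h.ne).1 hx)

/-- The weight v is bounded only almost everywhere on compact sets, so v(y) itself is not
controlled. Instead y = z + (y - z), where z is taken in a ball about y/2, which has positive
measure, such that z and y - z both avoid the exceptional set; moderateness is used twice. -/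
lemma IsModerate.exists_le_mul_of_norm_le_one {ω : V → ℝ} (hω : IsModerate ω) :
    ∃ D : ℝ, 1 ≤ D ∧ ∀ x y, ‖y‖ ≤ 1 → ω (x + y) ≤ D * ω x := by
  obtain ⟨hw, v, hv, C, hC, hb⟩ := hω
  have : ProperSpace V := FiniteDimensional.proper ℝ V
  obtain ⟨M, hM⟩ := hv.exists_ae_le (isCompact_closedBall (0 : V) 1)
  refine ⟨max 1 ((C * M) ^ 2), le_max_left _ _, fun x y hy => ?_⟩
  have h2 : ∀ᵐ z : V, y - z ∈ Metric.closedBall (0 : V) 1 → v (y - z) ≤ M :=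
    (Measure.measurePreserving_sub_left volume y).quasiMeasurePreserving.ae hM
  obtain ⟨z, hz, h1, h2⟩ : ∃ z ∈ Metric.ball ((1 / 2 : ℝ) • y) (1 / 2),
      (z ∈ Metric.closedBall (0 : V) 1 → v z ≤ M) ∧
      (y - z ∈ Metric.closedBall (0 : V) 1 → v (y - z) ≤ M) := by
    by_contra! hcon
    have h0 := ae_iff.1 (hM.and h2)
    refine (Metric.measure_ball_pos volume ((1 / 2 : ℝ) • y) (by norm_num : (0 : ℝ) < 1 / 2)).ne'
      (measure_mono_null (fun z hz => ?_) h0)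
    intro h
    exact absurd (h.2) (by
      have := hcon z hz h.1
      push Not
      exact this)
  rw [mem_ball_iff_norm] at hz
  have hy2 : ‖(1 / 2 : ℝ) • y‖ ≤ 1 / 2 := by
    rw [norm_smul]
    norm_num
    linarith
  have hz1 : ‖z‖ ≤ 1 := by
    have : z = (z - (1 / 2 : ℝ) • y) + (1 / 2 : ℝ) • y := by abel
    rw [this]
    exact (norm_add_le _ _).trans (by linarith)
  have hz2 : ‖y - z‖ ≤ 1 := by
    have : y - z = (1 / 2 : ℝ) • y - (z - (1 / 2 : ℝ) • y) := by
      have e : y = (1 / 2 : ℝ) • y + (1 / 2 : ℝ) • y := by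
        rw [← add_smul]
        norm_num
      nth_rewrite 1 [e]
      abel
    rw [this]
    exact (norm_sub_le _ _).trans (by linarith)
  have hv1 := h1 (mem_closedBall_zero_iff.2 hz1)
  have hv2 := h2 (mem_closedBall_zero_iff.2 hz2)
  have p1 := (hv.1 z)
  have p2 := (hv.1 (y - z))
  have hM0 : 0 < M := p1.trans_le hv1
  have hx := hw.1 x
  have hxz := hw.1 (x + z)
  have e : x + y = (x + z) + (y - z) := by abel
  calc ω (x + y) = ω ((x + z) + (y - z)) := by rw [e]
    _ ≤ C * (ω (x + z) * v (y - z)) := hb _ _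
    _ ≤ C * (C * (ω x * M) * M) := by
        gcongr
        exact (hb x z).trans (by gcongr)
    _ = (C * M) ^ 2 * ω x := by ring
    _ ≤ _ := by
        gcongr
        exact le_max_right _ _

/-- The vector Z - W is divided into ⌈‖Z - W‖⌉ steps of length at most 1, each of which costs D;
thus c = log D, and the rounding costs one more factor D. -/
lemma IsModerate.exists_le_exp_mul {ω : V → ℝ} (hω : IsModerate ω) :
    ∃ C c : ℝ, 1 ≤ C ∧ 0 ≤ c ∧ ∀ Z W, ω Z ≤ C * Real.exp (c * ‖Z - W‖) * ω W := by
  obtain ⟨D, hD, hb⟩ := hω.exists_le_mul_of_norm_le_one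
  have hD0 : 0 < D := by linarith
  have iter : ∀ n : ℕ, ∀ x y, ‖y‖ ≤ n → ω (x + y) ≤ D ^ n * ω x := by
    intro n
    induction n with
    | zero =>
      intro x y hy
      have : y = 0 := by simpa using hy
      simp [this]
    | succ n ih =>
      intro x y hy
      have hn : (0 : ℝ) < n + 1 := by positivity
      have hy' : ‖y‖ ≤ n + 1 := by exact_mod_cast hy
      have n1 : ‖((n : ℝ) / (n + 1)) • y‖ ≤ n := by
        rw [norm_smul, Real.norm_of_nonneg (by positivity), div_mul_eq_mul_div, div_le_iff₀ hn]
        gcongr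
      have n2 : ‖(1 / ((n : ℝ) + 1)) • y‖ ≤ 1 := by
        rw [norm_smul, Real.norm_of_nonneg (by positivity), one_div_mul_eq_div, div_le_one hn]
        exact hy'
      have e : x + y = (x + ((n : ℝ) / (n + 1)) • y) + (1 / ((n : ℝ) + 1)) • y := by
        rw [add_assoc, ← add_smul, ← add_div, div_self hn.ne', one_smul]
      rw [e]
      refine (hb _ _ n2).trans ?_
      rw [pow_succ', mul_assoc]
      exact mul_le_mul_of_nonneg_left (ih _ _ n1) hD0.le
  refine ⟨D, Real.log D, hD, Real.log_nonneg hD, fun Z W => ?_⟩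
  have h1 := iter ⌈‖Z - W‖⌉₊ W (Z - W) (Nat.le_ceil _)
  rw [add_sub_cancel] at h1
  refine h1.trans (mul_le_mul_of_nonneg_right ?_ (hω.1.1 W).le)
  rw [← Real.rpow_natCast, ← Real.rpow_def_of_pos hD0]
  refine (Real.rpow_le_rpow_of_exponent_le hD (Nat.ceil_lt_add_one (norm_nonneg _)).le).trans ?_
  rw [Real.rpow_add hD0, Real.rpow_one, mul_comm]

/-- A moderate weight is equivalent to a continuous weight. -/
lemma IsModerate.exists_continuous {ω : V → ℝ} (hω : IsModerate ω) :
    ∃ (ω' : V → ℝ) (C c : ℝ), 1 ≤ C ∧ 0 ≤ c ∧ Continuous ω' ∧ (∀ Z, ω Z ≤ ω' Z) ∧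
      (∀ Z, ω' Z ≤ C * ω Z) ∧ (∀ Z, 0 < ω' Z) ∧
      ∀ Z W, ω' Z ≤ Real.exp (c * ‖Z - W‖) * ω' W := by
  obtain ⟨C, c, hC, hc, hb⟩ := hω.exists_le_exp_mul
  -- The continuous weight is sup_W ω(W) e^{-c‖Z - W‖}. Its logarithm is Lipschitz with constant c,
  -- and exponential moderateness keeps it below C ω.
  set τ : V → V → ℝ := fun Z W => ω W * Real.exp (-(c * ‖Z - W‖)) with hτ
  have hτle : ∀ Z W, τ Z W ≤ C * ω Z := fun Z W => by
    rw [hτ]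
    have := hb W Z
    rw [norm_sub_rev] at this
    refine (mul_le_mul_of_nonneg_right this (Real.exp_pos _).le).trans (le_of_eq ?_)
    rw [mul_right_comm, mul_assoc C, ← Real.exp_add]
    simp
  have hbdd : ∀ Z, BddAbove (Set.range (τ Z)) := fun Z => ⟨C * ω Z, by
    rintro _ ⟨W, rfl⟩
    exact hτle Z W⟩
  set ω' : V → ℝ := fun Z => ⨆ W, τ Z W with hω'
  have h1 : ∀ Z, ω Z ≤ ω' Z := fun Z => by
    have := le_ciSup (hbdd Z) Z
    simpa [hτ] using this
  have h2 : ∀ Z, 0 < ω' Z := fun Z => (hω.1.1 Z).trans_le (h1 Z)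
  have h3 : ∀ Z W, ω' Z ≤ Real.exp (c * ‖Z - W‖) * ω' W := fun Z W => by
    refine ciSup_le fun Y => ?_
    refine le_trans ?_ (mul_le_mul_of_nonneg_left (le_ciSup (hbdd W) Y) (Real.exp_pos _).le)
    rw [hτ, mul_left_comm, ← Real.exp_add]
    refine mul_le_mul_of_nonneg_left (Real.exp_le_exp.2 ?_) (hω.1.1 Y).le
    have : ‖W - Y‖ ≤ ‖Z - W‖ + ‖Z - Y‖ := by
      rw [norm_sub_rev Z W]
      exact norm_sub_le_norm_sub_add_norm_sub W Z Y
    nlinarith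
  refine ⟨ω', C, c, hC, hc, ?_, h1, fun Z => ciSup_le (hτle Z), h2, h3⟩
  rw [continuous_iff_continuousAt]
  intro Z
  have l1 : Tendsto (fun W => Real.exp (c * ‖W - Z‖) * ω' Z) (𝓝 Z) (𝓝 (ω' Z)) := by
    have : Continuous fun W => Real.exp (c * ‖W - Z‖) * ω' Z := by fun_prop
    simpa using this.tendsto Z
  have l2 : Tendsto (fun W => Real.exp (-(c * ‖W - Z‖)) * ω' Z) (𝓝 Z) (𝓝 (ω' Z)) := by
    have : Continuous fun W => Real.exp (-(c * ‖W - Z‖)) * ω' Z := by fun_prop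
    simpa using this.tendsto Z
  refine tendsto_of_tendsto_of_tendsto_of_le_of_le l2 l1 (fun W => ?_) fun W => h3 W Z
  have := h3 Z W
  rw [norm_sub_rev] at this
  simp only
  rwa [Real.exp_neg, inv_mul_le_iff₀ (Real.exp_pos _)]

lemma IsWeight.comp_equiv {ω : V → ℝ} (hω : IsWeight ω) (L : V ≃L[ℝ] V) :
    IsWeight fun x => ω (L x) := by
  refine ⟨fun x => hω.1 _, fun K hK => ?_⟩
  have hq : Measure.QuasiMeasurePreserving L (volume.restrict K) (volume.restrict (L '' K)) := by
    have h0 : Measure.QuasiMeasurePreserving L (volume : Measure V) volume :=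
      Measure.ContinuousLinearMap.quasiMeasurePreserving volume (L : V →L[ℝ] V) (L.toLinearEquiv.isUnit_det'.ne_zero)
    refine ⟨h0.measurable, ?_⟩
    refine Measure.AbsolutelyContinuous.mk fun s hs h => ?_
    rw [Measure.map_apply h0.measurable hs, Measure.restrict_apply (h0.measurable hs)]
    rw [Measure.restrict_apply hs] at h
    refine measure_mono_null ?_ (h0.preimage_null h)
    rintro x ⟨hx, hxK⟩
    exact ⟨hx, x, hxK, rfl⟩
  have key : ∀ f : V → ℝ, MemLp f ⊤ (volume.restrict (L '' K)) →
      MemLp (fun x => f (L x)) ⊤ (volume.restrict K) := by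
    intro f hf
    refine ⟨hf.1.comp_quasiMeasurePreserving hq, lt_of_le_of_lt ?_ hf.2⟩
    simp only [eLpNorm_exponent_top]
    refine eLpNormEssSup_le_of_ae_enorm_bound ?_
    exact hq.ae (ae_le_eLpNormEssSup (f := f))
  have h := hω.2 _ (hK.image L.continuous)
  exact ⟨key _ h.1, key _ h.2⟩

lemma IsModerate.comp_equiv {ω : V → ℝ} (hω : IsModerate ω) (L : V ≃L[ℝ] V) :
    IsModerate fun x => ω (L x) := by
  obtain ⟨hw, v, hv, C, hC, hb⟩ := hω
  refine ⟨hw.comp_equiv L, fun x => v (L x), hv.comp_equiv L, C, hC, fun x y => ?_⟩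
  simp only [map_add]
  exact hb _ _

end Weights

/-! ### Maximal inequalities in weighted mixed norms, for all exponents -/

section Maximal

open Filter
open scoped ENNReal

section Pointwise

variable {V : Type*} [NormedAddCommGroup V]

/-- The maximal function `sup_W F(W) e^{-N|Z - W|}`. -/
noncomputable def expMax (N : ℝ) (F : V → ℝ≥0∞) (Z : V) : ℝ≥0∞ :=
  ⨆ W, F W * ENNReal.ofReal (Real.exp (-(N * ‖Z - W‖)))

lemma le_expMax (N : ℝ) (F : V → ℝ≥0∞) (Z W : V) :
    F W ≤ expMax N F Z * ENNReal.ofReal (Real.exp (N * ‖Z - W‖)) := by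
  refine le_trans (le_of_eq ?_) (mul_le_mul_left
    (le_iSup (fun W => F W * ENNReal.ofReal (Real.exp (-(N * ‖Z - W‖)))) W) _)
  rw [mul_assoc, ← ENNReal.ofReal_mul (Real.exp_pos _).le, ← Real.exp_add, neg_add_cancel,
    Real.exp_zero, ENNReal.ofReal_one, mul_one]

/-- The supremum is uncountable, so measurability comes from semicontinuity of a supremum of
continuous functions. -/
lemma lowerSemicontinuous_expMax (N : ℝ) (F : V → ℝ≥0∞) : LowerSemicontinuous (expMax N F) := by
  refine lowerSemicontinuous_iSup fun W => Continuous.lowerSemicontinuous ?_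
  refine continuous_iff_continuousAt.2 fun Z =>
    ENNReal.Tendsto.const_mul ?_ (Or.inl (by simp [Real.exp_pos]))
  exact (ENNReal.continuous_ofReal.comp
    (by fun_prop : Continuous fun Z => Real.exp (-(N * ‖Z - W‖)))).tendsto Z

lemma measurable_expMax [MeasurableSpace V] [BorelSpace V] (N : ℝ) (F : V → ℝ≥0∞) :
    Measurable (expMax N F) := (lowerSemicontinuous_expMax N F).measurable

variable [MeasurableSpace V]

/-- The Strömberg-Torchinsky argument: a function that is dominated by its convolution with a
Gaussian and that has subgaussian growth satisfies maximal inequalities for all powers. -/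
lemma rpow_mul_exp_le_lintegral (μ : Measure V) {F : V → ℝ≥0∞} {K ε N r : ℝ} (hK : 0 ≤ K)
    (hε : 0 < ε) (hN : 0 ≤ N) (hr : 0 < r) (hr1 : r ≤ 1)
    (hF : ∀ Z, F Z ≤ ENNReal.ofReal K *
      ∫⁻ W, F W * ENNReal.ofReal (Real.exp (-(ε * ‖Z - W‖ ^ 2))) ∂μ)
    (hg : ∀ δ : ℝ, 0 < δ → ∃ C : ℝ≥0, ∀ W, F W ≤ C * ENNReal.ofReal (Real.exp (δ * ‖W‖ ^ 2)))
    (Z Z' : V) :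
    (F Z' * ENNReal.ofReal (Real.exp (-(N * ‖Z - Z'‖)))) ^ r ≤
      ENNReal.ofReal (K * Real.exp (N ^ 2 / (2 * ε))) *
        ∫⁻ W, F W ^ r * ENNReal.ofReal (Real.exp (-(r * N * ‖Z - W‖))) ∂μ := by
  set A := ENNReal.ofReal (K * Real.exp (N ^ 2 / (2 * ε))) *
        ∫⁻ W, F W ^ r * ENNReal.ofReal (Real.exp (-(r * N * ‖Z - W‖))) ∂μ with hA
  have hexp : ∀ a b : ℝ, ENNReal.ofReal (Real.exp a) * ENNReal.ofReal (Real.exp b) =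
      ENNReal.ofReal (Real.exp (a + b)) := fun a b => by
    rw [← ENNReal.ofReal_mul (Real.exp_pos _).le, Real.exp_add]
  have main : ∀ δ : ℝ, 0 < δ → δ ≤ ε * r / 2 →
      (F Z' * ENNReal.ofReal (Real.exp (-(N * ‖Z - Z'‖ + δ * ‖Z'‖ ^ 2)))) ^ r ≤ A := by
    intro δ hδ hδε
    -- The additional factor exp(-δ‖W‖²) makes this supremum finite by the subgaussian growth, which
    -- allows M^{1-r} to be divided out below.
    set M : ℝ≥0∞ := ⨆ W, F W * ENNReal.ofReal (Real.exp (-(N * ‖Z - W‖ + δ * ‖W‖ ^ 2))) with hM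
    have hMtop : M ≠ ⊤ := by
      obtain ⟨C, hC⟩ := hg δ hδ
      refine ne_top_of_le_ne_top ENNReal.coe_ne_top (iSup_le fun W => ?_ : M ≤ C)
      refine (mul_le_mul_left (hC W) _).trans ?_
      rw [mul_assoc, hexp]
      refine mul_le_of_le_one_right' ?_
      rw [ENNReal.ofReal_le_one, Real.exp_le_one_iff]
      have : 0 ≤ N * ‖Z - W‖ := by positivity
      linarith
    have hFM : ∀ W, F W ≤ M * ENNReal.ofReal (Real.exp (N * ‖Z - W‖ + δ * ‖W‖ ^ 2)) := by
      intro W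
      refine le_trans (le_of_eq ?_) (mul_le_mul_left (le_iSup (fun W =>
        F W * ENNReal.ofReal (Real.exp (-(N * ‖Z - W‖ + δ * ‖W‖ ^ 2)))) W) _)
      rw [mul_assoc, hexp, neg_add_cancel, Real.exp_zero, ENNReal.ofReal_one, mul_one]
    have hr' : 0 ≤ 1 - r := by linarith
    have hsplit : ∀ t : ℝ≥0∞, t = t ^ r * t ^ (1 - r) := fun t => by
      rw [← ENNReal.rpow_add_of_nonneg _ _ hr.le hr', add_sub_cancel, ENNReal.rpow_one]
    have hMr : M ^ (1 - r) ≠ ⊤ := ENNReal.rpow_ne_top_of_nonneg hr' hMtop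
    have hint : ∀ Y W, F W * ENNReal.ofReal (Real.exp (-(ε * ‖Y - W‖ ^ 2))) *
        ENNReal.ofReal (Real.exp (-(N * ‖Z - Y‖ + δ * ‖Y‖ ^ 2))) ≤
        M ^ (1 - r) * ENNReal.ofReal (Real.exp (N ^ 2 / (2 * ε))) *
          (F W ^ r * ENNReal.ofReal (Real.exp (-(r * N * ‖Z - W‖)))) := by
      intro Y W
      have h1 : F W ≤ F W ^ r * (M ^ (1 - r) *
          ENNReal.ofReal (Real.exp ((N * ‖Z - W‖ + δ * ‖W‖ ^ 2) * (1 - r)))) := by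
        conv_lhs => rw [hsplit (F W)]
        gcongr
        refine (ENNReal.rpow_le_rpow (hFM W) hr').trans (le_of_eq ?_)
        rw [ENNReal.mul_rpow_of_nonneg _ _ hr', ENNReal.ofReal_rpow_of_pos (Real.exp_pos _),
          ← Real.exp_mul]
      have h2 : Real.exp ((N * ‖Z - W‖ + δ * ‖W‖ ^ 2) * (1 - r) + -(ε * ‖Y - W‖ ^ 2) +
          -(N * ‖Z - Y‖ + δ * ‖Y‖ ^ 2)) ≤
          Real.exp (N ^ 2 / (2 * ε) + -(r * N * ‖Z - W‖)) := by
        refine Real.exp_le_exp.2 ?_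
        set t := ‖Y - W‖ with ht
        have t0 : 0 ≤ t := norm_nonneg _
        have a1 : ‖Z - W‖ ≤ ‖Z - Y‖ + t := norm_sub_le_norm_sub_add_norm_sub Z Y W
        have a2 : ‖W‖ ≤ ‖Y‖ + t := by
          have : W = Y - (Y - W) := by abel
          calc ‖W‖ = ‖Y - (Y - W)‖ := by rw [← this]
            _ ≤ _ := norm_sub_le _ _
        have a3 : N ^ 2 / (2 * ε) + ε / 2 * t ^ 2 - N * t = (ε * t - N) ^ 2 / (2 * ε) := by
          field_simp
          ring
        have a3' : 0 ≤ (ε * t - N) ^ 2 / (2 * ε) := by positivity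
        -- The coefficient of ‖Y‖² must be 1 to be cancelled by exp(-δ‖Y‖²). The remainder δt²/r
        -- takes at most half of εt², by the choice of δ; the other half pays for Nt.
        have a4 : (1 - r) * ‖W‖ ^ 2 ≤ ‖Y‖ ^ 2 + t ^ 2 / r := by
          have b1 : (1 - r) * ‖W‖ ^ 2 ≤ (1 - r) * (‖Y‖ + t) ^ 2 := by gcongr
          have b2 : ‖Y‖ ^ 2 + t ^ 2 / r - (1 - r) * (‖Y‖ + t) ^ 2 =
              (r * ‖Y‖ - (1 - r) * t) ^ 2 / r + t ^ 2 := by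
            field_simp
            ring
          have b3 : 0 ≤ (r * ‖Y‖ - (1 - r) * t) ^ 2 / r + t ^ 2 := by positivity
          linarith
        have a5 : δ * (t ^ 2 / r) ≤ ε / 2 * t ^ 2 := by
          rw [mul_div_assoc', div_le_iff₀ hr]
          have := mul_le_mul_of_nonneg_right hδε (sq_nonneg t)
          linarith
        have a6 : δ * ((1 - r) * ‖W‖ ^ 2) ≤ δ * (‖Y‖ ^ 2 + t ^ 2 / r) := by gcongr
        have a7 : N * ‖Z - W‖ ≤ N * (‖Z - Y‖ + t) := by gcongr
        nlinarith
      calc _ ≤ F W ^ r * (M ^ (1 - r) *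
            ENNReal.ofReal (Real.exp ((N * ‖Z - W‖ + δ * ‖W‖ ^ 2) * (1 - r)))) *
            ENNReal.ofReal (Real.exp (-(ε * ‖Y - W‖ ^ 2))) *
            ENNReal.ofReal (Real.exp (-(N * ‖Z - Y‖ + δ * ‖Y‖ ^ 2))) := by gcongr
        _ = F W ^ r * M ^ (1 - r) * ENNReal.ofReal (Real.exp
            ((N * ‖Z - W‖ + δ * ‖W‖ ^ 2) * (1 - r) + -(ε * ‖Y - W‖ ^ 2) +
              -(N * ‖Z - Y‖ + δ * ‖Y‖ ^ 2))) := by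
            rw [← hexp, ← hexp]
            ring
        _ ≤ F W ^ r * M ^ (1 - r) *
            ENNReal.ofReal (Real.exp (N ^ 2 / (2 * ε) + -(r * N * ‖Z - W‖))) := by gcongr
        _ = _ := by
            rw [← hexp]
            ring
    -- Since M = M^r M^{1-r}, cancellation of M^{1-r} leaves M^r ≤ A.
    have key : M ≤ M ^ (1 - r) * A := by
      refine iSup_le fun Y => ?_
      refine (mul_le_mul_left (hF Y) _).trans ?_
      have e : ∀ a b I : ℝ≥0∞, M ^ (1 - r) * (a * b * I) = a * (M ^ (1 - r) * b * I) :=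
        fun a b I => by ring
      rw [mul_assoc, ← lintegral_mul_const' _ _ ENNReal.ofReal_ne_top, hA, ENNReal.ofReal_mul hK, e,
        ← lintegral_const_mul' _ _ (ENNReal.mul_ne_top hMr ENNReal.ofReal_ne_top)]
      exact mul_le_mul_right (lintegral_mono fun W => hint Y W) _
    have hMA : M ^ r ≤ A := by
      rcases eq_or_ne M 0 with h0 | h0
      · rw [h0, ENNReal.zero_rpow_of_pos hr]
        exact zero_le
      have hne : M ^ (1 - r) ≠ 0 := by simp [ENNReal.rpow_eq_zero_iff, h0, hMtop]
      conv_lhs at key => rw [hsplit M, mul_comm]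
      exact (ENNReal.mul_le_mul_iff_right hne hMr).1 key
    refine le_trans (ENNReal.rpow_le_rpow ?_ hr.le) hMA
    exact le_iSup (fun W => F W * ENNReal.ofReal (Real.exp (-(N * ‖Z - W‖ + δ * ‖W‖ ^ 2)))) Z'
  -- The bound A does not involve δ, so the regularization can be removed.
  have hlim : Tendsto (fun δ : ℝ =>
      (F Z' * ENNReal.ofReal (Real.exp (-(N * ‖Z - Z'‖ + δ * ‖Z'‖ ^ 2)))) ^ r) (𝓝[>] 0)
      (𝓝 ((F Z' * ENNReal.ofReal (Real.exp (-(N * ‖Z - Z'‖ + 0 * ‖Z'‖ ^ 2)))) ^ r)) := by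
    refine (ENNReal.continuous_rpow_const.tendsto _).comp
      (ENNReal.Tendsto.const_mul ?_ (Or.inl (by simp [Real.exp_pos])))
    have : Continuous fun δ : ℝ =>
        ENNReal.ofReal (Real.exp (-(N * ‖Z - Z'‖ + δ * ‖Z'‖ ^ 2))) :=
      ENNReal.continuous_ofReal.comp (by fun_prop)
    exact (this.tendsto 0).mono_left nhdsWithin_le_nhds
  rw [zero_mul, add_zero] at hlim
  refine le_of_tendsto hlim ?_
  filter_upwards [Ioc_mem_nhdsGT (show (0 : ℝ) < ε * r / 2 by positivity)] with δ hδ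
  exact main δ hδ.1 hδ.2

end Pointwise

section MixedNorm

variable {E : Type*} [MeasureSpace E]

/-- The mixed norm of a nonnegative function. -/
noncomputable def mixedENorm (p q : ℝ≥0∞) (G : E × E → ℝ≥0∞) : ℝ≥0∞ :=
  eLpNorm (fun Ξ => eLpNorm (fun X => G (X, Ξ)) p volume) q volume

lemma mixedENorm_le_mul {p q : ℝ≥0∞} {G H : E × E → ℝ≥0∞} {c : ℝ≥0} (h : ∀ Z, G Z ≤ c * H Z) :
    mixedENorm p q G ≤ c * mixedENorm p q H :=
  eLpNorm_le_mul_eLpNorm_of_ae_le_mul' (.of_forall fun Ξ =>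
    eLpNorm_le_mul_eLpNorm_of_ae_le_mul' (.of_forall fun X => h (X, Ξ)) p) q

lemma mixedENorm_mono {p q : ℝ≥0∞} {G H : E × E → ℝ≥0∞} (h : ∀ Z, G Z ≤ H Z) :
    mixedENorm p q G ≤ mixedENorm p q H :=
  eLpNorm_mono_enorm fun Ξ => eLpNorm_mono_enorm fun X => h (X, Ξ)

/-- Passing to r-th powers raises the exponents, which brings quasi-norms into the range where
Minkowski's inequality holds. -/
lemma mixedENorm_rpow {p q : ℝ≥0∞} {r : ℝ} (hr : 0 < r) (G : E × E → ℝ≥0∞) :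
    mixedENorm (p / ENNReal.ofReal r) (q / ENNReal.ofReal r) (fun Z => G Z ^ r) =
      mixedENorm p q G ^ r := by
  have h0 : ENNReal.ofReal r ≠ 0 := by simpa using hr
  have h : ∀ (p : ℝ≥0∞) (f : E → ℝ≥0∞),
      eLpNorm (fun x => f x ^ r) (p / ENNReal.ofReal r) volume = eLpNorm f p volume ^ r := by
    intro p f
    have := eLpNorm_enorm_rpow (p := p / ENNReal.ofReal r) (μ := volume) f hr
    rwa [ENNReal.div_mul_cancel h0 ENNReal.ofReal_ne_top] at this
  unfold mixedENorm
  simp only [h]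

variable [AddCommGroup E] [MeasurableAdd E] [MeasurableSub₂ E] [SigmaFinite (volume : Measure E)]
  [(volume : Measure E).IsAddRightInvariant]

/-- Young's inequality for mixed norms. -/
lemma mixedENorm_lintegral_sub_le {p q : ℝ≥0∞} (hp : 1 ≤ p) (hq : 1 ≤ q) {G : E × E → ℝ≥0∞}
    (hG : Measurable G) (ν : Measure (E × E)) [SFinite ν] :
    mixedENorm p q (fun Z => ∫⁻ W, G (Z - W) ∂ν) ≤ ν Set.univ * mixedENorm p q G := by
  set g : E → ℝ≥0∞ := fun Ξ => eLpNorm (fun X => G (X, Ξ)) p volume with hg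
  have hgm : Measurable g := measurable_eLpNorm_prod (H := fun X Ξ => G (X, Ξ)) hG p
  have h1 : ∀ Ξ, eLpNorm (fun X => ∫⁻ W, G ((X, Ξ) - W) ∂ν) p volume ≤
      ∫⁻ W, g (Ξ - W.2) ∂ν := by
    intro Ξ
    have hm : Measurable (Function.uncurry fun (X : E) (W : E × E) => G (X - W.1, Ξ - W.2)) :=
      hG.comp (f := fun z : E × (E × E) => (z.1 - z.2.1, Ξ - z.2.2)) (by fun_prop)
    refine (eLpNorm_lintegral_le hm hp).trans (lintegral_mono fun W => le_of_eq ?_)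
    have hGW : Measurable fun X => G (X, Ξ - W.2) := hG.comp (by fun_prop)
    exact eLpNorm_comp_measurePreserving hGW.aestronglyMeasurable
      (measurePreserving_sub_right volume W.1)
  calc mixedENorm p q (fun Z => ∫⁻ W, G (Z - W) ∂ν)
      ≤ eLpNorm (fun Ξ => ∫⁻ W, g (Ξ - W.2) ∂ν) q volume := eLpNorm_mono_enorm h1
    _ ≤ ∫⁻ W, eLpNorm (fun Ξ => g (Ξ - W.2)) q volume ∂ν :=
        eLpNorm_lintegral_le (H := fun (Ξ : E) (W : E × E) => g (Ξ - W.2))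
          (hgm.comp (f := fun z : E × (E × E) => z.1 - z.2.2) (by fun_prop)) hq
    _ = ∫⁻ W, mixedENorm p q G ∂ν := by
        refine lintegral_congr fun W => ?_
        exact eLpNorm_comp_measurePreserving hgm.aestronglyMeasurable
          (measurePreserving_sub_right volume W.2)
    _ = _ := by rw [lintegral_const, mul_comm]

end MixedNorm

/-- The maximal function is bounded in weighted mixed norms. -/
lemma exists_mixedENorm_expMax_le {E : Type*} [NormedAddCommGroup E] [NormedSpace ℝ E]
    [FiniteDimensional ℝ E] [MeasureSpace E] [BorelSpace E]
    [(volume : Measure E).IsAddHaarMeasure] {p q : ℝ≥0∞} (hp : p ≠ 0) (hq : q ≠ 0)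
    {ω : E × E → ℝ} (hωc : Continuous ω) {c : ℝ} (hc : 0 ≤ c) (hω0 : ∀ Z, 0 < ω Z)
    (hω : ∀ Z W, ω Z ≤ Real.exp (c * ‖Z - W‖) * ω W)
    {K ε : ℝ} (hK : 0 ≤ K) (hε : 0 < ε) :
    ∃ C : ℝ≥0, ∀ F : E × E → ℝ≥0∞, Measurable F →
      (∀ Z, F Z ≤ ENNReal.ofReal K *
        ∫⁻ W, F W * ENNReal.ofReal (Real.exp (-(ε * ‖Z - W‖ ^ 2)))) →
      (∀ δ : ℝ, 0 < δ → ∃ D : ℝ≥0, ∀ W, F W ≤ D * ENNReal.ofReal (Real.exp (δ * ‖W‖ ^ 2))) →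
      mixedENorm p q (fun Z => expMax (c + 1) F Z * ENNReal.ofReal (ω Z)) ≤
        C * mixedENorm p q (fun Z => F Z * ENNReal.ofReal (ω Z)) := by
  -- Then p/r and q/r are at least 1; the minimum with 1 keeps r finite when p = q = ∞.
  set r : ℝ := (min 1 (min p q)).toReal with hr_def
  have hmin : min 1 (min p q) ≠ ⊤ := ne_top_of_le_ne_top ENNReal.one_ne_top (min_le_left _ _)
  have hr : 0 < r := ENNReal.toReal_pos (by simp [hp, hq]) hmin
  have hofr : ENNReal.ofReal r = min 1 (min p q) := ENNReal.ofReal_toReal hmin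
  have hr1 : r ≤ 1 := by
    rw [← ENNReal.ofReal_le_one, hofr]
    exact min_le_left _ _
  have hofr0 : ENNReal.ofReal r ≠ 0 := by simpa using hr
  have hp1 : 1 ≤ p / ENNReal.ofReal r := by
    rw [ENNReal.le_div_iff_mul_le (Or.inl hofr0) (Or.inl ENNReal.ofReal_ne_top), one_mul, hofr]
    exact (min_le_right _ _).trans (min_le_left _ _)
  have hq1 : 1 ≤ q / ENNReal.ofReal r := by
    rw [ENNReal.le_div_iff_mul_le (Or.inl hofr0) (Or.inl ENNReal.ofReal_ne_top), one_mul, hofr]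
    exact (min_le_right _ _).trans (min_le_right _ _)
  set A := ENNReal.ofReal (K * Real.exp ((c + 1) ^ 2 / (2 * ε))) with hA
  -- The maximal function decays with rate c + 1 and moderateness of the weight consumes c, so the
  -- r-th powers leave the integrable kernel exp(-r‖W‖).
  set k : E × E → ℝ≥0∞ := fun W => A * ENNReal.ofReal (Real.exp (-(r * ‖W‖))) with hk
  have hkm : Measurable k := by
    rw [hk]
    fun_prop
  set ν : Measure (E × E) := volume.withDensity k with hν
  have : (volume : Measure (E × E)).IsAddHaarMeasure :=
    Measure.prod.instIsAddHaarMeasure volume volume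
  have hνfin : ν Set.univ ≠ ⊤ := by
    rw [hν, withDensity_apply _ MeasurableSet.univ, Measure.restrict_univ, hk,
      lintegral_const_mul' _ _ ENNReal.ofReal_ne_top]
    exact ENNReal.mul_ne_top ENNReal.ofReal_ne_top
      (integrable_exp_neg_mul_norm volume hr).lintegral_lt_top.ne
  refine ⟨((ν Set.univ) ^ r⁻¹).toNNReal, fun F hFm hF hg => ?_⟩
  rw [ENNReal.coe_toNNReal (ENNReal.rpow_ne_top_of_nonneg (by positivity) hνfin)]
  set G : E × E → ℝ≥0∞ := fun Z => (F Z * ENNReal.ofReal (ω Z)) ^ r with hG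
  have hGm : Measurable G := (hFm.mul hωc.measurable.ennreal_ofReal).pow_const r
  have hpt : ∀ Z, (expMax (c + 1) F Z * ENNReal.ofReal (ω Z)) ^ r ≤ ∫⁻ W, G (Z - W) ∂ν := by
    intro Z
    have e1 : ∫⁻ W, G (Z - W) ∂ν =
        ∫⁻ W, A * ENNReal.ofReal (Real.exp (-(r * ‖Z - W‖))) * G W := by
      rw [hν, lintegral_withDensity_eq_lintegral_mul _ hkm
        (show Measurable fun W => G (Z - W) from hGm.comp (measurable_const_sub Z)),
        ← lintegral_sub_left_eq_self _ Z]
      simp [hk]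
    have e2 : (expMax (c + 1) F Z) ^ r ≤
        A * ∫⁻ W, F W ^ r * ENNReal.ofReal (Real.exp (-(r * (c + 1) * ‖Z - W‖))) := by
      rw [← ENNReal.le_rpow_inv_iff hr]
      refine iSup_le fun W => ?_
      rw [ENNReal.le_rpow_inv_iff hr]
      exact rpow_mul_exp_le_lintegral volume hK hε (by positivity) hr hr1 hF hg Z W
    rw [e1, ENNReal.mul_rpow_of_nonneg _ _ hr.le]
    refine (mul_le_mul_left e2 _).trans ?_
    rw [mul_assoc, ← lintegral_mul_const' _ _
      (ENNReal.rpow_ne_top_of_nonneg hr.le ENNReal.ofReal_ne_top),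
      ← lintegral_const_mul' _ _ ENNReal.ofReal_ne_top]
    refine lintegral_mono fun W => ?_
    simp only [hG]
    rw [mul_assoc A]
    refine mul_le_mul_right ?_ A
    rw [ENNReal.mul_rpow_of_nonneg _ _ hr.le, mul_assoc, mul_left_comm (ENNReal.ofReal _)]
    refine mul_le_mul_right ?_ _
    rw [ENNReal.ofReal_rpow_of_pos (hω0 _), ENNReal.ofReal_rpow_of_pos (hω0 _),
      ← ENNReal.ofReal_mul (Real.exp_pos _).le, ← ENNReal.ofReal_mul (Real.exp_pos _).le]
    refine ENNReal.ofReal_le_ofReal ?_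
    have h3 := Real.rpow_le_rpow (hω0 Z).le (hω Z W) hr.le
    rw [Real.mul_rpow (Real.exp_pos _).le (hω0 W).le, ← Real.exp_mul] at h3
    refine (mul_le_mul_of_nonneg_left h3 (Real.exp_pos _).le).trans (le_of_eq ?_)
    rw [← mul_assoc, ← Real.exp_add]
    ring_nf
  have h4 := (mixedENorm_mono hpt).trans (mixedENorm_lintegral_sub_le hp1 hq1 hGm ν)
  rw [hG, mixedENorm_rpow hr, mixedENorm_rpow hr] at h4
  have h5 := ENNReal.rpow_le_rpow h4 (inv_nonneg.2 hr.le)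
  rwa [ENNReal.mul_rpow_of_nonneg _ _ (inv_nonneg.2 hr.le), ENNReal.rpow_rpow_inv hr.ne',
    ENNReal.rpow_rpow_inv hr.ne'] at h5

end Maximal

/-! ### Window independence, and the embedding into distributions -/

section ModulationNorm

open Filter
open scoped ENNReal

variable {ι : Type*} [Fintype ι] [DecidableEq ι]

/-- The modulus of the pairing of `u` with the time-frequency shifts of `φ`. -/
noncomputable def GSDual.tfNorm (u : GSDual (1 / 2) ι) (φ : GSSpace (1 / 2) ι)
    (Z : EuclideanSpace ℝ ι × EuclideanSpace ℝ ι) : ℝ≥0∞ := ‖u.pairing (tfWindow φ Z)‖ₑ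

lemma GSDual.continuous_tfNorm (u : GSDual (1 / 2) ι) (φ : GSSpace (1 / 2) ι) :
    Continuous (u.tfNorm φ) := (u.continuous_pairing_tfWindow φ).enorm

variable {p q : ℝ≥0∞} {ω ω' : EuclideanSpace ℝ ι × EuclideanSpace ℝ ι → ℝ}

lemma enorm_stft_mul (φ : GSSpace (1 / 2) ι) (u : GSDual (1 / 2) ι) (X Ξ : EuclideanSpace ℝ ι)
    {t : ℝ} (ht : 0 ≤ t) : ‖u.stft (by norm_num) φ X Ξ * (t : ℂ)‖ₑ =
      ‖fourierConst ι‖₊ * (u.tfNorm φ (X, Ξ) * ENNReal.ofReal t) := by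
  rw [GSDual.stft_eq, enorm_mul, enorm_mul, mul_assoc, GSDual.tfNorm]
  congr 2
  rw [← ofReal_norm, Complex.norm_real, Real.norm_of_nonneg ht]

/-- Together with `mixedENorm_le_modNorm` this replaces ω by a pointwise equivalent continuous
weight and removes phases and the constant (2π)^{-n/2}, so that the measurable estimates above
apply. -/
lemma modNorm_le_mixedENorm (h0 : ∀ Z, 0 ≤ ω Z) (h : ∀ Z, ω Z ≤ ω' Z) (φ : GSSpace (1 / 2) ι)
    (u : GSDual (1 / 2) ι) : modNorm p q ω φ u ≤
      ‖fourierConst ι‖₊ * mixedENorm p q (fun Z => u.tfNorm φ Z * ENNReal.ofReal (ω' Z)) := by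
  refine eLpNorm_le_mul_eLpNorm_of_ae_le_mul' (.of_forall fun Ξ =>
    eLpNorm_le_mul_eLpNorm_of_ae_le_mul' (.of_forall fun X => ?_) p) q
  rw [enorm_stft_mul _ _ _ _ (h0 _), enorm_eq_self]
  exact mul_le_mul_right (mul_le_mul_right (ENNReal.ofReal_le_ofReal (h _)) _) _

lemma mixedENorm_le_modNorm (h0 : ∀ Z, 0 ≤ ω Z) {C : ℝ≥0} (h : ∀ Z, ω' Z ≤ C * ω Z)
    (φ : GSSpace (1 / 2) ι) (u : GSDual (1 / 2) ι) :
    mixedENorm p q (fun Z => u.tfNorm φ Z * ENNReal.ofReal (ω' Z)) ≤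
      (‖fourierConst ι‖₊⁻¹ * C : ℝ≥0) * modNorm p q ω φ u := by
  refine eLpNorm_le_mul_eLpNorm_of_ae_le_mul' (.of_forall fun Ξ =>
    eLpNorm_le_mul_eLpNorm_of_ae_le_mul' (.of_forall fun X => ?_) p) q
  rw [enorm_stft_mul _ _ _ _ (h0 _), enorm_eq_self, ← mul_assoc, ← ENNReal.coe_mul, mul_right_comm,
    inv_mul_cancel₀ (nnnorm_ne_zero_iff.2 (fourierConst_ne_zero ι)), one_mul, mul_left_comm]
  refine mul_le_mul_right ?_ _
  rw [← ENNReal.ofReal_coe_nnreal, ← ENNReal.ofReal_mul C.coe_nonneg]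
  exact ENNReal.ofReal_le_ofReal (h _)

/-- In the Gaussian convolution that dominates a change of window, the values at W are at most the
maximal function at Z times e^{N‖Z - W‖}, and the Gaussian integrates this exponential. -/
lemma GSDual.exists_tfNorm_le_expMax (φ : GSSpace (1 / 2) ι) {ψ : GSSpace (1 / 2) ι} (hψ : ψ ≠ 0)
    (N : ℝ) : ∃ C : ℝ≥0, ∀ (u : GSDual (1 / 2) ι) Z,
      u.tfNorm φ Z ≤ C * expMax N (u.tfNorm ψ) Z := by
  obtain ⟨K, ε, hK, hε, h⟩ := exists_enorm_pairing_tfWindow_le φ hψ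
  set I : ℝ≥0∞ := ∫⁻ W : EuclideanSpace ℝ ι × EuclideanSpace ℝ ι,
    ENNReal.ofReal (Real.exp (-(ε / 2 * ‖W‖ ^ 2))) with hI
  have hIt : I ≠ ⊤ := (integrable_exp_neg_mul_norm_sq' volume (half_pos hε)).lintegral_lt_top.ne
  set D : ℝ≥0∞ := ENNReal.ofReal K * (ENNReal.ofReal (Real.exp (N ^ 2 / (2 * ε))) * I) with hD
  have hDt : D ≠ ⊤ := ENNReal.mul_ne_top ENNReal.ofReal_ne_top
    (ENNReal.mul_ne_top ENNReal.ofReal_ne_top hIt)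
  refine ⟨D.toNNReal, fun u Z => ?_⟩
  rw [ENNReal.coe_toNNReal hDt, hD, mul_assoc]
  refine (h u Z).trans (mul_le_mul_right ?_ _)
  have e1 : I = ∫⁻ W, ENNReal.ofReal (Real.exp (-(ε / 2 * ‖Z - W‖ ^ 2))) := by
    simp only [norm_sub_rev Z]
    rw [hI, ← lintegral_sub_right_eq_self _ Z]
  rw [e1, ← lintegral_const_mul' _ _ ENNReal.ofReal_ne_top, mul_comm,
    ← lintegral_const_mul _ (by fun_prop)]
  refine lintegral_mono fun W => ?_
  refine (mul_le_mul_left (le_expMax N (u.tfNorm ψ) Z W) _).trans ?_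
  rw [mul_assoc, ← ENNReal.ofReal_mul (Real.exp_pos _).le, ← ENNReal.ofReal_mul (Real.exp_pos _).le,
    ← Real.exp_add, ← Real.exp_add]
  refine mul_le_mul_right (ENNReal.ofReal_le_ofReal (Real.exp_le_exp.2 ?_)) _
  have : N ^ 2 / (2 * ε) + -(ε / 2 * ‖Z - W‖ ^ 2) -
      (N * ‖Z - W‖ + -(ε * ‖Z - W‖ ^ 2)) = (ε * ‖Z - W‖ - N) ^ 2 / (2 * ε) := by
    field_simp
    ring
  have h0 : 0 ≤ (ε * ‖Z - W‖ - N) ^ 2 / (2 * ε) := by positivity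
  linarith

/-- The change of window from ψ to itself supplies the self-domination by a Gaussian convolution,
and boundedness of u on every 𝒮_{1/2,h} the subgaussian growth. -/
lemma GSDual.exists_mixedENorm_expMax_tfNorm_le (hp : p ≠ 0) (hq : q ≠ 0) (hωc : Continuous ω')
    {c : ℝ} (hc : 0 ≤ c) (h0 : ∀ Z, 0 < ω' Z)
    (hω : ∀ Z W, ω' Z ≤ Real.exp (c * ‖Z - W‖) * ω' W) {ψ : GSSpace (1 / 2) ι} (hψ : ψ ≠ 0) :
    ∃ C : ℝ≥0, ∀ u : GSDual (1 / 2) ι,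
      mixedENorm p q (fun Z => expMax (c + 1) (u.tfNorm ψ) Z * ENNReal.ofReal (ω' Z)) ≤
        C * mixedENorm p q (fun Z => u.tfNorm ψ Z * ENNReal.ofReal (ω' Z)) := by
  obtain ⟨K, ε, hK, hε, h⟩ := exists_enorm_pairing_tfWindow_le ψ hψ
  obtain ⟨C, hC⟩ := exists_mixedENorm_expMax_le hp hq hωc hc h0 hω hK hε
  refine ⟨C, fun u => hC _ (u.continuous_tfNorm ψ).measurable (h u) fun δ hδ => ?_⟩
  obtain ⟨D, hD, hu⟩ := u.exists_norm_pairing_tfWindow_le ψ hδ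
  refine ⟨D.toNNReal, fun W => ?_⟩
  rw [GSDual.tfNorm, ← ofReal_norm]
  refine (ENNReal.ofReal_le_ofReal (hu W)).trans (le_of_eq ?_)
  rw [ENNReal.ofReal_mul hD]
  rfl

/-- Modulation norms dominate the maximal function of the short-time Fourier transform. -/
lemma IsModerate.exists_mixedENorm_expMax_le_modNorm (hω : IsModerate ω) (hp : p ≠ 0) (hq : q ≠ 0) :
    ∃ (ω' : EuclideanSpace ℝ ι × EuclideanSpace ℝ ι → ℝ) (c : ℝ), 0 ≤ c ∧ Continuous ω' ∧
      (∀ Z, 0 < ω' Z) ∧ (∀ Z, ω Z ≤ ω' Z) ∧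
      (∀ Z W, ω' Z ≤ Real.exp (c * ‖Z - W‖) * ω' W) ∧
      ∀ ψ : GSSpace (1 / 2) ι, ψ ≠ 0 → ∃ C : ℝ≥0, ∀ u : GSDual (1 / 2) ι,
        mixedENorm p q (fun Z => expMax (c + 1) (u.tfNorm ψ) Z * ENNReal.ofReal (ω' Z)) ≤
          C * modNorm p q ω ψ u := by
  obtain ⟨ω', D, c, hD, hc, hcont, h1, h2, h3, h4⟩ := hω.exists_continuous
  refine ⟨ω', c, hc, hcont, h3, h1, h4, fun ψ hψ => ?_⟩
  obtain ⟨C, hC⟩ := GSDual.exists_mixedENorm_expMax_tfNorm_le hp hq hcont hc h3 h4 hψ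
  lift D to ℝ≥0 using (by linarith)
  refine ⟨C * (‖fourierConst ι‖₊⁻¹ * D), fun u => (hC u).trans ?_⟩
  rw [ENNReal.coe_mul, mul_assoc]
  exact mul_le_mul_right (mixedENorm_le_modNorm (fun Z => (hω.1.1 Z).le) h2 ψ u) _

/-- Modulation norms with different windows are equivalent. -/
lemma IsModerate.exists_modNorm_le (hω : IsModerate ω) (hp : p ≠ 0) (hq : q ≠ 0)
    (φ : GSSpace (1 / 2) ι) {ψ : GSSpace (1 / 2) ι} (hψ : ψ ≠ 0) :
    ∃ C : ℝ≥0, ∀ u : GSDual (1 / 2) ι, modNorm p q ω φ u ≤ C * modNorm p q ω ψ u := by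
  obtain ⟨ω', c, hc, hcont, h0, h1, h2, h3⟩ := hω.exists_mixedENorm_expMax_le_modNorm hp hq
  obtain ⟨C, hC⟩ := h3 ψ hψ
  obtain ⟨D, hD⟩ := GSDual.exists_tfNorm_le_expMax φ hψ (c + 1)
  refine ⟨‖fourierConst ι‖₊ * D * C, fun u => ?_⟩
  have e1 := modNorm_le_mixedENorm (p := p) (q := q) (fun Z => (hω.1.1 Z).le) h1 φ u
  have e2 : mixedENorm p q (fun Z => u.tfNorm φ Z * ENNReal.ofReal (ω' Z)) ≤ D *
      mixedENorm p q (fun Z => expMax (c + 1) (u.tfNorm ψ) Z * ENNReal.ofReal (ω' Z)) :=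
    mixedENorm_le_mul fun Z => by
      rw [← mul_assoc]
      exact mul_le_mul_left (hD u Z) _
  refine e1.trans ((mul_le_mul_right (e2.trans (mul_le_mul_right (hC u) _)) _).trans (le_of_eq ?_))
  push_cast
  ring

lemma expMax_le_expMax_mul {V : Type*} [NormedAddCommGroup V] {N : ℝ} (hN : 0 ≤ N) (F : V → ℝ≥0∞)
    (Z W : V) : expMax N F Z ≤ expMax N F W * ENNReal.ofReal (Real.exp (N * ‖Z - W‖)) := by
  refine iSup_le fun Y => ?_
  refine (mul_le_mul_left (le_expMax N F W Y) _).trans ?_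
  rw [mul_assoc, ← ENNReal.ofReal_mul (Real.exp_pos _).le, ← Real.exp_add]
  gcongr
  have := norm_sub_le_norm_sub_add_norm_sub W Z Y
  rw [norm_sub_rev W Z] at this
  nlinarith

lemma mixedENorm_ne_zero {E : Type*} [MeasureSpace E] [SFinite (volume : Measure E)]
    [NeZero (volume : Measure E)] (hp : p ≠ 0) (hq : q ≠ 0) {H : E × E → ℝ≥0∞} (hH : Measurable H)
    (h : ∀ Z, H Z ≠ 0) : mixedENorm p q H ≠ 0 := by
  have key : ∀ (p : ℝ≥0∞) (f : E → ℝ≥0∞), p ≠ 0 → Measurable f → (∀ x, f x ≠ 0) →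
      eLpNorm f p volume ≠ 0 := by
    intro p f hp hf hf0 h0
    rw [eLpNorm_eq_zero_iff hf.aestronglyMeasurable hp] at h0
    obtain ⟨x, hx⟩ := h0.exists
    exact hf0 x hx
  exact key q _ hq (measurable_eLpNorm_prod (H := fun X Ξ => H (X, Ξ)) hH p) fun Ξ =>
    key p _ hp (hH.comp (by fun_prop)) fun X => h _

/-- Modulation spaces are continuously included in the space of distributions. -/
lemma IsModerate.exists_enorm_pairing_le (hω : IsModerate ω) (hp : p ≠ 0) (hq : q ≠ 0)
    {φ : GSSpace (1 / 2) ι} (hφ : φ ≠ 0) (g : GSSpace (1 / 2) ι) :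
    ∃ C : ℝ≥0, ∀ u : GSDual (1 / 2) ι, ‖u.pairing g‖ₑ ≤ C * modNorm p q ω φ u := by
  obtain ⟨ω', c, hc, hcont, h0, h1, h2, h3⟩ := hω.exists_mixedENorm_expMax_le_modNorm hp hq
  obtain ⟨C, hC⟩ := h3 φ hφ
  obtain ⟨D, hD⟩ := GSDual.exists_tfNorm_le_expMax (gsConj g) hφ (c + 1)
  -- Pairing with g is thus the value at the origin of a short-time Fourier transform, and the
  -- maximal function at the origin controls it.
  have hg : tfWindow (gsConj g) 0 = g := by
    refine Subtype.ext (funext fun y => ?_)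
    simp [coe_tfWindow, tfShift]
  -- The maximal function at Z is at least its value at 0 times exp(-(c + 1)‖Z‖), so its weighted
  -- norm is at least that value times the nonzero norm of H.
  set H : EuclideanSpace ℝ ι × EuclideanSpace ℝ ι → ℝ≥0∞ := fun Z =>
    ENNReal.ofReal (Real.exp (-((c + 1) * ‖Z‖))) * ENNReal.ofReal (ω' Z) with hH
  have hH0 : mixedENorm p q H ≠ 0 := by
    refine mixedENorm_ne_zero hp hq ?_ fun Z => ?_
    · have := hcont.measurable
      rw [hH]
      fun_prop
    · simp [hH, h0 Z, Real.exp_pos]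
  -- Truncation at 1 makes the divisor finite without a separate estimate of H.
  set k := min (mixedENorm p q H) 1 with hk
  have hk0 : k ≠ 0 := by simp [hk, hH0]
  have hkt : k ≠ ⊤ := ne_top_of_le_ne_top ENNReal.one_ne_top (min_le_right _ _)
  refine ⟨D * (k⁻¹).toNNReal * C, fun u => ?_⟩
  set m := mixedENorm p q
    (fun Z => expMax (c + 1) (u.tfNorm φ) Z * ENNReal.ofReal (ω' Z)) with hm
  have hmax : expMax (c + 1) (u.tfNorm φ) 0 ≤ k⁻¹ * m := by
    -- Finite numbers below the maximal function are tested, since its value may be ∞.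
    refine ENNReal.le_of_forall_nnreal_lt fun t ht => ?_
    rcases eq_or_ne t 0 with rfl | ht0
    · simp
    have ht0' : (t : ℝ≥0∞) ≠ 0 := by exact_mod_cast ht0
    have hle : mixedENorm p q H ≤ (t⁻¹ : ℝ≥0) * m := by
      refine mixedENorm_le_mul fun Z => ?_
      rw [ENNReal.coe_inv ht0, ← mul_assoc, hH]
      refine mul_le_mul_left ?_ _
      rw [← ENNReal.div_eq_inv_mul, ENNReal.le_div_iff_mul_le (Or.inl ht0')
        (Or.inl ENNReal.coe_ne_top), mul_comm]
      refine (mul_le_mul_left (ht.le.trans (expMax_le_expMax_mul (by linarith) _ 0 Z)) _).trans ?_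
      rw [mul_assoc, ← ENNReal.ofReal_mul (Real.exp_pos _).le, ← Real.exp_add, zero_sub, norm_neg,
        add_neg_cancel, Real.exp_zero, ENNReal.ofReal_one, mul_one]
    rw [← ENNReal.div_eq_inv_mul, ENNReal.le_div_iff_mul_le (Or.inl hk0) (Or.inl hkt)]
    refine (mul_le_mul_right ((min_le_left _ _).trans hle) _).trans (le_of_eq ?_)
    rw [ENNReal.coe_inv ht0, ← mul_assoc, ENNReal.mul_inv_cancel ht0' ENNReal.coe_ne_top, one_mul]
  have h5 := hD u 0
  rw [GSDual.tfNorm, hg] at h5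
  refine (h5.trans (mul_le_mul_right (hmax.trans (mul_le_mul_right (hC u) _)) _)).trans
    (le_of_eq ?_)
  rw [ENNReal.coe_mul, ENNReal.coe_mul, ENNReal.coe_toNNReal (ENNReal.inv_ne_top.2 hk0)]
  ring

end ModulationNorm

/-! ### Density of test functions for finite exponents -/

section Density

open Filter
open scoped ENNReal

lemma tendsto_eLpNorm_zero_of_dominated {α : Type*} [MeasurableSpace α] {μ : Measure α} {p : ℝ≥0∞}
    (hp : p ≠ 0) (hp' : p ≠ ⊤) {f : ℕ → α → ℝ≥0∞} {D : α → ℝ≥0∞} (hf : ∀ j, Measurable (f j))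
    (hfD : ∀ j x, f j x ≤ D x) (hD : eLpNorm D p μ ≠ ⊤)
    (hlim : ∀ᵐ x ∂μ, Tendsto (fun j => f j x) atTop (𝓝 0)) :
    Tendsto (fun j => eLpNorm (f j) p μ) atTop (𝓝 0) := by
  have hr : 0 < p.toReal := ENNReal.toReal_pos hp hp'
  simp only [eLpNorm_eq_lintegral_rpow_enorm_toReal hp hp', enorm_eq_self] at hD ⊢
  have hD' : ∫⁻ x, D x ^ p.toReal ∂μ ≠ ⊤ := fun h => hD (by
    rw [h, ENNReal.top_rpow_of_pos (by positivity)])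
  have h1 := tendsto_lintegral_of_dominated_convergence (μ := μ) (fun x => D x ^ p.toReal)
    (F := fun j x => f j x ^ p.toReal) (f := fun _ => 0) (fun j => (hf j).pow_const _)
    (fun j => .of_forall fun x => ENNReal.rpow_le_rpow (hfD j x) hr.le) hD'
    (by
      filter_upwards [hlim] with x hx
      have := (ENNReal.continuous_rpow_const (y := p.toReal)).tendsto 0 |>.comp hx
      rwa [ENNReal.zero_rpow_of_pos hr] at this)
  have h2 := (ENNReal.continuous_rpow_const (y := 1 / p.toReal)).tendsto _ |>.comp h1
  rwa [lintegral_zero, ENNReal.zero_rpow_of_pos (by positivity)] at h2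

lemma tendsto_mixedENorm_zero_of_dominated {E : Type*} [MeasureSpace E]
    [SFinite (volume : Measure E)] {p q : ℝ≥0∞} (hp : p ≠ 0) (hp' : p ≠ ⊤) (hq : q ≠ 0)
    (hq' : q ≠ ⊤) {f : ℕ → E × E → ℝ≥0∞} {D : E × E → ℝ≥0∞} (hf : ∀ j, Measurable (f j))
    (hDm : Measurable D) (hfD : ∀ j Z, f j Z ≤ D Z) (hD : mixedENorm p q D ≠ ⊤)
    (hlim : ∀ Z, Tendsto (fun j => f j Z) atTop (𝓝 0)) :
    Tendsto (fun j => mixedENorm p q (f j)) atTop (𝓝 0) := by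
  have hgm : Measurable fun Ξ => eLpNorm (fun X => D (X, Ξ)) p volume :=
    measurable_eLpNorm_prod (H := fun X Ξ => D (X, Ξ)) hDm p
  refine tendsto_eLpNorm_zero_of_dominated hq hq'
    (fun j => measurable_eLpNorm_prod (H := fun X Ξ => f j (X, Ξ)) (hf j) p)
    (fun j Ξ => eLpNorm_mono_enorm fun X => hfD j (X, Ξ)) hD ?_
  -- Since q < ∞, a finite mixed norm makes the inner norm finite for almost every Ξ, where
  -- dominated convergence applies to the inner norm.
  have hfin : ∀ᵐ Ξ, eLpNorm (fun X => D (X, Ξ)) p volume ≠ ⊤ := by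
    have hr : 0 < q.toReal := ENNReal.toReal_pos hq hq'
    have h1 : ∫⁻ Ξ, eLpNorm (fun X => D (X, Ξ)) p volume ^ q.toReal ≠ ⊤ := by
      intro h
      refine hD ?_
      rw [mixedENorm, eLpNorm_eq_lintegral_rpow_enorm_toReal hq hq']
      simp only [enorm_eq_self]
      rw [h, ENNReal.top_rpow_of_pos (by positivity)]
    filter_upwards [ae_lt_top (hgm.pow_const _) h1] with Ξ hΞ h
    rw [h, ENNReal.top_rpow_of_pos hr] at hΞ
    exact lt_irrefl _ hΞ
  filter_upwards [hfin] with Ξ hΞ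
  exact tendsto_eLpNorm_zero_of_dominated hp hp' (fun j => (hf j).comp (by fun_prop))
    (fun j X => hfD j (X, Ξ)) hΞ (.of_forall fun X => hlim (X, Ξ))

lemma eLpNorm_exp_neg_mul_norm_ne_top {E : Type*} [NormedAddCommGroup E] [NormedSpace ℝ E]
    [FiniteDimensional ℝ E] [MeasurableSpace E] [BorelSpace E] (μ : Measure E)
    [μ.IsAddHaarMeasure] {c : ℝ} (hc : 0 < c) {p : ℝ≥0∞} (hp : p ≠ 0) :
    eLpNorm (fun x : E => ENNReal.ofReal (Real.exp (-(c * ‖x‖)))) p μ ≠ ⊤ := by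
  rcases eq_or_ne p ⊤ with rfl | hp'
  · rw [eLpNorm_exponent_top]
    refine ne_top_of_le_ne_top ENNReal.one_ne_top
      (eLpNormEssSup_le_of_ae_enorm_bound (.of_forall fun x => ?_))
    rw [enorm_eq_self, ENNReal.ofReal_le_one, Real.exp_le_one_iff]
    have : 0 ≤ c * ‖x‖ := by positivity
    linarith
  · have hr : 0 < p.toReal := ENNReal.toReal_pos hp hp'
    rw [eLpNorm_eq_lintegral_rpow_enorm_toReal hp hp']
    refine ENNReal.rpow_ne_top_of_nonneg (by positivity) ?_
    have := (integrable_exp_neg_mul_norm μ (show 0 < c * p.toReal by positivity)).lintegral_lt_top.ne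
    convert this using 3 with x
    rw [enorm_eq_self, ENNReal.ofReal_rpow_of_pos (Real.exp_pos _), ← Real.exp_mul]
    ring_nf

lemma mixedENorm_mul_le {E : Type*} [MeasureSpace E] {p q : ℝ≥0∞} {f g : E → ℝ≥0∞}
    (hf : eLpNorm f p volume ≠ ⊤) (hg : ∀ x, g x ≠ ⊤) :
    mixedENorm p q (fun Z => f Z.1 * g Z.2) ≤ eLpNorm f p volume * eLpNorm g q volume := by
  have h1 : ∀ Ξ, eLpNorm (fun X => f X * g Ξ) p volume ≤ g Ξ * eLpNorm f p volume := fun Ξ => by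
    rw [← ENNReal.coe_toNNReal (hg Ξ)]
    exact eLpNorm_le_mul_eLpNorm_of_ae_le_mul' (.of_forall fun X => by
      rw [enorm_eq_self, enorm_eq_self, mul_comm]) p
  have h2 := eLpNorm_le_mul_eLpNorm_of_ae_le_mul' (μ := volume)
    (f := fun Ξ => eLpNorm (fun X => f X * g Ξ) p volume) (g := g) (c := (eLpNorm f p volume).toNNReal)
    (.of_forall fun Ξ => by
      rw [enorm_eq_self, enorm_eq_self, ENNReal.coe_toNNReal hf, mul_comm]
      exact h1 Ξ) q
  rwa [ENNReal.coe_toNNReal hf] at h2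

variable {ι : Type*} [Fintype ι] [DecidableEq ι] {p q : ℝ≥0∞}
  {ω : EuclideanSpace ℝ ι × EuclideanSpace ℝ ι → ℝ}

/-- The Gaussian dominates e^{-(c+1)‖Z‖}, and ‖Z‖, being a maximum, is at least half of the sum of
the two norms. The separated form lets the mixed norm factor. -/
lemma exp_neg_sq_mul_exp_le {V W : Type*} [NormedAddCommGroup V] [NormedAddCommGroup W] {ε : ℝ}
    (hε : 0 < ε) (c : ℝ) (Z : V × W) :
    Real.exp (-(ε * ‖Z‖ ^ 2)) * Real.exp (c * ‖Z‖) ≤ Real.exp ((c + 1) ^ 2 / (4 * ε)) *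
      (Real.exp (-(1 / 2 * ‖Z.1‖)) * Real.exp (-(1 / 2 * ‖Z.2‖))) := by
  rw [← Real.exp_add, ← Real.exp_add, ← Real.exp_add]
  refine Real.exp_le_exp.2 ?_
  have k1 := norm_fst_le Z
  have k2 := norm_snd_le Z
  have k3 : (c + 1) ^ 2 / (4 * ε) - ((c + 1) * ‖Z‖ - ε * ‖Z‖ ^ 2) =
      (2 * ε * ‖Z‖ - (c + 1)) ^ 2 / (4 * ε) := by
    field_simp
    ring
  have k4 : 0 ≤ (2 * ε * ‖Z‖ - (c + 1)) ^ 2 / (4 * ε) := by positivity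
  linarith

lemma GSDual.exists_tfNorm_ofGS_mul_le {c : ℝ} (h0 : ∀ Z, 0 < ω Z)
    (hω : ∀ Z W, ω Z ≤ Real.exp (c * ‖Z - W‖) * ω W) (φ a : GSSpace (1 / 2) ι) :
    ∃ C : ℝ≥0, ∀ Z, (GSDual.ofGS a).tfNorm φ Z * ENNReal.ofReal (ω Z) ≤
      C * (ENNReal.ofReal (Real.exp (-(1 / 2 * ‖Z.1‖))) *
        ENNReal.ofReal (Real.exp (-(1 / 2 * ‖Z.2‖)))) := by
  obtain ⟨K, ε, hK, hε, hb⟩ := exists_norm_integral_mul_tfShift_le a φ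
  have hω0 := h0 0
  set C : ℝ := K * Real.exp ((c + 1) ^ 2 / (4 * ε)) * ω 0 with hC
  have hC0 : 0 ≤ C := by positivity
  refine ⟨C.toNNReal, fun Z => ?_⟩
  rw [ENNReal.ofNNReal_toNNReal, GSDual.tfNorm, ← ofReal_norm,
    ← ENNReal.ofReal_mul (norm_nonneg _), ← ENNReal.ofReal_mul (Real.exp_pos _).le,
    ← ENNReal.ofReal_mul hC0]
  refine ENNReal.ofReal_le_ofReal ?_
  have g1 : ‖(GSDual.ofGS a).pairing (tfWindow φ Z)‖ ≤ K * Real.exp (-(ε * ‖Z‖ ^ 2)) := hb Z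
  have g2 := hω Z 0
  rw [sub_zero] at g2
  calc _ ≤ (K * Real.exp (-(ε * ‖Z‖ ^ 2))) * (Real.exp (c * ‖Z‖) * ω 0) :=
        mul_le_mul g1 g2 (h0 Z).le (by positivity)
    _ = K * ω 0 * (Real.exp (-(ε * ‖Z‖ ^ 2)) * Real.exp (c * ‖Z‖)) := by ring
    _ ≤ K * ω 0 * (Real.exp ((c + 1) ^ 2 / (4 * ε)) *
      (Real.exp (-(1 / 2 * ‖Z.1‖)) * Real.exp (-(1 / 2 * ‖Z.2‖)))) :=
        mul_le_mul_of_nonneg_left (exp_neg_sq_mul_exp_le hε c Z) (by positivity)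
    _ = _ := by
      rw [hC]
      ring

/-- Functions of `𝒮_{1/2}` belong to all modulation spaces. -/
lemma IsModerate.modNorm_ofGS_lt_top (hω : IsModerate ω) (hp : p ≠ 0) (hq : q ≠ 0)
    (φ a : GSSpace (1 / 2) ι) : modNorm p q ω φ (GSDual.ofGS a) < ⊤ := by
  obtain ⟨ω', D, c, hD, hc, hcont, h1, h2, h3, h4⟩ := hω.exists_continuous
  obtain ⟨C, hC⟩ := GSDual.exists_tfNorm_ofGS_mul_le h3 h4 φ a
  refine (modNorm_le_mixedENorm (fun Z => (hω.1.1 Z).le) h1 φ _).trans_lt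
    (ENNReal.mul_lt_top ENNReal.coe_lt_top ?_)
  set e : EuclideanSpace ℝ ι → ℝ≥0∞ := fun x => ENNReal.ofReal (Real.exp (-(1 / 2 * ‖x‖))) with he
  have hfin : ∀ {r : ℝ≥0∞}, r ≠ 0 → eLpNorm e r volume ≠ ⊤ := fun hr =>
    eLpNorm_exp_neg_mul_norm_ne_top volume (by norm_num : (0 : ℝ) < 1 / 2) hr
  have hC' : mixedENorm p q (fun Z => (GSDual.ofGS a).tfNorm φ Z * ENNReal.ofReal (ω' Z)) ≤
      C * mixedENorm p q fun Z : EuclideanSpace ℝ ι × EuclideanSpace ℝ ι => e Z.1 * e Z.2 :=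
    mixedENorm_le_mul hC
  have hmul := mixedENorm_mul_le (p := p) (q := q) (f := e) (g := e) (hfin hp)
    fun _ => ENNReal.ofReal_ne_top
  exact hC'.trans_lt (ENNReal.mul_lt_top ENNReal.coe_lt_top (hmul.trans_lt
    (ENNReal.mul_lt_top (hfin hp).lt_top (hfin hq).lt_top)))

lemma GSDual.exists_tfNorm_ofGS_approx_le (φ ψ : GSSpace (1 / 2) ι) (N : ℝ) :
    ∃ C : ℝ≥0, ∀ (u : GSDual (1 / 2) ι) Z j,
      (GSDual.ofGS (u.approx ψ j)).tfNorm φ Z ≤ C * expMax N (u.tfNorm ψ) Z := by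
  obtain ⟨C, hC, h⟩ := exists_norm_ofGS_approx_pairing_le φ ψ N
  refine ⟨C.toNNReal + 1, fun u Z j => ?_⟩
  rcases eq_or_ne (expMax N (u.tfNorm ψ) Z) ⊤ with ht | ht
  · rw [ht, ENNReal.mul_top (by simp)]
    exact le_top
  have h1 := h u Z (expMax N (u.tfNorm ψ) Z).toReal ENNReal.toReal_nonneg (fun W => by
    have := le_expMax N (u.tfNorm ψ) Z W
    rw [GSDual.tfNorm, ← ofReal_norm] at this
    rw [← ENNReal.ofReal_le_ofReal_iff (by positivity), ENNReal.ofReal_mul ENNReal.toReal_nonneg,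
      ENNReal.ofReal_toReal ht]
    exact this) j
  rw [GSDual.tfNorm, ← ofReal_norm]
  refine (ENNReal.ofReal_le_ofReal h1).trans ?_
  rw [ENNReal.ofReal_mul hC, ENNReal.ofReal_toReal ht]
  gcongr
  exact ENNReal.coe_le_coe.2 (by simp)

/-- The functions of `𝒮_{1/2}` are dense in the modulation spaces with finite exponents. -/
lemma IsModerate.tendsto_modNorm_sub_approx (hω : IsModerate ω) (hp : p ≠ 0) (hp' : p ≠ ⊤)
    (hq : q ≠ 0) (hq' : q ≠ ⊤) {φ : GSSpace (1 / 2) ι} (hφ : φ ≠ 0) {u : GSDual (1 / 2) ι}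
    (hu : modNorm p q ω φ u < ⊤) :
    Tendsto (fun j => modNorm p q ω φ (GSDual.ofGS (u.approx φ j) - u)) atTop (𝓝 0) := by
  obtain ⟨ω', c, hc, hcont, h0, h1, h2, h3⟩ := hω.exists_mixedENorm_expMax_le_modNorm hp hq
  obtain ⟨C, hC⟩ := h3 φ hφ
  obtain ⟨D, hD⟩ := GSDual.exists_tfNorm_ofGS_approx_le φ φ (c + 1)
  set M := expMax (c + 1) (u.tfNorm φ) with hM
  -- The constant D accounts for the approximant and 1 for u; the majorant does not depend on j and
  -- has finite norm.
  have hle : ∀ j Z, (GSDual.ofGS (u.approx φ j) - u).tfNorm φ Z * ENNReal.ofReal (ω' Z) ≤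
      ((D + 1 : ℝ≥0) : ℝ≥0∞) * (M Z * ENNReal.ofReal (ω' Z)) := by
    intro j Z
    rw [← mul_assoc]
    refine mul_le_mul_left ?_ _
    rw [GSDual.tfNorm, GSDual.sub_pairing, ENNReal.coe_add, add_mul, ENNReal.coe_one, one_mul]
    refine (enorm_sub_le).trans (add_le_add (hD u Z j) ?_)
    have := le_expMax (c + 1) (u.tfNorm φ) Z Z
    rwa [sub_self, norm_zero, mul_zero, Real.exp_zero, ENNReal.ofReal_one, mul_one] at this
  have hωm : Measurable fun Z => ENNReal.ofReal (ω' Z) := hcont.measurable.ennreal_ofReal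
  have hlim := tendsto_mixedENorm_zero_of_dominated hp hp' hq hq'
    (f := fun j Z => (GSDual.ofGS (u.approx φ j) - u).tfNorm φ Z * ENNReal.ofReal (ω' Z))
    (D := fun Z => ((D + 1 : ℝ≥0) : ℝ≥0∞) * (M Z * ENNReal.ofReal (ω' Z)))
    (fun j => (GSDual.continuous_tfNorm _ φ).measurable.mul hωm)
    (((measurable_expMax _ _).mul hωm).const_mul _) hle
    (ne_top_of_le_ne_top (ENNReal.mul_ne_top ENNReal.coe_ne_top
      (ENNReal.mul_ne_top ENNReal.coe_ne_top hu.ne))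
      ((mixedENorm_le_mul fun Z => le_rfl).trans (mul_le_mul_right (hC u) _)))
    (fun Z => by
      have t1 := (u.tendsto_ofGS_approx hφ (tfWindow φ Z)).sub_const (u.pairing (tfWindow φ Z))
      rw [sub_self] at t1
      have t2 := t1.enorm
      rw [enorm_zero] at t2
      have t3 := ENNReal.Tendsto.mul_const t2 (b := ENNReal.ofReal (ω' Z))
        (Or.inr ENNReal.ofReal_ne_top)
      rwa [zero_mul] at t3)
  have hlim2 := ENNReal.Tendsto.const_mul hlim (a := (‖fourierConst ι‖₊ : ℝ≥0∞))
    (Or.inr ENNReal.coe_ne_top)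
  rw [mul_zero] at hlim2
  exact tendsto_of_tendsto_of_tendsto_of_le_of_le tendsto_const_nhds hlim2 (fun _ => zero_le)
    fun j => modNorm_le_mixedENorm (fun Z => (hω.1.1 Z).le) h1 φ _

end Density

/-! ### Convergence and continuity for the quasi-norm topology -/

section ModSpaceTopology

open Filter
open scoped ENNReal

variable {ι : Type*} [Fintype ι] [DecidableEq ι] {p q : ℝ≥0∞}
  {ω : EuclideanSpace ℝ ι × EuclideanSpace ℝ ι → ℝ} {φ : GSSpace (1 / 2) ι}

/-- Open sets contain balls about their points by definition, so neither a triangle inequality nor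
openness of balls is needed. -/
lemma ModSpace.tendsto_of_modNorm {u : ModSpace p q ω φ} {v : ℕ → ModSpace p q ω φ}
    (h : Tendsto (fun j => modNorm p q ω φ ((v j).1 - u.1)) atTop (𝓝 0)) :
    Tendsto v atTop (𝓝 u) := by
  refine tendsto_nhds.2 fun U hU hu => ?_
  obtain ⟨ε, hε, hb⟩ := hU u hu
  filter_upwards [h.eventually (gt_mem_nhds hε)] with j hj using hb _ hj

lemma IsModerate.continuous_pairing (hω : IsModerate ω) (hp : p ≠ 0) (hq : q ≠ 0) (hφ : φ ≠ 0)
    (g : GSSpace (1 / 2) ι) : Continuous fun u : ModSpace p q ω φ => u.1.pairing g := by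
  obtain ⟨C, hC⟩ := hω.exists_enorm_pairing_le hp hq hφ g
  refine continuous_def.2 fun U hU u hu => ?_
  obtain ⟨r, hr, hb⟩ := Metric.isOpen_iff.1 hU _ hu
  -- The divisor is C + 1 because C may vanish.
  refine ⟨ENNReal.ofReal r / (C + 1), ENNReal.div_pos (by simpa using hr) (by finiteness),
    fun v hv => hb ?_⟩
  rw [mem_ball_iff_norm, ← ENNReal.ofReal_lt_ofReal_iff hr, ofReal_norm, ← GSDual.sub_pairing]
  refine (hC _).trans_lt ?_
  rw [ENNReal.lt_div_iff_mul_lt (Or.inl (by simp)) (Or.inl (by finiteness)), mul_comm] at hv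
  exact lt_of_le_of_lt (mul_le_mul_left (by simp) _) hv

lemma ModSpace.continuous_of_modNorm_le {ω₂ : EuclideanSpace ℝ ι × EuclideanSpace ℝ ι → ℝ}
    {ψ : GSSpace (1 / 2) ι} {f : ModSpace p q ω φ → ModSpace p q ω₂ ψ} {C : ℝ≥0}
    (hf : ∀ u v, modNorm p q ω₂ ψ ((f v).1 - (f u).1) ≤ C * modNorm p q ω φ (v.1 - u.1)) :
    Continuous f := by
  refine continuous_def.2 fun U hU u hu => ?_
  obtain ⟨ε, hε, hb⟩ := hU _ hu
  refine ⟨min ε 1 / (C + 1), ENNReal.div_pos (by simpa using hε.ne') (by finiteness),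
    fun v hv => hb _ ?_⟩
  rw [ENNReal.lt_div_iff_mul_lt (Or.inl (by simp)) (Or.inl (by finiteness)), mul_comm] at hv
  exact ((hf u v).trans (mul_le_mul_left (by simp) _)).trans_lt (hv.trans_le (min_le_left _ _))

end ModSpaceTopology

/-! ### The chirp multiplier on modulation spaces -/

section Shear

open Filter
open scoped ENNReal

variable {ι : Type*} [Fintype ι] [DecidableEq ι] {B : EuclideanSpace ℝ ι →L[ℝ] EuclideanSpace ℝ ι}
  {p q : ℝ≥0∞} {ω : EuclideanSpace ℝ ι × EuclideanSpace ℝ ι → ℝ}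

/-- The weight `(X, Ξ) ↦ ω (X + B Ξ, Ξ)`. -/
def shearWeight (B : EuclideanSpace ℝ ι →L[ℝ] EuclideanSpace ℝ ι)
    (ω : EuclideanSpace ℝ ι × EuclideanSpace ℝ ι → ℝ) :
    EuclideanSpace ℝ ι × EuclideanSpace ℝ ι → ℝ :=
  fun Z => ω (Z.1 + B Z.2, Z.2)

lemma IsModerate.shearWeight (hω : IsModerate ω) (B : EuclideanSpace ℝ ι →L[ℝ] EuclideanSpace ℝ ι) :
    IsModerate (shearWeight B ω) := by
  set L : (EuclideanSpace ℝ ι × EuclideanSpace ℝ ι) ≃L[ℝ]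
      (EuclideanSpace ℝ ι × EuclideanSpace ℝ ι) :=
    ContinuousLinearEquiv.equivOfInverse
      ((ContinuousLinearMap.fst ℝ _ _ + B.comp (ContinuousLinearMap.snd ℝ _ _)).prod
        (ContinuousLinearMap.snd ℝ _ _))
      ((ContinuousLinearMap.fst ℝ _ _ - B.comp (ContinuousLinearMap.snd ℝ _ _)).prod
        (ContinuousLinearMap.snd ℝ _ _))
      (fun Z => by simp) (fun Z => by simp)
  exact hω.comp_equiv L

/-- At fixed Ξ the two integrands differ by a unimodular factor and the translation by BΞ, which the
L^p quasi-norm does not see. The identity is exact for the transformed window; window independence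
supplies all others. -/
lemma modNorm_dualOp (hB : ∀ x y, ⟪B x, y⟫ = ⟪x, B y⟫) (φ : GSSpace (1 / 2) ι)
    (u : GSDual (1 / 2) ι) :
    modNorm p q (shearWeight B ω) (gsOp B hB φ) (dualOp B hB u) = modNorm p q ω φ u := by
  unfold modNorm mixedNorm
  congr 1
  funext Ξ
  set f : EuclideanSpace ℝ ι → ℂ := fun X => u.stft (by norm_num) φ X Ξ * (ω (X, Ξ) : ℂ) with hf
  have h1 : eLpNorm (fun X => (dualOp B hB u).stft (by norm_num) (gsOp B hB φ) X Ξ *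
      (shearWeight B ω (X, Ξ) : ℂ)) p volume = eLpNorm (f ∘ fun X => X + B Ξ) p volume := by
    refine eLpNorm_congr_enorm_ae (.of_forall fun X => ?_)
    have hn : ‖Complex.exp (Complex.I * (⟪B Ξ, Ξ⟫ / 2 : ℝ))‖ₑ = 1 := by
      rw [← ofReal_norm, mul_comm, Complex.norm_exp_ofReal_mul_I, ENNReal.ofReal_one]
    rw [stft_dualOp, mul_assoc, enorm_mul, hn, one_mul]
    rfl
  rw [h1, ← (measurableEmbedding_addRight (B Ξ)).eLpNorm_map_measure,
    (measurePreserving_add_right volume (B Ξ)).map_eq]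

lemma gsOp_ne_zero (hB : ∀ x y, ⟪B x, y⟫ = ⟪x, B y⟫) {φ : GSSpace (1 / 2) ι} (hφ : φ ≠ 0) :
    gsOp B hB φ ≠ 0 := by
  intro h
  have := gsOp_neg_gsOp hB (fun x y => by simp [hB]) φ
  rw [h, map_zero] at this
  exact hφ this.symm

lemma IsModerate.exists_modNorm_dualOp_le (hω : IsModerate ω) (hp : p ≠ 0) (hq : q ≠ 0)
    (hB : ∀ x y, ⟪B x, y⟫ = ⟪x, B y⟫) {φ ψ : GSSpace (1 / 2) ι} (hφ : φ ≠ 0) (hψ : ψ ≠ 0) :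
    ∃ C : ℝ≥0, ∀ u : GSDual (1 / 2) ι,
      modNorm p q (_root_.shearWeight B ω) ψ (dualOp B hB u) ≤ C * modNorm p q ω φ u ∧
        modNorm p q ω φ u ≤ C * modNorm p q (_root_.shearWeight B ω) ψ (dualOp B hB u) := by
  obtain ⟨C, hC⟩ := (hω.shearWeight B).exists_modNorm_le hp hq ψ (gsOp_ne_zero hB hφ)
  obtain ⟨D, hD⟩ := (hω.shearWeight B).exists_modNorm_le hp hq (gsOp B hB φ) hψ
  refine ⟨max C D, fun u => ⟨?_, ?_⟩⟩
  · have := hC (dualOp B hB u)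
    rw [modNorm_dualOp] at this
    refine this.trans (mul_le_mul_left ?_ _)
    exact ENNReal.coe_le_coe.2 (le_max_left _ _)
  · have := hD (dualOp B hB u)
    rw [modNorm_dualOp] at this
    refine this.trans (mul_le_mul_left ?_ _)
    exact ENNReal.coe_le_coe.2 (le_max_right _ _)

/-- The operator `e^{i⟨B D, D⟩/2}` between modulation spaces. -/
lemma IsModerate.exists_homeomorph (hω : IsModerate ω) (hp : p ≠ 0) (hq : q ≠ 0)
    (hB : ∀ x y, ⟪B x, y⟫ = ⟪x, B y⟫) {φ ψ : GSSpace (1 / 2) ι} (hφ : φ ≠ 0) (hψ : ψ ≠ 0) :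
    ∃ H : ModSpace p q ω φ ≃ₜ ModSpace p q (_root_.shearWeight B ω) ψ,
      ∀ u, (H u).1 = dualOp B hB u.1 := by
  obtain ⟨C, hC⟩ := hω.exists_modNorm_dualOp_le hp hq hB hφ hψ
  have hB' : ∀ x y, ⟪(-B) x, y⟫ = ⟪x, (-B) y⟫ := fun x y => by simp [hB]
  have hinv : ∀ v, modNorm p q ω φ (dualOp (-B) hB' v) ≤
      C * modNorm p q (_root_.shearWeight B ω) ψ v := fun v => by
    have := (hC (dualOp (-B) hB' v)).2
    rwa [dualOp_dualOp_neg] at this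
  let H : ModSpace p q ω φ ≃ ModSpace p q (_root_.shearWeight B ω) ψ :=
    { toFun := fun u => ⟨dualOp B hB u.1, ((hC u.1).1).trans_lt
        (ENNReal.mul_lt_top ENNReal.coe_lt_top u.2)⟩
      invFun := fun v => ⟨dualOp (-B) hB' v.1, (hinv v.1).trans_lt
        (ENNReal.mul_lt_top ENNReal.coe_lt_top v.2)⟩
      left_inv := fun u => Subtype.ext (dualOp_neg_dualOp hB hB' u.1)
      right_inv := fun v => Subtype.ext (dualOp_dualOp_neg hB hB' v.1) }
  refine ⟨{ toEquiv := H
            continuous_toFun := ModSpace.continuous_of_modNorm_le (C := C) fun u v => ?_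
            continuous_invFun := ModSpace.continuous_of_modNorm_le (C := C) fun u v => ?_ },
    fun u => rfl⟩
  · change modNorm p q _ ψ (dualOp B hB v.1 - dualOp B hB u.1) ≤ _
    rw [← map_sub]
    exact (hC _).1
  · change modNorm p q ω φ (dualOp (-B) hB' v.1 - dualOp (-B) hB' u.1) ≤ _
    rw [← map_sub]
    exact hinv _

lemma GSSpace.mono {s t : ℝ} (hs : 0 ≤ s) (hst : s ≤ t) {f : EuclideanSpace ℝ ι → ℂ}
    (hf : f ∈ GSSpace s ι) : f ∈ GSSpace t ι := by
  obtain ⟨h1, h, hh, C, hC, hb⟩ := (mem_GSSpace_iff hs).1 hf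
  refine (mem_GSSpace_iff (hs.trans hst)).2 ⟨h1, h, hh, C, hC, fun k l x => (hb k l x).trans ?_⟩
  have hpos : ∀ n : ℕ, (1 : ℝ) ≤ n.factorial := fun n => by exact_mod_cast n.factorial_pos
  have := Real.rpow_le_rpow_of_exponent_le (hpos k) hst
  have := Real.rpow_le_rpow_of_exponent_le (hpos l) hst
  gcongr

/-- Continuous maps between modulation spaces that agree with `T` on `𝒮_{1/2}` are given by `T`. -/
lemma IsModerate.eq_of_forall_ofGS (hω : IsModerate ω) {ω₂ : EuclideanSpace ℝ ι × EuclideanSpace ℝ ι → ℝ}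
    (hω₂ : IsModerate ω₂) (hp : p ≠ 0) (hq : q ≠ 0) {φ ψ : GSSpace (1 / 2) ι} (hφ : φ ≠ 0)
    (hψ : ψ ≠ 0) {T : GSDual (1 / 2) ι → GSDual (1 / 2) ι} (hT : Continuous T)
    {R : ModSpace p q ω φ → ModSpace p q ω₂ ψ}
    (hR : Continuous[ModSpace.weakTop p q ω φ, ModSpace.weakTop p q ω₂ ψ] R ∨
      (p ≠ ⊤ ∧ q ≠ ⊤ ∧ Continuous R))
    (h : ∀ (a : GSSpace (1 / 2) ι) (u : ModSpace p q ω φ), u.1 = GSDual.ofGS a → (R u).1 = T u.1)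
    (u : ModSpace p q ω φ) : (R u).1 = T u.1 := by
  -- On these approximants R and T agree. They tend to u weakly for all exponents and in quasi-norm
  -- when p and q are finite, so either continuity hypothesis identifies the limits of their
  -- pairings with each g.
  set v : ℕ → ModSpace p q ω φ := fun j =>
    ⟨GSDual.ofGS (u.1.approx φ j), hω.modNorm_ofGS_lt_top hp hq φ _⟩ with hv
  have hweak : Tendsto (fun j => (v j).1) atTop (𝓝 u.1) := by
    rw [nhds_induced, tendsto_comap_iff]
    exact tendsto_pi_nhds.2 fun g => u.1.tendsto_ofGS_approx hφ g
  refine GSDual.ext fun g => ?_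
  have hTv : Tendsto (fun j => (R (v j)).1.pairing g) atTop (𝓝 ((T u.1).pairing g)) := by
    have h1 := (((_root_.continuous_pairing g).comp hT).tendsto u.1).comp hweak
    refine h1.congr fun j => ?_
    rw [h _ (v j) rfl]
    rfl
  refine tendsto_nhds_unique ?_ hTv
  rcases hR with hR | ⟨hp', hq', hR⟩
  · have h1 : Tendsto v atTop (@nhds _ (ModSpace.weakTop p q ω φ) u) := by
      rw [nhds_induced, tendsto_comap_iff]
      exact hweak
    have h2 : Continuous[ModSpace.weakTop p q ω φ, inferInstance] fun w => (R w).1.pairing g :=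
      @Continuous.comp _ _ _ (_) _ _ _ _ (_root_.continuous_pairing g)
        (@Continuous.comp _ _ _ (_) (_) _ _ _ continuous_induced_dom hR)
    exact (@Continuous.tendsto _ _ (_) _ _ h2 u).comp h1
  · have h1 : Tendsto v atTop (𝓝 u) :=
      ModSpace.tendsto_of_modNorm (hω.tendsto_modNorm_sub_approx hp hp' hq hq' hφ u.2)
    exact (((hω₂.continuous_pairing hp hq hψ g).comp hR).tendsto u).comp h1

end Shear

/-! ### The operator T_A as a chirp multiplier on phase space -/

section PhaseSpace

variable {d : ℕ}

lemma inner_phasePoint (x ξ : EuclideanSpace ℝ (Fin d)) (X : EuclideanSpace ℝ (Fin d ⊕ Fin d)) :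
    ⟪phasePoint x ξ, X⟫ = ⟪x, fstPart X⟫ + ⟪ξ, sndPart X⟫ := by
  simp [PiLp.inner_apply, phasePoint, fstPart, sndPart]

/-- The map `(η, y) ↦ (A y, A^* η)`. -/
noncomputable def phaseMap (A : Matrix (Fin d) (Fin d) ℝ) :
    EuclideanSpace ℝ (Fin d ⊕ Fin d) →L[ℝ] EuclideanSpace ℝ (Fin d ⊕ Fin d) :=
  LinearMap.toContinuousLinearMap
    { toFun := fun Ξ => phasePoint (A.toEuclideanLin (sndPart Ξ))
        (A.transpose.toEuclideanLin (fstPart Ξ))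
      map_add' := fun X Y => by
        have h1 : sndPart (X + Y) = sndPart X + sndPart Y := rfl
        have h2 : fstPart (X + Y) = fstPart X + fstPart Y := rfl
        rw [h1, h2, map_add, map_add]
        ext (i | i) <;> rfl
      map_smul' := fun c X => by
        have h1 : sndPart (c • X) = c • sndPart X := rfl
        have h2 : fstPart (c • X) = c • fstPart X := rfl
        rw [h1, h2, map_smul, map_smul]
        ext (i | i) <;> rfl }

lemma phaseMap_apply (A : Matrix (Fin d) (Fin d) ℝ) (Ξ : EuclideanSpace ℝ (Fin d ⊕ Fin d)) :
    phaseMap A Ξ = phasePoint (A.toEuclideanLin (sndPart Ξ))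
      (A.transpose.toEuclideanLin (fstPart Ξ)) := rfl

lemma inner_transpose_toEuclideanLin (A : Matrix (Fin d) (Fin d) ℝ)
    (x y : EuclideanSpace ℝ (Fin d)) :
    ⟪A.transpose.toEuclideanLin x, y⟫ = ⟪A.toEuclideanLin y, x⟫ := by
  rw [← Matrix.conjTranspose_eq_transpose_of_trivial, Matrix.toEuclideanLin_conjTranspose_eq_adjoint,
    LinearMap.adjoint_inner_left, real_inner_comm]

lemma phaseMap_symmetric (A : Matrix (Fin d) (Fin d) ℝ) (X Y : EuclideanSpace ℝ (Fin d ⊕ Fin d)) :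
    ⟪phaseMap A X, Y⟫ = ⟪X, phaseMap A Y⟫ := by
  rw [real_inner_comm (phaseMap A Y), phaseMap_apply, phaseMap_apply, inner_phasePoint,
    inner_phasePoint, inner_transpose_toEuclideanLin, inner_transpose_toEuclideanLin, add_comm]

/-- The blocks A and A^* contribute equally to the quadratic form, which accounts for the factor 1/2
in e^{i⟨BD, D⟩/2}. -/
lemma inner_phaseMap_self (A : Matrix (Fin d) (Fin d) ℝ) (Ξ : EuclideanSpace ℝ (Fin d ⊕ Fin d)) :
    ⟪phaseMap A Ξ, Ξ⟫ / 2 = ⟪A.toEuclideanLin (sndPart Ξ), fstPart Ξ⟫ := by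
  rw [phaseMap_apply, inner_phasePoint, inner_transpose_toEuclideanLin]
  ring

lemma expOp_eq_chirpOp (A : Matrix (Fin d) (Fin d) ℝ) {a : EuclideanSpace ℝ (Fin d ⊕ Fin d) → ℂ}
    {F : SchwartzMap (EuclideanSpace ℝ (Fin d ⊕ Fin d)) ℂ} (h : ⇑F = a) :
    expOp A a = chirpOp (phaseMap A) F := by
  rw [← unitaryFourierInv_chirp, expOp, ← h]
  simp only [inner_phaseMap_self]

lemma weightShear_eq (A : Matrix (Fin d) (Fin d) ℝ)
    (ω : EuclideanSpace ℝ (Fin d ⊕ Fin d) × EuclideanSpace ℝ (Fin d ⊕ Fin d) → ℝ) :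
    weightShear A ω = shearWeight (phaseMap A) ω := by
  funext Z
  rw [weightShear, shearWeight, phaseMap_apply]
  congr 2
  ext (i | i) <;> rfl

end PhaseSpace

theorem proposition3p8 (d : ℕ) (A : Matrix (Fin d) (Fin d) ℝ) (s : ℝ) (hs : 1 / 2 ≤ s)
    (p q : ENNReal) (hp : p ≠ 0) (hq : q ≠ 0) :
    -- `T_A` maps `𝒮_s(ℝ^{2d})` to itself
    (∀ a ∈ GSSpace s (Fin d ⊕ Fin d), expOp A a ∈ GSSpace s (Fin d ⊕ Fin d)) ∧
    -- the formula for the short-time Fourier transform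
    (∀ φ ∈ GSSpace s (Fin d ⊕ Fin d), ∀ a ∈ GSSpace s (Fin d ⊕ Fin d),
      ∀ x ξ η y : EuclideanSpace ℝ (Fin d),
        stft (expOp A φ) (expOp A a) (phasePoint x ξ) (phasePoint η y) =
          Complex.exp (Complex.I * (⟪A.toEuclideanLin y, η⟫ : ℝ)) *
            stft φ a (phasePoint (x + A.toEuclideanLin y) (ξ + A.transpose.toEuclideanLin η))
              (phasePoint η y)) ∧
    -- the extension of `T_A` to distributions and its restriction to modulation spaces
    ∃ T : GSDual (1 / 2) (Fin d ⊕ Fin d) →ₗ[ℂ] GSDual (1 / 2) (Fin d ⊕ Fin d),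
      Continuous T ∧
      (∀ a ∈ GSSpace s (Fin d ⊕ Fin d), ∀ u, u.IsFunction a → (T u).IsFunction (expOp A a)) ∧
      ∀ ω : EuclideanSpace ℝ (Fin d ⊕ Fin d) × EuclideanSpace ℝ (Fin d ⊕ Fin d) → ℝ,
        IsModerate ω →
        IsModerate (weightShear A ω) ∧
        -- `φ`, `ψ` are arbitrary windows for the two modulation spaces
        ∀ φ ψ : GSSpace (1 / 2) (Fin d ⊕ Fin d), φ ≠ 0 → ψ ≠ 0 →
          (∃ H : ModSpace p q ω φ ≃ₜ ModSpace p q (weightShear A ω) ψ,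
            (∀ u, (H u).1 = T u.1) ∧
            -- uniqueness of the extension
            ∀ R : ModSpace p q ω φ → ModSpace p q (weightShear A ω) ψ,
              (Continuous[ModSpace.weakTop p q ω φ, ModSpace.weakTop p q (weightShear A ω) ψ] R ∨
                (p ≠ ⊤ ∧ q ≠ ⊤ ∧ Continuous R)) →
              (∀ a ∈ GSSpace s (Fin d ⊕ Fin d), ∀ u, u.1.IsFunction a →
                (R u).1.IsFunction (expOp A a)) →
              R = H) ∧
          -- equivalence of the quasi-norms
          ∃ C : ℝ≥0, ∀ u,
            modNorm p q (weightShear A ω) ψ (T u) ≤ C * modNorm p q ω φ u ∧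
              modNorm p q ω φ u ≤ C * modNorm p q (weightShear A ω) ψ (T u) := by
  have hs0 : 0 ≤ s := by linarith
  have hB := phaseMap_symmetric A
  have hop : ∀ (a : GSSpace s (Fin d ⊕ Fin d)),
      expOp A a = chirpOp (phaseMap A) (GSSpace.toSchwartz hs0 a) := fun a =>
    expOp_eq_chirpOp A (GSSpace.coe_toSchwartz hs0 a)
  refine ⟨fun a ha => ?_, fun φ hφ a ha x ξ η y => ?_, dualOp (phaseMap A) hB,
    continuous_dualOp _ hB, fun a ha u hu => ?_, fun ω hω => ?_⟩
  · rw [hop ⟨a, ha⟩]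
    exact chirpOp_mem hs hB (by rw [GSSpace.coe_toSchwartz]; exact ha)
  · rw [hop ⟨a, ha⟩, hop ⟨φ, hφ⟩, stft_chirpOp hs0 hB
      (chirpOp_mem hs hB (by rw [GSSpace.coe_toSchwartz]; exact hφ)), inner_phaseMap_self,
      GSSpace.coe_toSchwartz, GSSpace.coe_toSchwartz]
    congr 2
    ext (i | i) <;> rfl
  · rw [hop ⟨a, ha⟩]
    exact dualOp_isFunction hs0 hB ⟨a, ha⟩ hu
  · rw [weightShear_eq]
    refine ⟨hω.shearWeight _, fun φ ψ hφ hψ => ⟨?_, hω.exists_modNorm_dualOp_le hp hq hB hφ hψ⟩⟩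
    obtain ⟨H, hH⟩ := hω.exists_homeomorph hp hq hB hφ hψ
    refine ⟨H, hH, fun R hR hRa => funext fun u => Subtype.ext ?_⟩
    rw [hH]
    refine hω.eq_of_forall_ofGS (hω.shearWeight _) hp hq hφ hψ (continuous_dualOp _ hB) hR
      (fun a v hv => ?_) u
    -- Agreement on 𝒮_s is used only on the smaller space 𝒮_{1/2}, which contains the approximants.
    have ha := GSSpace.mono (by norm_num) hs a.2
    have hva : v.1.IsFunction a := by
      rw [hv]
      exact GSDual.isFunction_ofGS a
    refine (hRa a ha v hva).eq ?_
    rw [hop ⟨a, ha⟩]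
    exact dualOp_isFunction hs0 hB ⟨a, ha⟩ hva
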